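/- Let $n\in\mathbb N$, $0<T<\infty$, let $\Lambda\subset\mathbb R$ and $\Omega\subset\mathbb R^n$ be open, $f:\Lambda\times\Omega\times[0,T]\to\mathbb R^n$, $g:\Omega\times[0,T]\to\mathbb R^n$, and let $h:[0,T]\to\mathbb R$ have bounded variation and be left-continuous on $(0,T]$. Let $\|\cdot\|$ be the Euclidean norm on $\mathbb R^n$ and the operator norm on $n\times n$ matrices (other norms give the same statement). Let $G[0,T]$ be the space of regulated functions $x:[0,T]\to\mathbb R^n$ (i.e. with finite one-sided limits $x(t-)$, $t\in(0,T]$, and $x(t+)$, $t\in[0,T)$) with the supremum norm $\|\cdot\|_\infty$, and let $B(x_0,\rho)$ be the closed ball in $G[0,T]$. Integrals with respect to $h$ and to $v(t)=\mathrm{var}_0^t h$ are Kurzweil--Stieltjes integrals. Primes with index $x$ denote total differentials with respect to $x$. **Solutions.** Consider the periodic problem $$Dx=f(\lambda,x,t)+g(x,t)\,.\,Dh,\qquad x(0)=x(T).\tag{P}$$ A pair $(x,\lambda)$ with $\lambda\in\Lambda$ and $x:[0,T]\to\mathbb R^n$ is a solution of (P) if $x$ has bounded variation, is left-continuous on $(0,T]$,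 $x(t)\in\Omega$ for all $t\in[0,T]$, $t\mapsto f(\lambda,x(t),t)$ is Lebesgue integrable, the integral $H(t)=\int_0^t g(x(s),s)\,dh(s)$ exists for $t\in[0,T]$, the identity $Dx=f(\lambda,x(\cdot),\cdot)+DH$ holds in the sense of distributions, i.e. when tested with all $C^\infty$ functions $\varphi:\mathbb R\to\mathbb R^n$ vanishing outside $(0,T)$, the jump relation $x(0+)=x(0)+g(x(0),0)\,(h(0+)-h(0))$ holds at the initial point, and $x(0)=x(T)$. **Assumptions.** 1. For $\lambda\in\Lambda$, $x\in\Omega$, $t\in[0,T]$: $f(\lambda,\cdot,t)$ is continuous on $\Omega$, $f(\lambda,x,\cdot)$ is Lebesgue measurable, and $\|f(\lambda,x,t)\|\le m(t)$ for a Lebesgue integrable $m:[0,T]\to[0,\infty)$ independent of $\lambda,x$. 2. $g(\cdot,t)$ is continuous on $\Omega$ for each $t\in[0,T]$, and $\|g(x,t)\|\le m_h(t)$ on $\Omega\times[0,T]$ for some $m_h:[0,T]\to[0,\infty)$ for which $\int_0^T m_h\,dv$ exists (and is finite). 3. $f'_x(\lambda,x,t)$ exists for all $(\lambda,x,t)\in\Lambda\times\Omega\times[0,T]$,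 is continuous in $x\in\Omega$ for fixed $\lambda,t$, and $\|f'_x(\lambda,x,t)\|\le\Theta(t)$ for some Lebesgue integrable $\Theta$. 4. $g'_x(x,t)$ exists for all $(x,t)\in\Omega\times[0,T]$, is bounded on $\Omega\times[0,T]$, is continuous in $x\in\Omega$ for fixed $t$, and $\|g'_x(x,t)\|\le\Theta_h(t)$ for some $\Theta_h:[0,T]\to\mathbb R$ for which $\int_0^T\Theta_h\,dv$ exists (and is finite). 5. $x_0\in G[0,T]$, $(x_0,\lambda)$ is a solution of (P) for every $\lambda\in\Lambda$, and $\rho>0$ is such that $x(t)\in\Omega$ for all $x\in B(x_0,\rho)$ and $t\in[0,T]$. 6. There is a nondecreasing $\gamma:[0,T]\to\mathbb R$ such that for every $\varepsilon>0$ there is $\delta>0$ with $$\Big\|\int_s^t[f(\lambda_2,x,r)-f(\lambda_1,x,r)]\,dr\Big\|\le\varepsilon\,|\gamma(t)-\gamma(s)|$$ for all $x\in\Omega$, $s,t\in[0,T]$ and $\lambda_1,\lambda_2\in\Lambda$ with $|\lambda_1-\lambda_2|<\delta$. 7. There is a nondecreasing $\widetilde\gamma:[0,T]\to\mathbb R$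 such that for every $\varepsilon>0$ there is $\delta>0$ such that, for all $s,t\in[0,T]$, $x,y\in\Omega$, $\lambda_1,\lambda_2\in\Lambda$ with $|\lambda_1-\lambda_2|+\|x-y\|<\delta$, the second integral below exists and $$\Big\|\int_s^t[f'_x(\lambda_1,x,r)-f'_x(\lambda_2,y,r)]\,dr+\int_s^t[g'_x(x,r)-g'_x(y,r)]\,dh(r)\Big\|\le\varepsilon\,|\widetilde\gamma(t)-\widetilde\gamma(s)|.$$ **Bifurcation.** Let $\lambda_0\in\Lambda$ be such that $(x_0,\lambda_0)$ is a bifurcation point of (P): every neighbourhood of $(x_0,\lambda_0)$ in $B(x_0,\rho)\times\Lambda$ contains a solution $(x,\lambda)$ of (P) with $x\neq x_0$. **Conclusion.** There exists $q\in G[0,T]$ such that the equation $$z(t)-z(T)-\int_0^t f'_x(\lambda_0,x_0(\tau),\tau)\,z(\tau)\,d\tau-\int_0^t g'_x(x_0(\tau),\tau)\,z(\tau)\,dh(\tau)=q(t),\qquad t\in[0,T],$$ has no solution $z\in G[0,T]$ (a solution being a $z$ for which all the integrals exist and the equality holds), and the corresponding homogeneous equation (with $q=0$) has at least one solution $z\in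 G[0,T]$ that is not identically zero. -/

import Mathlib

open Set Filter Topology MeasureTheory
open scoped ContDiff

noncomputable section

namespace MeasureDE

/-- `x` is regulated on `[a, b]`: it has a finite left limit at each point of `(a, b]` and a finite
right limit at each point of `[a, b)`. Functions on `[a, b]` are represented by functions on `ℝ`
of which only the values on `[a, b]` matter. -/
def RegulatedOn {F : Type*} [TopologicalSpace F] (x : ℝ → F) (a b : ℝ) : Prop :=
  (∀ t ∈ Ioc a b, ∃ l, Tendsto x (𝓝[<] t) (𝓝 l)) ∧
  (∀ t ∈ Ico a b, ∃ l, Tendsto x (𝓝[>] t) (𝓝 l))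

/-- Tagged partitions `a = t₀ ≤ t₁ ≤ … ≤ t_m = b` of `[a, b]` with tags `τ_j ∈ [t_j, t_{j+1}]`. -/
structure TaggedDivision (a b : ℝ) where
  m : ℕ
  pt : ℕ → ℝ
  tag : ℕ → ℝ
  pt_zero : pt 0 = a
  pt_last : pt m = b
  tag_mem : ∀ j < m, tag j ∈ Icc (pt j) (pt (j + 1))

/-- The tagged partition is `δ`-fine. -/
def TaggedDivision.IsFine {a b : ℝ} (P : TaggedDivision a b) (δ : ℝ → ℝ) : Prop :=
  ∀ j < P.m, Icc (P.pt j) (P.pt (j + 1)) ⊆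
    Ioo (P.tag j - δ (P.tag j)) (P.tag j + δ (P.tag j))

/-- The Stieltjes sum `∑ [h(t_{j+1}) - h(t_j)] G(τ_j)`. -/
def TaggedDivision.stieltjesSum {a b : ℝ} {F : Type*} [AddCommGroup F] [Module ℝ F]
    (P : TaggedDivision a b) (G : ℝ → F) (h : ℝ → ℝ) : F :=
  ∑ j ∈ Finset.range P.m, (h (P.pt (j + 1)) - h (P.pt j)) • G (P.tag j)

/-- The Kurzweil-Stieltjes integral `∫_a^b G dh` (where `a ≤ b`) exists and is equal to `I`. -/
def HasKSIntegral {F : Type*} [NormedAddCommGroup F] [NormedSpace ℝ F]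
    (G : ℝ → F) (h : ℝ → ℝ) (a b : ℝ) (I : F) : Prop :=
  a ≤ b ∧ ∀ ε > 0, ∃ δ : ℝ → ℝ, (∀ t ∈ Icc a b, 0 < δ t) ∧
    ∀ P : TaggedDivision a b, P.IsFine δ → ‖P.stieltjesSum G h - I‖ < ε

/-- The variation function `t ↦ var_0^t h` on `[0, T]`. -/
def varFun (T : ℝ) (h : ℝ → ℝ) (t : ℝ) : ℝ := variationOnFromTo h (Icc 0 T) 0 t

/-- `ℝⁿ`. -/
abbrev Vec (n : ℕ) := EuclideanSpace ℝ (Fin n)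

/-- The differential with respect to `x` of `f(λ, x, t)`. -/
def fx {n : ℕ} (f : ℝ → Vec n → ℝ → Vec n) (lam : ℝ) (x : Vec n) (t : ℝ) : Vec n →L[ℝ] Vec n :=
  fderiv ℝ (fun y => f lam y t) x

/-- The differential with respect to `x` of `g(x, t)`. -/
def gx {n : ℕ} (g : Vec n → ℝ → Vec n) (x : Vec n) (t : ℝ) : Vec n →L[ℝ] Vec n :=
  fderiv ℝ (fun y => g y t) x

/-! ### Conditions on the data -/

/-- `h` has bounded variation on `[0, T]` and is left-continuous on `(0, T]`. -/
def IntegratorCondition (T : ℝ) (h : ℝ → ℝ) : Prop :=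
  BoundedVariationOn h (Icc 0 T) ∧ ∀ t ∈ Ioc 0 T, ContinuousWithinAt h (Iic t) t

/-- Carathéodory conditions on `f`. -/
def CaratheodoryCondition {n : ℕ} (T : ℝ) (Lam : Set ℝ) (Om : Set (Vec n))
    (f : ℝ → Vec n → ℝ → Vec n) : Prop :=
  (∀ lam ∈ Lam, ∀ t ∈ Icc 0 T, ContinuousOn (fun x => f lam x t) Om) ∧
  (∀ lam ∈ Lam, ∀ x ∈ Om, AEMeasurable (f lam x) (volume.restrict (Icc 0 T))) ∧
  ∃ m : ℝ → ℝ, (∀ t ∈ Icc 0 T, 0 ≤ m t) ∧ IntegrableOn m (Icc 0 T) ∧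
    ∀ lam ∈ Lam, ∀ x ∈ Om, ∀ t ∈ Icc 0 T, ‖f lam x t‖ ≤ m t

/-- Conditions on `g`: continuity in `x` and a majorant integrable with respect to `var_0^t h`. -/
def StieltjesCondition {n : ℕ} (T : ℝ) (Om : Set (Vec n))
    (g : Vec n → ℝ → Vec n) (h : ℝ → ℝ) : Prop :=
  (∀ t ∈ Icc 0 T, ContinuousOn (fun x => g x t) Om) ∧
  ∃ m : ℝ → ℝ, (∀ t ∈ Icc 0 T, 0 ≤ m t) ∧ (∃ I, HasKSIntegral m (varFun T h) 0 T I) ∧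
    ∀ x ∈ Om, ∀ t ∈ Icc 0 T, ‖g x t‖ ≤ m t

/-- `f` has a total differential in `x`, continuous in `x`, with a Lebesgue integrable majorant. -/
def DiffConditionF {n : ℕ} (T : ℝ) (Lam : Set ℝ) (Om : Set (Vec n))
    (f : ℝ → Vec n → ℝ → Vec n) : Prop :=
  (∀ lam ∈ Lam, ∀ x ∈ Om, ∀ t ∈ Icc 0 T, DifferentiableAt ℝ (fun y => f lam y t) x) ∧
  (∀ lam ∈ Lam, ∀ t ∈ Icc 0 T, ContinuousOn (fun x => fx f lam x t) Om) ∧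
  ∃ θ : ℝ → ℝ, IntegrableOn θ (Icc 0 T) ∧
    ∀ lam ∈ Lam, ∀ x ∈ Om, ∀ t ∈ Icc 0 T, ‖fx f lam x t‖ ≤ θ t

/-- `g` has a bounded total differential in `x`, continuous in `x`, with a majorant which is
integrable with respect to `var_0^t h`. -/
def DiffConditionG {n : ℕ} (T : ℝ) (Om : Set (Vec n))
    (g : Vec n → ℝ → Vec n) (h : ℝ → ℝ) : Prop :=
  (∀ x ∈ Om, ∀ t ∈ Icc 0 T, DifferentiableAt ℝ (fun y => g y t) x) ∧
  (∃ C : ℝ, ∀ x ∈ Om, ∀ t ∈ Icc 0 T, ‖gx g x t‖ ≤ C) ∧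
  (∀ t ∈ Icc 0 T, ContinuousOn (fun x => gx g x t) Om) ∧
  ∃ θ : ℝ → ℝ, (∃ I, HasKSIntegral θ (varFun T h) 0 T I) ∧
    ∀ x ∈ Om, ∀ t ∈ Icc 0 T, ‖gx g x t‖ ≤ θ t

/-- Uniform continuity of the integrals of `f` in the parameter. -/
def ParameterCondition {n : ℕ} (T : ℝ) (Lam : Set ℝ) (Om : Set (Vec n))
    (f : ℝ → Vec n → ℝ → Vec n) : Prop :=
  ∃ γ : ℝ → ℝ, MonotoneOn γ (Icc 0 T) ∧ ∀ ε > 0, ∃ δ > 0,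
    ∀ x ∈ Om, ∀ s ∈ Icc 0 T, ∀ t ∈ Icc 0 T, s ≤ t →
    ∀ lam₁ ∈ Lam, ∀ lam₂ ∈ Lam, |lam₁ - lam₂| < δ →
      ‖∫ r in s..t, (f lam₂ x r - f lam₁ x r)‖ ≤ ε * (γ t - γ s)

/-- Uniform continuity of the integrals of the differentials of `f` and `g`; the Stieltjes
integral which occurs in the estimate is required to exist. -/
def DiffUniformCondition {n : ℕ} (T : ℝ) (Lam : Set ℝ) (Om : Set (Vec n))
    (f : ℝ → Vec n → ℝ → Vec n) (g : Vec n → ℝ → Vec n) (h : ℝ → ℝ) : Prop :=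
  ∃ γ : ℝ → ℝ, MonotoneOn γ (Icc 0 T) ∧ ∀ ε > 0, ∃ δ > 0,
    ∀ s ∈ Icc 0 T, ∀ t ∈ Icc 0 T, s ≤ t →
    ∀ x ∈ Om, ∀ y ∈ Om, ∀ lam₁ ∈ Lam, ∀ lam₂ ∈ Lam, |lam₁ - lam₂| + ‖x - y‖ < δ →
      ∃ J : Vec n →L[ℝ] Vec n, HasKSIntegral (fun r => gx g x r - gx g y r) h s t J ∧
        ‖(∫ r in s..t, (fx f lam₁ x r - fx f lam₂ y r)) + J‖ ≤ ε * (γ t - γ s)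

/-! ### Distributional solutions -/

/-- Test functions: smooth functions `ℝ → ℝⁿ` which vanish outside `(0, T)`. -/
def IsTestFunction {n : ℕ} (T : ℝ) (φ : ℝ → Vec n) : Prop :=
  ContDiff ℝ ∞ φ ∧ ∀ t, t ∉ Ioo 0 T → φ t = 0

/-- The action `⟨u, φ⟩ = ∫_0^T u(t) φ(t) dt` of the regular distribution given by `u`. -/
def pairing {n : ℕ} (T : ℝ) (u φ : ℝ → Vec n) : ℝ :=
  ∫ t in (0 : ℝ)..T, inner ℝ (u t) (φ t)

/-- The action `⟨Du, φ⟩ = -⟨u, φ'⟩` of the distributional derivative of `u`. -/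
def derivPairing {n : ℕ} (T : ℝ) (u φ : ℝ → Vec n) : ℝ := - pairing T u (deriv φ)

/-- `x` is a solution of `Dx = f(λ, x, t) + g(x, t) . Dh` on `[0, T]`: `x` has bounded variation,
is left-continuous on `(0, T]`, takes values in `Ω`, the product `g(x(t), t) . Dh` is defined as
the distributional derivative of the indefinite Kurzweil-Stieltjes integral
`H(t) = ∫_0^t g(x(s), s) dh(s)`, and the equation holds in the sense of distributions on `(0, T)`.
Since test functions vanish at `0`, the value `x(0)` is tied to the equation by the jump
relation `x(0+) = x(0) + g(x(0), 0) (h(0+) - h(0))`. -/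
def IsSolution {n : ℕ} (T : ℝ) (Om : Set (Vec n)) (f : ℝ → Vec n → ℝ → Vec n)
    (g : Vec n → ℝ → Vec n) (h : ℝ → ℝ) (lam : ℝ) (x : ℝ → Vec n) : Prop :=
  BoundedVariationOn x (Icc 0 T) ∧
  (∀ t ∈ Ioc 0 T, ContinuousWithinAt x (Iic t) t) ∧
  (∀ t ∈ Icc 0 T, x t ∈ Om) ∧
  IntegrableOn (fun t => f lam (x t) t) (Icc 0 T) ∧
  (∃ H : ℝ → Vec n,
    (∀ t ∈ Icc 0 T, HasKSIntegral (fun s => g (x s) s) h 0 t (H t)) ∧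
    ∀ φ : ℝ → Vec n, IsTestFunction T φ →
      derivPairing T x φ = pairing T (fun t => f lam (x t) t) φ + derivPairing T H φ) ∧
  Tendsto (fun t => x t - (h t - h 0) • g (x 0) 0) (𝓝[>] 0) (𝓝 (x 0))

/-- Solutions of the periodic problem. -/
def IsPeriodicSolution {n : ℕ} (T : ℝ) (Om : Set (Vec n)) (f : ℝ → Vec n → ℝ → Vec n)
    (g : Vec n → ℝ → Vec n) (h : ℝ → ℝ) (lam : ℝ) (x : ℝ → Vec n) : Prop :=
  IsSolution T Om f g h lam x ∧ x 0 = x T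

/-- `x` belongs to the closed ball `B(x₀, ρ)` of the space of functions regulated on `[0, T]`
with the supremum norm. -/
def MemBall {n : ℕ} (T : ℝ) (x₀ : ℝ → Vec n) (ρ : ℝ) (x : ℝ → Vec n) : Prop :=
  RegulatedOn x 0 T ∧ ∀ t ∈ Icc 0 T, ‖x t - x₀ t‖ ≤ ρ

/-- `x₀` is a regulated periodic solution for every parameter, and all functions of the
ball `B(x₀, ρ)` have their values in `Ω`. -/
def TrivialBranch {n : ℕ} (T : ℝ) (Lam : Set ℝ) (Om : Set (Vec n))
    (f : ℝ → Vec n → ℝ → Vec n) (g : Vec n → ℝ → Vec n) (h : ℝ → ℝ)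
    (x₀ : ℝ → Vec n) (ρ : ℝ) : Prop :=
  RegulatedOn x₀ 0 T ∧ (∀ lam ∈ Lam, IsPeriodicSolution T Om f g h lam x₀) ∧
  ∀ x : ℝ → Vec n, MemBall T x₀ ρ x → ∀ t ∈ Icc 0 T, x t ∈ Om

/-- `(x₀, λ₀)` is a bifurcation point of the periodic problem: it is a solution and each of its
neighbourhoods in `B(x₀, ρ) × Λ` contains a solution `(x, λ)` with `x ≠ x₀`. -/
def IsBifurcationPoint {n : ℕ} (T : ℝ) (Lam : Set ℝ) (Om : Set (Vec n))
    (f : ℝ → Vec n → ℝ → Vec n) (g : Vec n → ℝ → Vec n) (h : ℝ → ℝ) (ρ : ℝ)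
    (x₀ : ℝ → Vec n) (lam₀ : ℝ) : Prop :=
  RegulatedOn x₀ 0 T ∧ lam₀ ∈ Lam ∧ IsPeriodicSolution T Om f g h lam₀ x₀ ∧
  ∀ ε > 0, ∃ lam ∈ Lam, ∃ x : ℝ → Vec n,
    MemBall T x₀ ρ x ∧ |lam - lam₀| < ε ∧ (∀ t ∈ Icc 0 T, ‖x t - x₀ t‖ < ε) ∧
    IsPeriodicSolution T Om f g h lam x ∧ ∃ t ∈ Icc 0 T, x t ≠ x₀ t

/-- `z` is a regulated solution on `[0, T]` of
`z(t) - z(T) - ∫_0^t A(τ) z(τ) dτ - ∫_0^t B(τ) z(τ) dh(τ) = q(t)`, with Kurzweil-Stieltjes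
integrals. -/
def IsLinearSolution {n : ℕ} (T : ℝ) (A B : ℝ → Vec n →L[ℝ] Vec n) (h : ℝ → ℝ)
    (q z : ℝ → Vec n) : Prop :=
  RegulatedOn z 0 T ∧ ∀ t ∈ Icc 0 T, ∃ I J : Vec n,
    HasKSIntegral (fun τ => A τ (z τ)) (fun τ => τ) 0 t I ∧
    HasKSIntegral (fun τ => B τ (z τ)) h 0 t J ∧
    z t - z T - I - J = q t

end MeasureDE

end

/-!
Let `(x_k, l_k)` be nontrivial solutions converging to `(x₀, lam₀)`. The difference quotients
`z_k = (x_k - x₀) / ‖x_k(τ_k) - x₀(τ_k)‖`, with `τ_k` chosen so that the denominator is at least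
half of `‖x_k - x₀‖_∞`, are bounded by `2`, and by the mean value theorem their increments are
dominated by those of one nondecreasing function. Hence a subsequence converges uniformly, and
its limit is a nonzero solution of the linearized homogeneous problem: the Stieltjes integrals are
Lebesgue integrals up to the sign of `dh`, so dominated convergence applies, and the uniform
continuity of the integrals of `f'_x` makes `f'_x(l_k, ·, t)` converge locally uniformly for almost
every `t`.

A solution of the linear equation is determined by its value at `0`. If the linear problem were
solvable for every constant right-hand side `c = z(0) - z(T)`, then `z(0) ↦ z(0) - z(T)` would be a
surjective, hence injective, map of `ℝⁿ`, and the homogeneous problem would have only the zero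
solution.
-/

namespace MeasureDE

/-! ### Gauges adapted to an integrable function -/

section Gauge

variable {X : Type*} [PseudoMetricSpace X] [MeasurableSpace X] [BorelSpace X]
  (μ : Measure X) [IsFiniteMeasure μ]

-- `φ` is squeezed between a lower and an upper semicontinuous function, and semicontinuity
-- provides the gauge.
lemma exists_gauge_abs_sub_le {φ : X → ℝ} (hφ : Integrable φ μ) {ε : ℝ} (hε : 0 < ε) :
    ∃ δ W : X → ℝ, (∀ τ, 0 < δ τ) ∧ Integrable W μ ∧ ∫ x, W x ∂μ ≤ ε ∧
      ∀ᵐ x ∂μ, ∀ τ, dist x τ < δ τ → |φ x - φ τ| ≤ W x := by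
  obtain ⟨l, hφl, hl, hl_int, hl_top, hl_le⟩ :=
    exists_lt_lowerSemicontinuous_integral_lt φ hφ (half_pos hε)
  obtain ⟨u, huφ, hu, hu_int, hu_bot, hu_ge⟩ :=
    exists_upperSemicontinuous_lt_integral_gt φ hφ (half_pos hε)
  have squeezed (τ : X) : ∃ δ > 0, ∀ x, dist x τ < δ → u x < φ τ ∧ φ τ < l x :=
    Metric.eventually_nhds_iff.1 ((hu τ _ (huφ τ)).and (hl τ _ (hφl τ)))
  choose δ hδ squeezed using squeezed
  refine ⟨δ, fun x => (l x).toReal - (u x).toReal, hδ, hl_int.sub hu_int, ?_, ?_⟩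
  · rw [integral_sub hl_int hu_int]
    linarith
  · filter_upwards [hl_top, hu_bot] with x hx_top hx_bot τ hτ
    have lt_toReal {r : ℝ} (hr : (r : EReal) < l x) : r < (l x).toReal := by
      rwa [← EReal.coe_toReal hx_top.ne (EReal.bot_lt_coe r |>.trans hr).ne', EReal.coe_lt_coe_iff]
        at hr
    have toReal_lt {r : ℝ} (hr : u x < r) : (u x).toReal < r := by
      rwa [← EReal.coe_toReal (hr.trans (EReal.coe_lt_top r)).ne hx_bot.ne', EReal.coe_lt_coe_iff]
        at hr
    rw [abs_le]
    constructor <;> linarith [lt_toReal (hφl x), toReal_lt (huφ x),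
      lt_toReal (squeezed τ x hτ).2, toReal_lt (squeezed τ x hτ).1]

variable {F : Type*} [NormedAddCommGroup F] [NormedSpace ℝ F]

-- For a continuous function the claim is trivial; the distance `ψ` of `φ` to a continuous
-- function is real-valued and has a small integral.
lemma exists_gauge_norm_sub_le {φ : X → F} (hφ : Integrable φ μ) {ε : ℝ} (hε : 0 < ε) :
    ∃ δ W : X → ℝ, (∀ τ, 0 < δ τ) ∧ Integrable W μ ∧ ∫ x, W x ∂μ ≤ ε ∧
      ∀ᵐ x ∂μ, ∀ τ, dist x τ < δ τ → ‖φ x - φ τ‖ ≤ W x := by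
  obtain ⟨g, hg_le, hg⟩ :=
    hφ.exists_boundedContinuous_integral_sub_le (ε := ε / 8) (by positivity)
  set ψ : X → ℝ := fun x => ‖φ x - g x‖
  have hψ : Integrable ψ μ := (hφ.sub hg).norm
  obtain ⟨δ₁, W, hδ₁, hW, hW_le, hψW⟩ := exists_gauge_abs_sub_le μ hψ (half_pos hε)
  set η : ℝ := ε / (4 * (μ.real univ + 1))
  have hη : 0 < η := by positivity
  have hημ : μ.real univ * η ≤ ε / 4 := by
    rw [mul_div_assoc', div_le_iff₀ (by positivity)]
    nlinarith [measureReal_nonneg (μ := μ) (s := univ)]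
  have g_near (τ : X) : ∃ δ > 0, ∀ x, dist x τ < δ → dist (g x) (g τ) < η :=
    Metric.continuous_iff.1 g.continuous τ η hη
  choose δ₂ hδ₂ g_near using g_near
  refine ⟨fun τ => min (δ₁ τ) (δ₂ τ), fun x => 2 * ψ x + η + W x,
    fun τ => lt_min (hδ₁ τ) (hδ₂ τ), by fun_prop, ?_, ?_⟩
  · rw [integral_add (by fun_prop) hW, integral_add (by fun_prop) (by fun_prop),
      integral_const_mul, integral_const, smul_eq_mul]
    linarith
  · filter_upwards [hψW] with x hx τ hτ
    have h₁ := (abs_le.1 (hx τ (hτ.trans_le (min_le_left _ _)))).1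
    have h₂ := (g_near τ x (hτ.trans_le (min_le_right _ _))).le
    rw [dist_eq_norm] at h₂
    calc ‖φ x - φ τ‖ = ‖φ x - g x + (g x - g τ) - (φ τ - g τ)‖ := by congr 1; abel
      _ ≤ ψ x + ‖g x - g τ‖ + ψ τ := (norm_sub_le _ _).trans (by gcongr; exact norm_add_le _ _)
      _ ≤ 2 * ψ x + η + W x := by linarith

end Gauge

/-! ### Sums over tagged divisions -/

namespace TaggedDivision

variable {a b c : ℝ} {F : Type*} [NormedAddCommGroup F]

/-- The sum `∑ U(τ_j, t_j, t_{j+1})` of a function `U` of a tag and two endpoints, which covers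
Stieltjes sums as well as their error terms. -/
def sum (P : TaggedDivision a b) (U : ℝ → ℝ → ℝ → F) : F :=
  ∑ j ∈ Finset.range P.m, U (P.tag j) (P.pt j) (P.pt (j + 1))

lemma stieltjesSum_eq_sum [NormedSpace ℝ F] (P : TaggedDivision a b) (G : ℝ → F) (h : ℝ → ℝ) :
    P.stieltjesSum G h = P.sum fun τ s t => (h t - h s) • G τ := rfl

lemma pt_le_succ (P : TaggedDivision a b) {j : ℕ} (hj : j < P.m) : P.pt j ≤ P.pt (j + 1) :=
  (P.tag_mem j hj).1.trans (P.tag_mem j hj).2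

lemma pt_mono (P : TaggedDivision a b) {i j : ℕ} (hij : i ≤ j) (hj : j ≤ P.m) :
    P.pt i ≤ P.pt j := by
  induction j, hij using Nat.le_induction with
  | base => exact le_rfl
  | succ k _ ih => exact (ih (by omega)).trans (P.pt_le_succ (by omega))

lemma left_le_pt (P : TaggedDivision a b) {j : ℕ} (hj : j ≤ P.m) : a ≤ P.pt j := by
  simpa [P.pt_zero] using P.pt_mono (Nat.zero_le j) hj

lemma pt_le_right (P : TaggedDivision a b) {j : ℕ} (hj : j ≤ P.m) : P.pt j ≤ b := by
  have := P.pt_mono hj le_rfl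
  rwa [P.pt_last] at this

lemma tag_mem_Icc (P : TaggedDivision a b) {j : ℕ} (hj : j < P.m) : P.tag j ∈ Icc a b :=
  ⟨(P.left_le_pt hj.le).trans (P.tag_mem j hj).1, (P.tag_mem j hj).2.trans (P.pt_le_right hj)⟩

/-- The division of a degenerate interval without subintervals. -/
def nil (a : ℝ) : TaggedDivision a a := ⟨0, fun _ => a, fun _ => a, rfl, rfl, by simp⟩

/-- The division with a single subinterval. -/
def single {a b τ : ℝ} (hτ : τ ∈ Icc a b) : TaggedDivision a b where
  m := 1
  pt j := if j = 0 then a else b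
  tag _ := τ
  pt_zero := by simp
  pt_last := by simp
  tag_mem := by
    intro j hj
    obtain rfl : j = 0 := by omega
    simpa using hτ

/-- Concatenation of divisions of adjacent intervals. -/
def append (P : TaggedDivision a b) (Q : TaggedDivision b c) : TaggedDivision a c where
  m := P.m + Q.m
  pt j := if j ≤ P.m then P.pt j else Q.pt (j - P.m)
  tag j := if j < P.m then P.tag j else Q.tag (j - P.m)
  pt_zero := by simp [P.pt_zero]
  pt_last := by
    by_cases h : Q.m = 0
    · have := Q.pt_zero
      rw [← h, Q.pt_last] at this
      simp [h, P.pt_last, this]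
    · simp [h, Q.pt_last]
  tag_mem := by
    intro j hj
    by_cases h1 : j < P.m
    · simpa [h1, h1.le, Nat.succ_le_of_lt h1] using P.tag_mem j h1
    · obtain ⟨k, rfl⟩ := Nat.exists_eq_add_of_le (not_lt.1 h1)
      have := Q.tag_mem k (by omega)
      by_cases hk : k = 0
      · subst hk
        simpa [P.pt_last, Q.pt_zero] using this
      · simpa [hk, add_assoc] using this

lemma sum_nil (U : ℝ → ℝ → ℝ → F) : (nil a).sum U = 0 := by simp [sum, nil]

lemma sum_single {τ : ℝ} (hτ : τ ∈ Icc a b) (U : ℝ → ℝ → ℝ → F) :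
    (single hτ).sum U = U τ a b := by simp [sum, single]

lemma append_tag_left (P : TaggedDivision a b) (Q : TaggedDivision b c) {j : ℕ} (hj : j < P.m) :
    (P.append Q).tag j = P.tag j := by simp [append, hj]

lemma append_pt_left (P : TaggedDivision a b) (Q : TaggedDivision b c) {j : ℕ} (hj : j ≤ P.m) :
    (P.append Q).pt j = P.pt j := by simp [append, hj]

lemma append_tag_right (P : TaggedDivision a b) (Q : TaggedDivision b c) (j : ℕ) :
    (P.append Q).tag (P.m + j) = Q.tag j := by simp [append]

lemma append_pt_right (P : TaggedDivision a b) (Q : TaggedDivision b c) (j : ℕ) :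
    (P.append Q).pt (P.m + j) = Q.pt j := by
  by_cases hj : j = 0
  · subst hj
    simp [append, P.pt_last, Q.pt_zero]
  · simp [append, hj]

lemma sum_append (P : TaggedDivision a b) (Q : TaggedDivision b c) (U : ℝ → ℝ → ℝ → F) :
    (P.append Q).sum U = P.sum U + Q.sum U := by
  have hm : (P.append Q).m = P.m + Q.m := rfl
  rw [sum, hm, Finset.sum_range_add]
  congr 1
  · refine Finset.sum_congr rfl fun j hj => ?_
    have hj := Finset.mem_range.1 hj
    rw [append_tag_left _ _ hj, append_pt_left _ _ hj.le, append_pt_left _ _ (by omega)]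
  · refine Finset.sum_congr rfl fun j _ => ?_
    rw [append_tag_right, append_pt_right, add_assoc, append_pt_right]

lemma isFine_nil (δ : ℝ → ℝ) : (nil a).IsFine δ := by simp [IsFine, nil]

lemma isFine_single {τ : ℝ} (hτ : τ ∈ Icc a b) {δ : ℝ → ℝ}
    (h : Icc a b ⊆ Ioo (τ - δ τ) (τ + δ τ)) : (single hτ).IsFine δ := by
  intro j hj
  obtain rfl : j = 0 := by simpa [single] using hj
  simpa [single] using h

lemma IsFine.append {P : TaggedDivision a b} {Q : TaggedDivision b c} {δ : ℝ → ℝ}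
    (hP : P.IsFine δ) (hQ : Q.IsFine δ) : (P.append Q).IsFine δ := by
  intro j hj
  by_cases h1 : j < P.m
  · rw [append_tag_left _ _ h1, append_pt_left _ _ h1.le, append_pt_left _ _ (by omega)]
    exact hP j h1
  · obtain ⟨k, rfl⟩ := Nat.exists_eq_add_of_le (not_lt.1 h1)
    rw [append_tag_right, append_pt_right, add_assoc, append_pt_right]
    exact hQ k (by change P.m + k < P.m + Q.m at hj; omega)

lemma IsFine.mono {P : TaggedDivision a b} {δ δ' : ℝ → ℝ} (hP : P.IsFine δ)
    (h : ∀ t ∈ Icc a b, δ t ≤ δ' t) : P.IsFine δ' := by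
  intro j hj x hx
  have h1 := hP j hj hx
  have h2 := h _ (P.tag_mem_Icc hj)
  exact ⟨by linarith [h1.1], by linarith [h1.2]⟩

lemma sum_add (P : TaggedDivision a b) (U V : ℝ → ℝ → ℝ → F) :
    P.sum (fun τ s t => U τ s t + V τ s t) = P.sum U + P.sum V := Finset.sum_add_distrib

lemma sum_sub (P : TaggedDivision a b) (U V : ℝ → ℝ → ℝ → F) :
    P.sum (fun τ s t => U τ s t - V τ s t) = P.sum U - P.sum V := Finset.sum_sub_distrib _ _

lemma sum_increment (P : TaggedDivision a b) (H : ℝ → F) :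
    P.sum (fun _ s t => H t - H s) = H b - H a := by
  have := Finset.sum_range_sub (fun j => H (P.pt j)) P.m
  rwa [P.pt_last, P.pt_zero] at this

lemma IsFine.sum_le_sum {P : TaggedDivision a b} {δ : ℝ → ℝ} (hP : P.IsFine δ)
    {U V : ℝ → ℝ → ℝ → ℝ}
    (h : ∀ τ s t, a ≤ s → s ≤ τ → τ ≤ t → t ≤ b → τ - δ τ < s → t < τ + δ τ → U τ s t ≤ V τ s t) :
    P.sum U ≤ P.sum V := by
  refine Finset.sum_le_sum fun j hj => ?_
  have hj := Finset.mem_range.1 hj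
  have hs := hP j hj (left_mem_Icc.2 (P.pt_le_succ hj))
  have ht := hP j hj (right_mem_Icc.2 (P.pt_le_succ hj))
  exact h _ _ _ (P.left_le_pt hj.le) (P.tag_mem j hj).1 (P.tag_mem j hj).2 (P.pt_le_right hj)
    hs.1 ht.2

lemma norm_sum_le (P : TaggedDivision a b) (U : ℝ → ℝ → ℝ → F) :
    ‖P.sum U‖ ≤ P.sum fun τ s t => ‖U τ s t‖ := _root_.norm_sum_le _ _

lemma sum_mul_left (P : TaggedDivision a b) (c : ℝ) (U : ℝ → ℝ → ℝ → ℝ) :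
    P.sum (fun τ s t => c * U τ s t) = c * P.sum U := (Finset.mul_sum _ _ _).symm

/-- Cousin's lemma. -/
theorem exists_isFine (hab : a ≤ b) {δ : ℝ → ℝ} (hδ : ∀ t ∈ Icc a b, 0 < δ t) :
    ∃ P : TaggedDivision a b, P.IsFine δ := by
  let S : Set ℝ := {t | t ∈ Icc a b ∧ ∃ P : TaggedDivision a t, P.IsFine δ}
  have haS : a ∈ S := ⟨left_mem_Icc.2 hab, nil a, isFine_nil δ⟩
  have hS : BddAbove S := ⟨b, fun t ht => ht.1.2⟩
  set u := sSup S
  have hub : u ≤ b := csSup_le ⟨a, haS⟩ fun t ht => ht.1.2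
  have hδu := hδ u ⟨le_csSup hS haS, hub⟩
  obtain ⟨t, htS, htu⟩ := exists_lt_of_lt_csSup ⟨a, haS⟩ (show u - δ u < sSup S by linarith)
  obtain ⟨P, hP⟩ := htS.2
  have htu' : t ≤ u := le_csSup hS htS
  have extend (r : ℝ) (hur : u ≤ r) (hr : r < u + δ u) :
      ∃ Q : TaggedDivision a r, Q.IsFine δ :=
    ⟨P.append (single ⟨htu', hur⟩), hP.append (isFine_single _ fun x hx =>
      ⟨by linarith [hx.1], by linarith [hx.2]⟩)⟩
  rcases hub.eq_or_lt with hub | hub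
  · rw [← hub]
    exact extend u le_rfl (by linarith)
  · obtain ⟨r, hur, hr⟩ : ∃ r, u < r ∧ r < min b (u + δ u) :=
      exists_between (lt_min hub (by linarith))
    have hrS : r ∈ S := ⟨⟨htS.1.1.trans (htu'.trans hur.le), (hr.trans_le (min_le_left _ _)).le⟩,
      extend r hur.le (hr.trans_le (min_le_right _ _))⟩
    exact absurd (le_csSup hS hrS) (not_le.2 hur)

lemma exists_isFine_sum_le_sum {δ : ℝ → ℝ} {U : ℝ → ℝ → ℝ → ℝ} {p : ℕ → ℝ} (c : ℕ → ℝ) {N : ℕ}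
    (hp : p 0 = a) (hpN : p N = b)
    (h : ∀ j < N, ∃ Q : TaggedDivision (p j) (p (j + 1)), Q.IsFine δ ∧ c j ≤ Q.sum U) :
    ∃ P : TaggedDivision a b, P.IsFine δ ∧ ∑ j ∈ Finset.range N, c j ≤ P.sum U := by
  subst hp hpN
  induction N with
  | zero => exact ⟨nil _, isFine_nil δ, by simp [sum_nil]⟩
  | succ N ih =>
    obtain ⟨P, hP, hcP⟩ := ih fun j hj => h j (by omega)
    obtain ⟨Q, hQ, hcQ⟩ := h N (by omega)
    refine ⟨P.append Q, hP.append hQ, ?_⟩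
    rw [Finset.sum_range_succ, sum_append]
    exact add_le_add hcP hcQ

-- Replace the subintervals on which `U` is negative by fine divisions with almost nonnegative sums.
lemma IsFine.sum_posPart_le {δ : ℝ → ℝ} {U : ℝ → ℝ → ℝ → ℝ} {ε : ℝ}
    (hU : ∀ P : TaggedDivision a b, P.IsFine δ → P.sum U ≤ ε)
    (h_sub : ∀ s t, a ≤ s → s ≤ t → t ≤ b → ∀ η > 0,
      ∃ Q : TaggedDivision s t, Q.IsFine δ ∧ -η ≤ Q.sum U)
    {P : TaggedDivision a b} (hP : P.IsFine δ) :
    P.sum (fun τ s t => max (U τ s t) 0) ≤ ε := by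
  refine le_of_forall_pos_le_add fun ε' hε' => ?_
  set η : ℝ := ε' / (P.m + 1)
  have hη : 0 < η := by positivity
  obtain ⟨Q, hQ, hPQ⟩ := exists_isFine_sum_le_sum (δ := δ) (U := U)
    (fun j => max (U (P.tag j) (P.pt j) (P.pt (j + 1))) 0 - η) P.pt_zero P.pt_last fun j hj => by
      rcases le_total 0 (U (P.tag j) (P.pt j) (P.pt (j + 1))) with hUj | hUj
      · refine ⟨single (P.tag_mem j hj), isFine_single _ (hP j hj), ?_⟩
        rw [sum_single, max_eq_left hUj]
        linarith
      · obtain ⟨Q, hQ, hQU⟩ := h_sub _ _ (P.left_le_pt hj.le) (P.pt_le_succ hj) (P.pt_le_right hj)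
          η hη
        exact ⟨Q, hQ, by rw [max_eq_right hUj]; linarith⟩
  rw [Finset.sum_sub_distrib, Finset.sum_const, Finset.card_range, nsmul_eq_mul] at hPQ
  have hmη : P.m * η ≤ ε' := by
    rw [mul_div_assoc', div_le_iff₀ (by positivity)]
    nlinarith
  rw [sum]
  linarith [hU Q hQ]

end TaggedDivision

/-! ### The Kurzweil–Stieltjes integral -/

section KSIntegral

open TaggedDivision

variable {a b c : ℝ} {F F' : Type*} [NormedAddCommGroup F] [NormedSpace ℝ F]
  [NormedAddCommGroup F'] [NormedSpace ℝ F'] {G G' : ℝ → F} {h : ℝ → ℝ} {I J : F}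

namespace HasKSIntegral

theorem unique (hI : HasKSIntegral G h a b I) (hJ : HasKSIntegral G h a b J) : I = J := by
  refine eq_of_norm_sub_le_zero (le_of_forall_pos_le_add fun ε hε => ?_)
  obtain ⟨δ₁, hδ₁, h₁⟩ := hI.2 (ε / 2) (half_pos hε)
  obtain ⟨δ₂, hδ₂, h₂⟩ := hJ.2 (ε / 2) (half_pos hε)
  obtain ⟨P, hP⟩ := exists_isFine hI.1 (δ := fun t => min (δ₁ t) (δ₂ t))
    fun t ht => lt_min (hδ₁ t ht) (hδ₂ t ht)
  have hPI := h₁ P (hP.mono fun t _ => min_le_left _ _)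
  have hPJ := h₂ P (hP.mono fun t _ => min_le_right _ _)
  rw [norm_sub_rev] at hPI
  linarith [norm_sub_le_norm_sub_add_norm_sub I (P.stieltjesSum G h) J]

theorem eq_zero (hI : HasKSIntegral G h a a I) : I = 0 := by
  refine norm_le_zero_iff.1 (le_of_forall_gt fun ε hε => ?_)
  obtain ⟨δ, -, hδ⟩ := hI.2 ε hε
  simpa [stieltjesSum_eq_sum, sum_nil] using hδ (nil a) (isFine_nil δ)

theorem sub_left (hI : HasKSIntegral G h a b I) (hJ : HasKSIntegral G h a c J) (hbc : b ≤ c) :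
    HasKSIntegral G h b c (J - I) := by
  refine ⟨hbc, fun ε hε => ?_⟩
  obtain ⟨δ₁, hδ₁, h₁⟩ := hI.2 (ε / 2) (half_pos hε)
  obtain ⟨δ₂, hδ₂, h₂⟩ := hJ.2 (ε / 2) (half_pos hε)
  refine ⟨δ₂, fun t ht => hδ₂ t ⟨hI.1.trans ht.1, ht.2⟩, fun P hP => ?_⟩
  obtain ⟨Q, hQ⟩ := exists_isFine hI.1 (δ := fun t => min (δ₁ t) (δ₂ t))
    fun t ht => lt_min (hδ₁ t ht) (hδ₂ t ⟨ht.1, ht.2.trans hbc⟩)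
  have hQI := h₁ Q (hQ.mono fun t _ => min_le_left _ _)
  have hQPJ := h₂ (Q.append P) ((hQ.mono fun t _ => min_le_right _ _).append hP)
  rw [stieltjesSum_eq_sum, sum_append, ← stieltjesSum_eq_sum, ← stieltjesSum_eq_sum] at hQPJ
  calc ‖P.stieltjesSum G h - (J - I)‖
      = ‖(Q.stieltjesSum G h + P.stieltjesSum G h - J) - (Q.stieltjesSum G h - I)‖ := by
        congr 1; abel
    _ ≤ _ := norm_sub_le _ _
    _ < ε := by linarith

theorem const (hab : a ≤ b) (v : F) : HasKSIntegral (fun _ => v) h a b ((h b - h a) • v) := by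
  refine ⟨hab, fun ε hε => ⟨fun _ => 1, fun _ _ => one_pos, fun P _ => ?_⟩⟩
  have h_sum : P.stieltjesSum (fun _ => v) h = (h b - h a) • v := by
    rw [← P.sum_increment, stieltjesSum, TaggedDivision.sum, Finset.sum_smul]
  rwa [h_sum, sub_self, norm_zero]

theorem add (hI : HasKSIntegral G h a b I) (hJ : HasKSIntegral G' h a b J) :
    HasKSIntegral (fun t => G t + G' t) h a b (I + J) := by
  refine ⟨hI.1, fun ε hε => ?_⟩
  obtain ⟨δ₁, hδ₁, h₁⟩ := hI.2 (ε / 2) (half_pos hε)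
  obtain ⟨δ₂, hδ₂, h₂⟩ := hJ.2 (ε / 2) (half_pos hε)
  refine ⟨fun t => min (δ₁ t) (δ₂ t), fun t ht => lt_min (hδ₁ t ht) (hδ₂ t ht), fun P hP => ?_⟩
  have hPI := h₁ P (hP.mono fun t _ => min_le_left _ _)
  have hPJ := h₂ P (hP.mono fun t _ => min_le_right _ _)
  have h_sum : P.stieltjesSum (fun t => G t + G' t) h =
      P.stieltjesSum G h + P.stieltjesSum G' h := by
    simp only [stieltjesSum, smul_add, Finset.sum_add_distrib]
  rw [h_sum, add_sub_add_comm]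
  exact (norm_add_le _ _).trans_lt (by linarith)

theorem clm_comp (hI : HasKSIntegral G h a b I) (L : F →L[ℝ] F') :
    HasKSIntegral (fun t => L (G t)) h a b (L I) := by
  refine ⟨hI.1, fun ε hε => ?_⟩
  obtain ⟨δ, hδ, hP⟩ := hI.2 (ε / (‖L‖ + 1)) (by positivity)
  refine ⟨δ, hδ, fun P hPδ => ?_⟩
  have h_sum : P.stieltjesSum (fun t => L (G t)) h = L (P.stieltjesSum G h) := by
    simp only [stieltjesSum, map_sum, map_smul]
  rw [h_sum, ← map_sub]
  have hlt := hP P hPδ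
  rw [lt_div_iff₀ (by positivity)] at hlt
  nlinarith [L.le_opNorm (P.stieltjesSum G h - I), norm_nonneg (P.stieltjesSum G h - I)]

theorem const_smul (hI : HasKSIntegral G h a b I) (r : ℝ) :
    HasKSIntegral (fun t => r • G t) h a b (r • I) := by
  simpa using hI.clm_comp (r • ContinuousLinearMap.id ℝ F)

theorem sub (hI : HasKSIntegral G h a b I) (hJ : HasKSIntegral G' h a b J) :
    HasKSIntegral (fun t => G t - G' t) h a b (I - J) := by
  simpa [sub_eq_add_neg] using hI.add (hJ.const_smul (-1))

theorem norm_le {θ m : ℝ → ℝ} {K : ℝ} (hI : HasKSIntegral G h a b I)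
    (hK : HasKSIntegral θ m a b K)
    (hle : ∀ s τ t, a ≤ s → s ≤ τ → τ ≤ t → t ≤ b → |h t - h s| * ‖G τ‖ ≤ (m t - m s) * θ τ) :
    ‖I‖ ≤ K := by
  refine le_of_forall_pos_le_add fun ε hε => ?_
  obtain ⟨δ₁, hδ₁, h₁⟩ := hI.2 (ε / 2) (half_pos hε)
  obtain ⟨δ₂, hδ₂, h₂⟩ := hK.2 (ε / 2) (half_pos hε)
  obtain ⟨P, hP⟩ := exists_isFine hI.1 (δ := fun t => min (δ₁ t) (δ₂ t))
    fun t ht => lt_min (hδ₁ t ht) (hδ₂ t ht)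
  have hPI := h₁ P (hP.mono fun t _ => min_le_left _ _)
  have hPK := (abs_lt.1 (h₂ P (hP.mono fun t _ => min_le_right _ _))).2
  have hsum : ‖P.stieltjesSum G h‖ ≤ P.stieltjesSum θ m := by
    rw [stieltjesSum_eq_sum, stieltjesSum_eq_sum]
    refine (P.norm_sum_le _).trans (hP.sum_le_sum fun τ s t hs hsτ hτt ht _ _ => ?_)
    rw [norm_smul, Real.norm_eq_abs]
    exact hle s τ t hs hsτ hτt ht
  have htri := norm_sub_norm_le I (P.stieltjesSum G h)
  rw [norm_sub_rev] at htri
  linarith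

end HasKSIntegral

/-- `H` is the indefinite Kurzweil–Stieltjes integral of `G` with respect to `h` on `[a, b]`,
normalized by `H a = 0`. -/
def HasKSPrimitive (G : ℝ → F) (h : ℝ → ℝ) (a b : ℝ) (H : ℝ → F) : Prop :=
  ∀ t ∈ Icc a b, HasKSIntegral G h a t (H t)

namespace HasKSPrimitive

variable {H : ℝ → F}

theorem hasKSIntegral (hH : HasKSPrimitive G h a b H) {s t : ℝ} (hs : a ≤ s) (hst : s ≤ t)
    (ht : t ≤ b) : HasKSIntegral G h s t (H t - H s) :=
  (hH s ⟨hs, hst.trans ht⟩).sub_left (hH t ⟨hs.trans hst, ht⟩) hst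

theorem left_eq_zero (hH : HasKSPrimitive G h a b H) (hab : a ≤ b) : H a = 0 :=
  (hH a (left_mem_Icc.2 hab)).eq_zero

theorem norm_sub_le {θ m : ℝ → ℝ} {K : ℝ → ℝ} (hH : HasKSPrimitive G h a b H)
    (hK : HasKSPrimitive θ m a b K)
    (hle : ∀ s τ t, a ≤ s → s ≤ τ → τ ≤ t → t ≤ b → |h t - h s| * ‖G τ‖ ≤ (m t - m s) * θ τ)
    {s t : ℝ} (hs : a ≤ s) (hst : s ≤ t) (ht : t ≤ b) : ‖H t - H s‖ ≤ K t - K s :=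
  (hH.hasKSIntegral hs hst ht).norm_le (hK.hasKSIntegral hs hst ht) fun _ _ _ h₁ h₂ h₃ h₄ =>
    hle _ _ _ (hs.trans h₁) h₂ h₃ (h₄.trans ht)

-- Complete the subinterval by fine divisions to its left and right with almost exact sums.
lemma exists_gauge_norm_sub_le (hH : HasKSPrimitive G h a b H) (hab : a ≤ b) {ε : ℝ}
    (hε : 0 < ε) :
    ∃ δ : ℝ → ℝ, (∀ t ∈ Icc a b, 0 < δ t) ∧ ∀ s τ t, a ≤ s → s ≤ τ → τ ≤ t → t ≤ b →
      τ - δ τ < s → t < τ + δ τ → ‖H t - H s - (h t - h s) • G τ‖ < ε := by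
  obtain ⟨δ, hδ, hb⟩ := (hH b (right_mem_Icc.2 hab)).2 (ε / 3) (by positivity)
  refine ⟨δ, hδ, fun s τ t hs hsτ hτt ht hδs hδt => ?_⟩
  have hst := hsτ.trans hτt
  have hτ : τ ∈ Icc s t := ⟨hsτ, hτt⟩
  have exact_on (r u : ℝ) (hr : a ≤ r) (hru : r ≤ u) (hu : u ≤ b) :
      ∃ Q : TaggedDivision r u, Q.IsFine δ ∧
        ‖Q.sum (fun τ s t => (h t - h s) • G τ) - (H u - H r)‖ < ε / 3 := by
    obtain ⟨δ', hδ', hQ⟩ := (hH.hasKSIntegral hr hru hu).2 (ε / 3) (by positivity)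
    obtain ⟨Q, hQδ⟩ := exists_isFine hru (δ := fun t => min (δ t) (δ' t))
      fun t ht => lt_min (hδ t ⟨hr.trans ht.1, ht.2.trans hu⟩) (hδ' t ht)
    exact ⟨Q, hQδ.mono fun t _ => min_le_left _ _, hQ Q (hQδ.mono fun t _ => min_le_right _ _)⟩
  obtain ⟨Q₁, hQ₁, h₁⟩ := exact_on a s le_rfl hs (hst.trans ht)
  obtain ⟨Q₂, hQ₂, h₂⟩ := exact_on t b (hs.trans hst) ht le_rfl
  have hsum := hb ((Q₁.append (single hτ)).append Q₂) ((hQ₁.append (isFine_single hτ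
    fun x hx => ⟨hδs.trans_le hx.1, hx.2.trans_lt hδt⟩)).append hQ₂)
  rw [stieltjesSum_eq_sum, sum_append, sum_append, sum_single] at hsum
  rw [hH.left_eq_zero hab] at h₁
  set S₁ := Q₁.sum fun τ s t => (h t - h s) • G τ
  set S₂ := Q₂.sum fun τ s t => (h t - h s) • G τ
  calc ‖H t - H s - (h t - h s) • G τ‖
      = ‖(S₁ - (H s - 0)) + (S₂ - (H b - H t)) - (S₁ + (h t - h s) • G τ + S₂ - H b)‖ := by
        congr 1; abel
    _ ≤ ‖S₁ - (H s - 0)‖ + ‖S₂ - (H b - H t)‖ + ‖S₁ + (h t - h s) • G τ + S₂ - H b‖ :=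
        (_root_.norm_sub_le _ _).trans (by gcongr; exact norm_add_le _ _)
    _ < ε := by linarith

theorem tendsto_left (hH : HasKSPrimitive G h a b H) {t : ℝ} (ht : t ∈ Ioc a b) :
    Tendsto (fun s => H t - H s - (h t - h s) • G t) (𝓝[<] t) (𝓝 0) := by
  rw [Metric.tendsto_nhds]
  intro ε hε
  obtain ⟨δ, hδ, hle⟩ := hH.exists_gauge_norm_sub_le (ht.1.le.trans ht.2) hε
  have hδt := hδ t (Ioc_subset_Icc_self ht)
  filter_upwards [Ioo_mem_nhdsLT (show max a (t - δ t) < t from max_lt ht.1 (by linarith))]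
    with s hs
  rw [dist_zero_right]
  exact hle s t t ((le_max_left _ _).trans hs.1.le) hs.2.le le_rfl ht.2
    ((le_max_right _ _).trans_lt hs.1) (by linarith)

theorem tendsto_right (hH : HasKSPrimitive G h a b H) {t : ℝ} (ht : t ∈ Ico a b) :
    Tendsto (fun s => H s - H t - (h s - h t) • G t) (𝓝[>] t) (𝓝 0) := by
  rw [Metric.tendsto_nhds]
  intro ε hε
  obtain ⟨δ, hδ, hle⟩ := hH.exists_gauge_norm_sub_le (ht.1.trans ht.2.le) hε
  have hδt := hδ t (Ico_subset_Icc_self ht)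
  filter_upwards [Ioo_mem_nhdsGT (show t < min b (t + δ t) from lt_min ht.2 (by linarith))]
    with s hs
  rw [dist_zero_right]
  exact hle t t s ht.1 le_rfl hs.1.le (hs.2.le.trans (min_le_left _ _)) (by linarith)
    (hs.2.trans_le (min_le_right _ _))

theorem continuousWithinAt_Iic (hH : HasKSPrimitive G h a b H) {t : ℝ} (ht : t ∈ Ioc a b)
    (hh : ContinuousWithinAt h (Iic t) t) : ContinuousWithinAt H (Iic t) t := by
  rw [← continuousWithinAt_Iio_iff_Iic] at hh ⊢
  have hincr : Tendsto (fun s => (h t - h s) • G t) (𝓝[<] t) (𝓝 0) := by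
    simpa using ((tendsto_const_nhds (x := h t)).sub hh.tendsto).smul_const (G t)
  simpa [ContinuousWithinAt] using
    (tendsto_const_nhds (x := H t)).sub ((hH.tendsto_left ht).add hincr)

theorem saks_henstock {G H : ℝ → ℝ} (hH : HasKSPrimitive G h a b H) (hab : a ≤ b) {ε : ℝ}
    (hε : 0 < ε) :
    ∃ δ : ℝ → ℝ, (∀ t ∈ Icc a b, 0 < δ t) ∧ ∀ P : TaggedDivision a b, P.IsFine δ →
      P.sum (fun τ s t => |(h t - h s) * G τ - (H t - H s)|) ≤ ε := by
  obtain ⟨δ, hδ, hP⟩ := (hH b (right_mem_Icc.2 hab)).2 (ε / 2) (half_pos hε)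
  let U (τ s t : ℝ) : ℝ := (h t - h s) * G τ - (H t - H s)
  have sum_U {r u : ℝ} (Q : TaggedDivision r u) : Q.sum U = Q.stieltjesSum G h - (H u - H r) := by
    rw [stieltjesSum_eq_sum, ← Q.sum_increment, ← sum_sub]
    rfl
  have abs_sum_U (P : TaggedDivision a b) (hPδ : P.IsFine δ) : |P.sum U| < ε / 2 := by
    rw [sum_U, hH.left_eq_zero hab, sub_zero]
    exact hP P hPδ
  have sum_U_small (s t : ℝ) (hs : a ≤ s) (hst : s ≤ t) (ht : t ≤ b) (η : ℝ) (hη : 0 < η) :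
      ∃ Q : TaggedDivision s t, Q.IsFine δ ∧ |Q.sum U| < η := by
    obtain ⟨δ', hδ', hQ⟩ := (hH.hasKSIntegral hs hst ht).2 η hη
    obtain ⟨Q, hQδ⟩ := exists_isFine hst (δ := fun t => min (δ t) (δ' t))
      fun r hr => lt_min (hδ r ⟨hs.trans hr.1, hr.2.trans ht⟩) (hδ' r hr)
    refine ⟨Q, hQδ.mono fun t _ => min_le_left _ _, ?_⟩
    rw [sum_U]
    exact hQ Q (hQδ.mono fun t _ => min_le_right _ _)
  have sum_neg_U {r u : ℝ} (Q : TaggedDivision r u) :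
      Q.sum (fun τ s t => -U τ s t) = -Q.sum U := Finset.sum_neg_distrib ..
  refine ⟨δ, hδ, fun P hPδ => ?_⟩
  have hpos : P.sum (fun τ s t => max (U τ s t) 0) ≤ ε / 2 :=
    hPδ.sum_posPart_le (fun P hPδ => (abs_lt.1 (abs_sum_U P hPδ)).2.le)
      fun s t hs hst ht η hη => (sum_U_small s t hs hst ht η hη).imp fun Q hQ =>
        ⟨hQ.1, (abs_lt.1 hQ.2).1.le⟩
  have hneg : P.sum (fun τ s t => max (-U τ s t) 0) ≤ ε / 2 :=
    hPδ.sum_posPart_le (fun P hPδ => by rw [sum_neg_U]; linarith [(abs_lt.1 (abs_sum_U P hPδ)).1])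
      fun s t hs hst ht η hη => (sum_U_small s t hs hst ht η hη).imp fun Q hQ =>
        ⟨hQ.1, by rw [sum_neg_U]; linarith [(abs_lt.1 hQ.2).2]⟩
  calc P.sum (fun τ s t => |U τ s t|)
      = P.sum (fun τ s t => max (U τ s t) 0 + max (-U τ s t) 0) := by
        simp only [max_zero_add_max_neg_zero_eq_abs_self]
    _ ≤ ε := by rw [sum_add]; linarith

end HasKSPrimitive

end KSIntegral

/-! ### Stieltjes integrals as Lebesgue integrals -/

section SetIntegral

variable {a b : ℝ} {μ : Measure ℝ} {F : Type*} [NormedAddCommGroup F] [NormedSpace ℝ F]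

lemma setIntegral_Ico_sub {f : ℝ → F} (hf : IntegrableOn f (Ico a b) μ) {s t : ℝ} (hs : a ≤ s)
    (hst : s ≤ t) (ht : t ≤ b) :
    (∫ x in Ico a t, f x ∂μ) - ∫ x in Ico a s, f x ∂μ = ∫ x in Ico s t, f x ∂μ := by
  rw [← Ico_union_Ico_eq_Ico hs hst, setIntegral_union Ico_disjoint_Ico_same measurableSet_Ico
    (hf.mono_set (Ico_subset_Ico_right (hst.trans ht))) (hf.mono_set (Ico_subset_Ico hs ht)),
    add_sub_cancel_left]

lemma measureReal_Ico_sub [IsFiniteMeasure μ] {s t : ℝ} (hs : a ≤ s) (hst : s ≤ t) :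
    μ.real (Ico a t) - μ.real (Ico a s) = μ.real (Ico s t) := by
  rw [← Ico_union_Ico_eq_Ico hs hst, measureReal_union Ico_disjoint_Ico_same measurableSet_Ico,
    add_sub_cancel_left]

lemma norm_setIntegral_sub_smul_le [CompleteSpace F] [IsFiniteMeasure μ] {s : Set ℝ} {φ : ℝ → F}
    (hφ : IntegrableOn φ s μ) (v : F) :
    ‖(∫ x in s, φ x ∂μ) - μ.real s • v‖ ≤ ∫ x in s, ‖φ x - v‖ ∂μ := by
  rw [← setIntegral_const, ← integral_sub hφ (integrable_const v)]
  exact norm_integral_le_integral_norm _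

open TaggedDivision in
lemma exists_gauge_sum_integral_norm_sub_le [IsFiniteMeasure μ] {φ : ℝ → F}
    (hφ : IntegrableOn φ (Ico a b) μ) {ε : ℝ} (hε : 0 < ε) :
    ∃ δ : ℝ → ℝ, (∀ τ, 0 < δ τ) ∧ ∀ P : TaggedDivision a b, P.IsFine δ →
      P.sum (fun τ s t => ∫ x in Ico s t, ‖φ x - φ τ‖ ∂μ) ≤ ε := by
  obtain ⟨δ, W, hδ, hW, hW_le, hφW⟩ :=
    MeasureDE.exists_gauge_norm_sub_le (μ.restrict (Ico a b)) hφ hε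
  refine ⟨δ, hδ, fun P hP => ?_⟩
  let w : ℝ → ℝ := fun t => ∫ x in Ico a t, W x ∂μ
  calc P.sum (fun τ s t => ∫ x in Ico s t, ‖φ x - φ τ‖ ∂μ)
      ≤ P.sum (fun _ s t => w t - w s) := by
        refine hP.sum_le_sum fun τ s t hs hsτ hτt ht hδs hδt => ?_
        have hsub : Ico s t ⊆ Ico a b := Ico_subset_Ico hs ht
        rw [setIntegral_Ico_sub hW hs (hsτ.trans hτt) ht]
        refine integral_mono_ae ((hφ.mono_set hsub).sub (integrable_const _)).norm
          (IntegrableOn.mono_set hW hsub) ?_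
        filter_upwards [ae_restrict_of_ae_restrict_of_subset hsub hφW,
          ae_restrict_mem measurableSet_Ico] with x hx hxI
        exact hx τ (abs_lt.2 ⟨by linarith [hxI.1], by linarith [hxI.2]⟩)
    _ = ∫ x in Ico a b, W x ∂μ := by simp [P.sum_increment, w]
    _ ≤ ε := hW_le

end SetIntegral

/-- The increments of `h` on `[a, b]` are the integrals of a sign `σ` with respect to `μ`, i.e.
`σ • μ` is the polar decomposition of the Stieltjes measure of `h`. -/
structure IsPolar (a b : ℝ) (h : ℝ → ℝ) (μ : Measure ℝ) (σ : ℝ → ℝ) : Prop where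
  isFiniteMeasure : IsFiniteMeasure μ
  measurable : Measurable σ
  abs_eq_one : ∀ x, |σ x| = 1
  sub_eq : ∀ s t, a ≤ s → s ≤ t → t ≤ b → h t - h s = ∫ x in Ico s t, σ x ∂μ

lemma exists_sign_integral_totalVariation_eq {X : Type*} [MeasurableSpace X]
    (κ : SignedMeasure X) :
    ∃ σ : X → ℝ, Measurable σ ∧ (∀ x, |σ x| = 1) ∧
      ∀ s, MeasurableSet s → ∫ x in s, σ x ∂κ.totalVariation = κ s := by
  classical
  set p := κ.toJordanDecomposition.posPart
  set q := κ.toJordanDecomposition.negPart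
  obtain ⟨N, hN, hpN, hqN⟩ := κ.toJordanDecomposition.mutuallySingular
  let σ : X → ℝ := fun x => if x ∈ N then -1 else 1
  have hσ : Measurable σ := Measurable.ite hN measurable_const measurable_const
  have abs_σ (x : X) : |σ x| = 1 := by
    by_cases hx : x ∈ N <;> simp [σ, hx]
  have integrable_σ (m : Measure X) [IsFiniteMeasure m] : Integrable σ m :=
    Integrable.of_bound hσ.aestronglyMeasurable 1 (ae_of_all _ fun x => (abs_σ x).le)
  refine ⟨σ, hσ, abs_σ, fun s hs => ?_⟩
  have hp : ∫ x in s, σ x ∂p = p.real s := by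
    have : σ =ᵐ[p.restrict s] fun _ => 1 := ae_restrict_of_ae <| by
      filter_upwards [measure_eq_zero_iff_ae_notMem.1 hpN] with x hx
      simp [σ, hx]
    simp [integral_congr_ae this]
  have hq : ∫ x in s, σ x ∂q = -q.real s := by
    have : σ =ᵐ[q.restrict s] fun _ => -1 := ae_restrict_of_ae <| by
      filter_upwards [measure_eq_zero_iff_ae_notMem.1 hqN] with x hx
      simp [σ, not_not.1 hx]
    simp [integral_congr_ae this]
  have hκ : κ s = p.real s - q.real s := by
    conv_lhs => rw [← κ.toSignedMeasure_toJordanDecomposition]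
    exact Measure.toSignedMeasure_sub_apply hs
  rw [SignedMeasure.totalVariation, Measure.restrict_add,
    integral_add_measure (integrable_σ _) (integrable_σ _), hp, hq, hκ, sub_eq_add_neg]

theorem exists_isPolar {a b : ℝ} (hab : a ≤ b) {h : ℝ → ℝ} (hbv : BoundedVariationOn h (Icc a b))
    (hcont : ∀ t ∈ Ioc a b, ContinuousWithinAt h (Iic t) t) : ∃ μ σ, IsPolar a b h μ σ := by
  let k : ℝ → ℝ := h ∘ fun t => (projIcc a b hab t : ℝ)
  have hk : BoundedVariationOn k univ :=
    ne_top_of_le_ne_top hbv (eVariationOn.comp_le_of_monotoneOn h _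
      (fun x _ y _ hxy => monotone_projIcc hab hxy) fun t _ => (projIcc a b hab t).2)
  have k_eq (t : ℝ) (ht : t ∈ Icc a b) : k t = h t := by simp [k, projIcc_of_mem hab ht]
  have leftLim_k (t : ℝ) (ht : t ∈ Icc a b) : k.leftLim t = h t := by
    refine leftLim_eq_of_tendsto ?_
    rcases ht.1.eq_or_lt with rfl | hat
    · refine tendsto_const_nhds.congr' ?_
      filter_upwards [self_mem_nhdsWithin] with s hs
      simp only [k, Function.comp_apply, projIcc_of_le_left hab (le_of_lt hs)]
    · refine Tendsto.congr' ?_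
        ((hcont t ⟨hat, ht.2⟩).tendsto.mono_left (nhdsWithin_mono _ Iio_subset_Iic_self))
      filter_upwards [Ioo_mem_nhdsLT hat] with s hs
      exact (k_eq s ⟨hs.1.le, hs.2.le.trans ht.2⟩).symm
  obtain ⟨σ, hσ, abs_σ, hσκ⟩ := exists_sign_integral_totalVariation_eq hk.vectorMeasure
  refine ⟨SignedMeasure.totalVariation hk.vectorMeasure, σ, inferInstance, hσ, abs_σ,
    fun s t hs hst ht => ?_⟩
  rw [hσκ _ measurableSet_Ico, hk.vectorMeasure_Ico hst, leftLim_k t ⟨hs.trans hst, ht⟩,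
    leftLim_k s ⟨hs, hst.trans ht⟩]

theorem isPolar_id (a b : ℝ) : IsPolar a b (fun t => t) (volume.restrict (Icc a b)) fun _ => 1 where
  isFiniteMeasure := inferInstance
  measurable := measurable_const
  abs_eq_one := by simp
  sub_eq s t hs hst ht := by
    rw [Measure.restrict_restrict measurableSet_Ico,
      inter_eq_left.2 (Ico_subset_Icc_self.trans (Icc_subset_Icc hs ht))]
    simp [hst]

namespace IsPolar

variable {a b : ℝ} {h : ℝ → ℝ} {μ : Measure ℝ} {σ : ℝ → ℝ} {F : Type*} [NormedAddCommGroup F]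
  [NormedSpace ℝ F]

lemma integrable_sign (hp : IsPolar a b h μ σ) : Integrable σ μ :=
  have := hp.isFiniteMeasure
  Integrable.of_bound hp.measurable.aestronglyMeasurable 1
    (ae_of_all _ fun x => (hp.abs_eq_one x).le)

lemma norm_smul (hp : IsPolar a b h μ σ) (x : ℝ) (v : F) : ‖σ x • v‖ = ‖v‖ := by
  rw [_root_.norm_smul, Real.norm_eq_abs, hp.abs_eq_one, one_mul]

lemma integrableOn_smul (hp : IsPolar a b h μ σ) {f : ℝ → F} {s : Set ℝ}
    (hf : IntegrableOn f s μ) : IntegrableOn (fun x => σ x • f x) s μ :=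
  hf.norm.mono' (hp.measurable.aestronglyMeasurable.smul hf.aestronglyMeasurable)
    (ae_of_all _ fun x => (hp.norm_smul x (f x)).le)

lemma abs_sub_le (hp : IsPolar a b h μ σ) {s t : ℝ} (hs : a ≤ s) (hst : s ≤ t) (ht : t ≤ b) :
    |h t - h s| ≤ μ.real (Ico s t) := by
  rw [hp.sub_eq s t hs hst ht]
  exact (norm_integral_le_integral_norm σ).trans_eq (by simp [hp.abs_eq_one])

theorem hasKSPrimitive [CompleteSpace F] (hp : IsPolar a b h μ σ) {f : ℝ → F}
    (hf : IntegrableOn f (Ico a b) μ) :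
    HasKSPrimitive f h a b fun t => ∫ x in Ico a t, σ x • f x ∂μ := by
  have := hp.isFiniteMeasure
  intro u hu
  refine ⟨hu.1, fun ε hε => ?_⟩
  have hfu : IntegrableOn f (Ico a u) μ := hf.mono_set (Ico_subset_Ico_right hu.2)
  obtain ⟨δ, hδ, hsum⟩ := exists_gauge_sum_integral_norm_sub_le hfu (half_pos hε)
  refine ⟨δ, fun t _ => hδ t, fun P hP => ?_⟩
  let H : ℝ → F := fun t => ∫ x in Ico a t, σ x • f x ∂μ
  have increment_error (τ s t : ℝ) (hs : a ≤ s) (hst : s ≤ t) (ht : t ≤ u) :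
      ‖(h t - h s) • f τ - (H t - H s)‖ ≤ ∫ x in Ico s t, ‖f x - f τ‖ ∂μ := by
    have hsub : Ico s t ⊆ Ico a u := Ico_subset_Ico hs ht
    rw [setIntegral_Ico_sub (hp.integrableOn_smul hfu) hs hst ht,
      hp.sub_eq s t hs hst (ht.trans hu.2), ← integral_smul_const, ← integral_sub
        (hp.integrable_sign.integrableOn.smul_const _) (hp.integrableOn_smul (hfu.mono_set hsub))]
    refine (norm_integral_le_integral_norm _).trans_eq (integral_congr_ae (ae_of_all _ fun x => ?_))
    dsimp only
    rw [← smul_sub, hp.norm_smul, norm_sub_rev]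
  calc ‖P.stieltjesSum f h - H u‖ = ‖P.sum fun τ s t => (h t - h s) • f τ - (H t - H s)‖ := by
        rw [TaggedDivision.sum_sub, P.sum_increment, TaggedDivision.stieltjesSum_eq_sum]
        simp [H]
    _ ≤ P.sum fun τ s t => ‖(h t - h s) • f τ - (H t - H s)‖ := P.norm_sum_le _
    _ ≤ P.sum fun τ s t => ∫ x in Ico s t, ‖f x - f τ‖ ∂μ :=
        hP.sum_le_sum fun τ s t hs hsτ hτt ht _ _ => increment_error τ s t hs (hsτ.trans hτt) ht
    _ ≤ ε / 2 := hsum P hP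
    _ < ε := half_lt_self hε

end IsPolar

/-! ### Bounded Stieltjes integrable functions are measurable -/

section SumSmall

open TaggedDivision

variable {a b : ℝ} {μ : Measure ℝ} {F : Type*} [NormedAddCommGroup F]

lemma exists_isFine_mul_measureReal_le_sum [IsFiniteMeasure μ] (hab : a < b) {δ : ℝ → ℝ}
    (hδ : ∀ t ∈ Icc a b, 0 < δ t) {ψ : ℝ → F} {E : Set ℝ} (hE : E ⊆ Ico a b) {r η : ℝ}
    (hr : 0 < r) (hrE : ∀ x ∈ E, r ≤ δ x) (hη : ∀ x ∈ E, η ≤ ‖ψ x‖) (hη₀ : 0 ≤ η) :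
    ∃ P : TaggedDivision a b, P.IsFine δ ∧
      η * μ.real E ≤ P.sum fun τ s t => ‖ψ τ‖ * μ.real (Ico s t) := by
  obtain ⟨N, hN⟩ := exists_nat_gt ((b - a) / r)
  have hN₀ : (0 : ℝ) < N := (div_pos (sub_pos.2 hab) hr).trans hN
  let w : ℝ := (b - a) / N
  have hw : 0 < w := div_pos (sub_pos.2 hab) hN₀
  have hwr : w < r := by rwa [div_lt_comm₀ hN₀ hr]
  let p : ℕ → ℝ := fun j => a + j * w
  have p_zero : p 0 = a := by simp [p]
  have p_N : p N = b := by simp [p, w, mul_div_cancel₀ _ hN₀.ne']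
  have p_succ (j : ℕ) : p (j + 1) = p j + w := by simp only [p]; push_cast; ring
  have p_mono : Monotone p := monotone_nat_of_le_succ fun j => by linarith [p_succ j]
  obtain ⟨P, hP, hle⟩ := exists_isFine_sum_le_sum (δ := δ)
    (U := fun τ s t => ‖ψ τ‖ * μ.real (Ico s t))
    (fun j => η * μ.real (E ∩ Ico (p j) (p (j + 1)))) p_zero p_N fun j hj => by
      by_cases hne : (E ∩ Ico (p j) (p (j + 1))).Nonempty
      · obtain ⟨x, hxE, hxI⟩ := hne
        have hx := hrE x hxE
        refine ⟨single (Ico_subset_Icc_self hxI), isFine_single _ fun y hy =>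
          ⟨by linarith [hy.1, hxI.2, p_succ j], by linarith [hy.2, hxI.1, p_succ j]⟩, ?_⟩
        rw [sum_single]
        exact mul_le_mul (hη x hxE) (measureReal_mono inter_subset_right) measureReal_nonneg
          (norm_nonneg _)
      · obtain ⟨Q, hQ⟩ := exists_isFine (p_mono j.le_succ) (δ := δ) fun t ht => hδ t
          ⟨(p_zero ▸ p_mono j.zero_le).trans ht.1, ht.2.trans (p_N ▸ p_mono hj)⟩
        refine ⟨Q, hQ, ?_⟩
        rw [not_nonempty_iff_eq_empty.1 hne, measureReal_empty, mul_zero]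
        exact Finset.sum_nonneg fun i _ => mul_nonneg (norm_nonneg _) measureReal_nonneg
  refine ⟨P, hP, le_trans ?_ hle⟩
  rw [← Finset.mul_sum]
  refine mul_le_mul_of_nonneg_left ?_ hη₀
  refine (measureReal_mono (fun x hx => ?_) (measure_ne_top _ _)).trans
    (measureReal_biUnion_finset_le _ _)
  have hxI : x ∈ Ico (p 0) (p N) := by rw [p_zero, p_N]; exact hE hx
  simpa only [← inter_iUnion] using mem_inter hx (Ico_subset_biUnion_Ico N p hxI)

theorem ae_eq_zero_of_sum_small [IsFiniteMeasure μ] (hab : a < b) {ψ : ℝ → F}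
    (hψ : ∀ ε > 0, ∃ δ : ℝ → ℝ, (∀ t ∈ Icc a b, 0 < δ t) ∧ ∀ P : TaggedDivision a b,
      P.IsFine δ → P.sum (fun τ s t => ‖ψ τ‖ * μ.real (Ico s t)) ≤ ε) :
    ∀ᵐ x ∂μ.restrict (Ico a b), ψ x = 0 := by
  have superlevel_null (k : ℕ) : μ {x ∈ Ico a b | 1 / ((k : ℝ) + 1) ≤ ‖ψ x‖} = 0 := by
    set η : ℝ := 1 / ((k : ℝ) + 1)
    have hη : 0 < η := Nat.one_div_pos_of_nat
    refine le_antisymm (ENNReal.le_of_forall_pos_le_add fun ε hε _ => ?_) bot_le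
    rw [zero_add]
    obtain ⟨δ, hδ, hsum⟩ := hψ (η * ε) (by positivity)
    let E : ℕ → Set ℝ := fun n => {x ∈ Ico a b | η ≤ ‖ψ x‖ ∧ 1 / ((n : ℝ) + 1) ≤ δ x}
    have hE_mono : Monotone E := fun m n hmn x hx =>
      ⟨hx.1, hx.2.1, (Nat.one_div_le_one_div hmn).trans hx.2.2⟩
    have hE_iUnion : {x ∈ Ico a b | η ≤ ‖ψ x‖} ⊆ ⋃ n, E n := fun x hx => by
      obtain ⟨n, hn⟩ := exists_nat_one_div_lt (hδ x (Ico_subset_Icc_self hx.1))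
      exact mem_iUnion.2 ⟨n, hx.1, hx.2, hn.le⟩
    refine (measure_mono hE_iUnion).trans (hE_mono.measure_iUnion.trans_le (iSup_le fun n => ?_))
    obtain ⟨P, hP, hle⟩ := exists_isFine_mul_measureReal_le_sum (μ := μ) hab hδ (ψ := ψ)
      (E := E n) (fun x hx => hx.1) Nat.one_div_pos_of_nat (fun x hx => hx.2.2)
      (fun x hx => hx.2.1) hη.le
    have hEε : μ.real (E n) ≤ ε := le_of_mul_le_mul_left (hle.trans (hsum P hP)) hη
    rw [← ofReal_measureReal, ← ENNReal.ofReal_coe_nnreal]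
    exact ENNReal.ofReal_le_ofReal hEε
  have small (k : ℕ) : ∀ᵐ x ∂μ.restrict (Ico a b), ‖ψ x‖ < 1 / ((k : ℝ) + 1) := by
    rw [ae_restrict_iff' measurableSet_Ico, ae_iff]
    refine measure_mono_null (fun x hx => ?_) (superlevel_null k)
    simpa [and_assoc] using hx
  filter_upwards [ae_all_iff.2 small] with x hx
  exact norm_le_zero_iff.1
    (ge_of_tendsto' tendsto_one_div_add_atTop_nhds_zero_nat fun k => (hx k).le)

end SumSmall

section Measurability

open TaggedDivision

variable {a b C : ℝ} {h : ℝ → ℝ}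

lemma abs_mul_sub_mul_le {m : ℝ} (hm : 0 ≤ m) (y α β p q : ℝ) :
    |y * α - β| * m ≤ |p * y - q| + (|y| * |p - m * α| + |q - m * β|) :=
  calc |y * α - β| * m = |(p * y - q) - (y * (p - m * α) - (q - m * β))| := by
        rw [← abs_of_nonneg hm, ← abs_mul, abs_of_nonneg hm]
        ring_nf
    _ ≤ |p * y - q| + (|y * (p - m * α)| + |q - m * β|) :=
        (abs_sub _ _).trans (add_le_add_right (abs_sub _ _) _)
    _ = |p * y - q| + (|y| * |p - m * α| + |q - m * β|) := by rw [abs_mul y]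

theorem HasKSPrimitive.ae_mul_eq {ν : Measure ℝ} [IsFiniteMeasure ν] {f H α β : ℝ → ℝ}
    (hH : HasKSPrimitive f h a b H) (hab : a < b) (hf : ∀ t ∈ Icc a b, |f t| ≤ C)
    (hα : IntegrableOn α (Ico a b) ν) (hβ : IntegrableOn β (Ico a b) ν)
    (h_sub : ∀ s t, a ≤ s → s ≤ t → t ≤ b → h t - h s = ∫ x in Ico s t, α x ∂ν)
    (H_sub : ∀ s t, a ≤ s → s ≤ t → t ≤ b → H t - H s = ∫ x in Ico s t, β x ∂ν) :
    ∀ᵐ x ∂ν.restrict (Ico a b), f x * α x = β x := by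
  have hC : 0 ≤ C := (abs_nonneg _).trans (hf a (left_mem_Icc.2 hab.le))
  let U (τ s t : ℝ) : ℝ := |(h t - h s) * f τ - (H t - H s)|
  let A (τ s t : ℝ) : ℝ := ∫ x in Ico s t, ‖α x - α τ‖ ∂ν
  let B (τ s t : ℝ) : ℝ := ∫ x in Ico s t, ‖β x - β τ‖ ∂ν
  have pointwise (τ s t : ℝ) (hs : a ≤ s) (hsτ : s ≤ τ) (hτt : τ ≤ t) (ht : t ≤ b) :
      ‖f τ * α τ - β τ‖ * ν.real (Ico s t) ≤ U τ s t + (C * A τ s t + B τ s t) := by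
    have hsub : Ico s t ⊆ Ico a b := Ico_subset_Ico hs ht
    refine (abs_mul_sub_mul_le measureReal_nonneg _ _ _ (h t - h s) (H t - H s)).trans ?_
    rw [h_sub s t hs (hsτ.trans hτt) ht, H_sub s t hs (hsτ.trans hτt) ht]
    gcongr ?_ + (?_ * ?_ + ?_)
    · rw [← h_sub s t hs (hsτ.trans hτt) ht, ← H_sub s t hs (hsτ.trans hτt) ht]
    · exact hf τ ⟨hs.trans hsτ, hτt.trans ht⟩
    · exact norm_setIntegral_sub_smul_le (hα.mono_set hsub) (α τ)
    · exact norm_setIntegral_sub_smul_le (hβ.mono_set hsub) (β τ)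
  have sub_eq_zero_ae : ∀ᵐ x ∂ν.restrict (Ico a b), f x * α x - β x = 0 := by
    refine ae_eq_zero_of_sum_small hab fun ε hε => ?_
    obtain ⟨δ₁, hδ₁, hU⟩ := hH.saks_henstock hab.le (ε := ε / 3) (by positivity)
    obtain ⟨δ₂, hδ₂, hA⟩ :=
      exists_gauge_sum_integral_norm_sub_le hα (ε := ε / (3 * (C + 1))) (by positivity)
    obtain ⟨δ₃, hδ₃, hB⟩ := exists_gauge_sum_integral_norm_sub_le hβ (ε := ε / 3) (by positivity)
    refine ⟨fun t => min (δ₁ t) (min (δ₂ t) (δ₃ t)),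
      fun t ht => lt_min (hδ₁ t ht) (lt_min (hδ₂ t) (hδ₃ t)), fun P hP => ?_⟩
    have hPU := hU P (hP.mono fun t _ => min_le_left _ _)
    have hPA := hA P (hP.mono fun t _ => (min_le_right _ _).trans (min_le_left _ _))
    have hPB := hB P (hP.mono fun t _ => (min_le_right _ _).trans (min_le_right _ _))
    have hCA : C * P.sum A ≤ ε / 3 := by
      calc C * P.sum A ≤ C * (ε / (3 * (C + 1))) := by gcongr
        _ ≤ ε / 3 := by
          rw [mul_div_assoc', div_le_div_iff₀ (by positivity) (by positivity)]
          nlinarith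
    calc P.sum (fun τ s t => ‖f τ * α τ - β τ‖ * ν.real (Ico s t))
        ≤ P.sum (fun τ s t => U τ s t + (C * A τ s t + B τ s t)) :=
          hP.sum_le_sum fun τ s t hs hsτ hτt ht _ _ => pointwise τ s t hs hsτ hτt ht
      _ = P.sum U + (C * P.sum A + P.sum B) := by rw [sum_add, sum_add, sum_mul_left]
      _ ≤ ε := by linarith
  filter_upwards [sub_eq_zero_ae] with x hx
  exact sub_eq_zero.1 hx

lemma boundedVariationOn_of_norm_sub_le {F : Type*} [NormedAddCommGroup F] {H : ℝ → F}
    {V : ℝ → ℝ} (hHV : ∀ s t, a ≤ s → s ≤ t → t ≤ b → ‖H t - H s‖ ≤ V t - V s) :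
    BoundedVariationOn H (Icc a b) := by
  have hV : MonotoneOn V (Icc a b) := fun s hs t ht hst =>
    sub_nonneg.1 ((norm_nonneg _).trans (hHV s t hs.1 hst ht.2))
  have hV_bv : BoundedVariationOn V (Icc a b) := by
    refine hV.boundedVariationOn (C := max |V a| |V b|) fun t ht => ?_
    exact abs_le_max_abs_abs (hV (left_mem_Icc.2 (ht.1.trans ht.2)) ht ht.1)
      (hV ht (right_mem_Icc.2 (ht.1.trans ht.2)) ht.2)
  refine ne_top_of_le_ne_top hV_bv (iSup_le fun p => ?_)
  refine le_trans (Finset.sum_le_sum fun i _ => ?_) (eVariationOn.sum_le p.2.2.1 p.2.2.2)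
  rw [edist_dist, edist_dist, dist_eq_norm, Real.dist_eq]
  exact ENNReal.ofReal_le_ofReal ((hHV _ _ (p.2.2.2 i).1 (p.2.2.1 i.le_succ)
    (p.2.2.2 (i + 1)).2).trans (le_abs_self _))

lemma tendsto_measureReal_Ico_left (μ : Measure ℝ) [IsFiniteMeasure μ] (t : ℝ) :
    Tendsto (fun s => μ.real (Ico s t)) (𝓝[<] t) (𝓝 0) := by
  have hlim := tendsto_measure_biInter_gt (ι := ℝᵒᵈ) (μ := μ)
    (s := fun r => Ico (OrderDual.ofDual r) t) (a := OrderDual.toDual t)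
    (fun r _ => measurableSet_Ico.nullMeasurableSet) (fun i j _ hij => Ico_subset_Ico_left hij)
    ⟨OrderDual.toDual (t - 1), sub_one_lt t, measure_ne_top _ _⟩
  have hempty : ⋂ r > OrderDual.toDual t, Ico (OrderDual.ofDual r) t = ∅ := by
    refine eq_empty_of_forall_notMem fun x hx => ?_
    simp only [mem_iInter] at hx
    obtain ⟨y, hxy, hyt⟩ := exists_between (hx (OrderDual.toDual (t - 1)) (sub_one_lt t)).2
    exact (hx (OrderDual.toDual y) hyt).1.not_gt hxy
  rw [hempty, measure_empty] at hlim
  exact (ENNReal.tendsto_toReal ENNReal.zero_ne_top).comp hlim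

namespace IsPolar

variable {μ ν : Measure ℝ} {σ : ℝ → ℝ}

lemma continuousWithinAt_Iic (hp : IsPolar a b h μ σ) {t : ℝ} (ht : t ∈ Ioc a b) :
    ContinuousWithinAt h (Iic t) t := by
  have := hp.isFiniteMeasure
  rw [← continuousWithinAt_Iio_iff_Iic, ContinuousWithinAt, tendsto_iff_dist_tendsto_zero]
  refine squeeze_zero' (Eventually.of_forall fun _ => dist_nonneg) ?_
    (tendsto_measureReal_Ico_left μ t)
  filter_upwards [Ioo_mem_nhdsLT ht.1] with s hs
  rw [dist_comm, Real.dist_eq]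
  exact hp.abs_sub_le hs.1.le hs.2.le ht.2

lemma integrable_rnDeriv_mul_sign [SigmaFinite ν] (hp : IsPolar a b h μ σ) (hμν : μ ≪ ν) :
    Integrable (fun x => (μ.rnDeriv ν x).toReal * σ x) ν :=
  have := hp.isFiniteMeasure
  (integrable_toReal_rnDeriv_mul_iff hμν).2 hp.integrable_sign

lemma sub_eq_rnDeriv [SigmaFinite ν] (hp : IsPolar a b h μ σ) (hμν : μ ≪ ν) {s t : ℝ}
    (hs : a ≤ s) (hst : s ≤ t) (ht : t ≤ b) :
    h t - h s = ∫ x in Ico s t, (μ.rnDeriv ν x).toReal * σ x ∂ν := by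
  have := hp.isFiniteMeasure
  rw [hp.sub_eq s t hs hst ht, setIntegral_toReal_rnDeriv_mul hμν measurableSet_Ico]

-- A primitive `H` of `f` has a polar decomposition of its own. In terms of the densities `α`, `β`
-- of `h` and `H` with respect to a common measure, `f` is `β / α`.
theorem aemeasurable_of_hasKSPrimitive (hp : IsPolar a b h μ σ) (hab : a < b) {f H : ℝ → ℝ}
    (hf : ∀ t ∈ Icc a b, |f t| ≤ C) (hH : HasKSPrimitive f h a b H) :
    AEMeasurable f (μ.restrict (Ico a b)) := by
  have := hp.isFiniteMeasure
  have H_bv : BoundedVariationOn H (Icc a b) := by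
    refine boundedVariationOn_of_norm_sub_le (V := fun t => C * μ.real (Ico a t))
      fun s t hs hst ht => ?_
    refine hH.norm_sub_le (m := fun t => μ.real (Ico a t)) (θ := fun _ => C)
      (K := fun t => C * μ.real (Ico a t))
      (fun t ht => ?_) (fun r τ u hr hrτ hτu hu => ?_) hs hst ht
    · simpa [mul_comm] using HasKSIntegral.const (h := fun t => μ.real (Ico a t)) ht.1 C
    · rw [measureReal_Ico_sub hr (hrτ.trans hτu)]
      exact mul_le_mul (hp.abs_sub_le hr (hrτ.trans hτu) hu) (hf τ ⟨hr.trans hrτ, hτu.trans hu⟩)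
        (norm_nonneg _) measureReal_nonneg
  obtain ⟨μ', σ', hp'⟩ := exists_isPolar hab.le H_bv fun t ht =>
    hH.continuousWithinAt_Iic ht (hp.continuousWithinAt_Iic ht)
  have := hp'.isFiniteMeasure
  have hμν : μ ≪ μ + μ' := (Measure.le_add_right le_rfl).absolutelyContinuous
  have hμν' : μ' ≪ μ + μ' := (Measure.le_add_left le_rfl).absolutelyContinuous
  have f_mul := hH.ae_mul_eq hab hf (hp.integrable_rnDeriv_mul_sign hμν).integrableOn
    (hp'.integrable_rnDeriv_mul_sign hμν').integrableOn (fun _ _ => hp.sub_eq_rnDeriv hμν)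
    fun _ _ => hp'.sub_eq_rnDeriv hμν'
  refine ⟨fun x => (μ'.rnDeriv (μ + μ') x).toReal * σ' x / ((μ.rnDeriv (μ + μ') x).toReal * σ x),
    ?_, ?_⟩
  · exact ((Measure.measurable_rnDeriv _ _).ennreal_toReal.mul hp'.measurable).div
      ((Measure.measurable_rnDeriv _ _).ennreal_toReal.mul hp.measurable)
  · filter_upwards [(hμν.restrict (Ico a b)).ae_le f_mul,
      ae_restrict_of_ae (Measure.rnDeriv_pos hμν),
      ae_restrict_of_ae (hμν.ae_le (Measure.rnDeriv_lt_top μ (μ + μ')))] with x hx hpos htop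
    have hσx : σ x ≠ 0 := abs_pos.1 (by rw [hp.abs_eq_one]; exact one_pos)
    exact eq_div_of_mul_eq (mul_ne_zero (ENNReal.toReal_pos hpos.ne' htop.ne).ne' hσx) hx

theorem integrableOn_of_hasKSPrimitive {F : Type*} [NormedAddCommGroup F] [NormedSpace ℝ F]
    [FiniteDimensional ℝ F] (hp : IsPolar a b h μ σ) (hab : a < b) {f H : ℝ → F}
    (hf : ∀ t ∈ Icc a b, ‖f t‖ ≤ C) (hH : HasKSPrimitive f h a b H) :
    IntegrableOn f (Ico a b) μ := by
  have := hp.isFiniteMeasure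
  let e := (Module.finBasis ℝ F).equivFunL
  have coord_meas (i) : AEMeasurable (fun t => e (f t) i) (μ.restrict (Ico a b)) := by
    let L : F →L[ℝ] ℝ := (ContinuousLinearMap.proj i).comp e.toContinuousLinearMap
    exact hp.aemeasurable_of_hasKSPrimitive hab (C := ‖L‖ * C)
      (fun t ht => (L.le_opNorm _).trans (by gcongr; exact hf t ht))
      fun t ht => (hH t ht).clm_comp L
  have f_meas : AEStronglyMeasurable f (μ.restrict (Ico a b)) := by
    simpa using e.symm.continuous.comp_aestronglyMeasurable
      (aemeasurable_pi_lambda _ coord_meas).aestronglyMeasurable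
  refine Integrable.of_bound f_meas C ?_
  filter_upwards [ae_restrict_mem measurableSet_Ico] with t ht
  exact hf t (Ico_subset_Icc_self ht)

end IsPolar

end Measurability

/-! ### Regulated functions -/

section Regulated

variable {E : Type*} [NormedAddCommGroup E] {a b : ℝ} {x y : ℝ → E}

theorem exists_eventually_norm_le {ι : Type*} {l : Filter ι} {u : ι → E}
    (hu : ∃ c, Tendsto u l (𝓝 c)) : ∃ C, ∀ᶠ i in l, ‖u i‖ ≤ C :=
  hu.elim fun c hc => ⟨‖c‖ + 1, hc.norm.eventually_le_const (lt_add_one _)⟩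

theorem RegulatedOn.exists_norm_le (hx : RegulatedOn x a b) : ∃ C, ∀ t ∈ Icc a b, ‖x t‖ ≤ C := by
  refine isCompact_Icc.induction_on (p := fun s => ∃ C, ∀ t ∈ s, ‖x t‖ ≤ C) ⟨0, by simp⟩
    (fun s t hst ⟨C, hC⟩ => ⟨C, fun r hr => hC r (hst hr)⟩)
    (fun s t ⟨C, hC⟩ ⟨D, hD⟩ => ⟨max C D, fun r hr => hr.elim
      (fun h => (hC r h).trans (le_max_left _ _)) fun h => (hD r h).trans (le_max_right _ _)⟩)
    fun t ht => ?_
  obtain ⟨C, hC⟩ : ∃ C, ∀ᶠ s in 𝓝[<] t, s ∈ Icc a b → ‖x s‖ ≤ C := by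
    rcases ht.1.eq_or_lt with rfl | hat
    · exact ⟨0, eventually_mem_nhdsWithin.mono fun s hs hs' => absurd hs'.1 (not_le.2 hs)⟩
    · exact (exists_eventually_norm_le (hx.1 t ⟨hat, ht.2⟩)).imp fun C h => h.mono fun s hs _ => hs
  obtain ⟨D, hD⟩ : ∃ D, ∀ᶠ s in 𝓝[>] t, s ∈ Icc a b → ‖x s‖ ≤ D := by
    rcases ht.2.eq_or_lt with rfl | htb
    · exact ⟨0, eventually_mem_nhdsWithin.mono fun s hs hs' => absurd hs'.2 (not_le.2 hs)⟩
    · exact (exists_eventually_norm_le (hx.2 t ⟨ht.1, htb⟩)).imp fun C h => h.mono fun s hs _ => hs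
  let M := max ‖x t‖ (max C D)
  refine ⟨Icc a b ∩ {s | s ∈ Icc a b → ‖x s‖ ≤ M}, inter_mem_nhdsWithin _ ?_, M,
    fun s hs => hs.2 hs.1⟩
  rw [← nhdsLT_sup_nhdsGE, ← Ioi_insert, nhdsWithin_insert]
  refine ⟨?_, mem_pure.2 fun _ => le_max_left _ _, ?_⟩
  · exact hC.mono fun s hs h => (hs h).trans (by simp [M])
  · exact hD.mono fun s hs h => (hs h).trans (by simp [M])

theorem regulatedOn_of_boundedVariationOn [CompleteSpace E]
    (hx : BoundedVariationOn x (Icc a b)) : RegulatedOn x a b := by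
  refine ⟨fun t ht => ?_, fun t ht => ?_⟩
  · refine (hx.exists_tendsto_left t).imp fun l hl => hl.mono_left (nhdsWithin_le_iff.2 ?_)
    filter_upwards [Ioo_mem_nhdsLT ht.1] with s hs
    exact ⟨⟨hs.1.le, hs.2.le.trans ht.2⟩, hs.2⟩
  · refine (hx.exists_tendsto_right t).imp fun l hl => hl.mono_left (nhdsWithin_le_iff.2 ?_)
    filter_upwards [Ioo_mem_nhdsGT ht.2] with s hs
    exact ⟨⟨ht.1.trans hs.1.le, hs.2.le⟩, hs.1⟩

theorem RegulatedOn.add (hx : RegulatedOn x a b) (hy : RegulatedOn y a b) :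
    RegulatedOn (fun t => x t + y t) a b :=
  ⟨fun t ht => let ⟨_, h⟩ := hx.1 t ht; let ⟨_, h'⟩ := hy.1 t ht; ⟨_, h.add h'⟩,
    fun t ht => let ⟨_, h⟩ := hx.2 t ht; let ⟨_, h'⟩ := hy.2 t ht; ⟨_, h.add h'⟩⟩

theorem RegulatedOn.const_smul [NormedSpace ℝ E] (hx : RegulatedOn x a b) (c : ℝ) :
    RegulatedOn (fun t => c • x t) a b :=
  ⟨fun t ht => let ⟨_, h⟩ := hx.1 t ht; ⟨_, h.const_smul c⟩,
    fun t ht => let ⟨_, h⟩ := hx.2 t ht; ⟨_, h.const_smul c⟩⟩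

theorem regulatedOn_const (c : E) : RegulatedOn (fun _ => c) a b :=
  ⟨fun _ _ => ⟨c, tendsto_const_nhds⟩, fun _ _ => ⟨c, tendsto_const_nhds⟩⟩

theorem HasKSPrimitive.regulatedOn [NormedSpace ℝ E] {h : ℝ → ℝ}
    (hy : HasKSPrimitive x h a b y) (hh : RegulatedOn h a b) : RegulatedOn y a b := by
  refine ⟨fun t ht => ?_, fun t ht => ?_⟩
  · obtain ⟨l, hl⟩ := hh.1 t ht
    have hlim := ((hy.tendsto_left ht).add ((hl.const_sub (h t)).smul_const (x t))).const_sub (y t)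
    exact ⟨_, hlim.congr fun s => by abel⟩
  · obtain ⟨l, hl⟩ := hh.2 t ht
    have hlim := ((hy.tendsto_right ht).add ((hl.sub_const (h t)).smul_const (x t))).add_const (y t)
    exact ⟨_, hlim.congr fun s => by abel⟩

end Regulated

/-! ### Left-continuous functions -/

section LeftContinuous

variable {a b : ℝ}

theorem tendsto_ceil_sub_one_div_nhdsWithin_Iic (t : ℝ) :
    Tendsto (fun m : ℕ => ((⌈((m : ℝ) + 1) * t⌉ : ℝ) - 1) / ((m : ℝ) + 1)) atTop (𝓝[≤] t) := by
  have hpos : ∀ m : ℕ, (0 : ℝ) < (m : ℝ) + 1 := fun m => by positivity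
  have hle : ∀ m : ℕ, ((⌈((m : ℝ) + 1) * t⌉ : ℝ) - 1) / ((m : ℝ) + 1) ≤ t := fun m => by
    rw [div_le_iff₀ (hpos m)]
    linarith [Int.ceil_lt_add_one (((m : ℝ) + 1) * t)]
  have hge : ∀ m : ℕ, t - 1 / ((m : ℝ) + 1) ≤ ((⌈((m : ℝ) + 1) * t⌉ : ℝ) - 1) / ((m : ℝ) + 1) :=
    fun m => by
      rw [le_div_iff₀ (hpos m), sub_mul, div_mul_cancel₀ _ (hpos m).ne']
      linarith [Int.le_ceil (((m : ℝ) + 1) * t)]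
  refine tendsto_nhdsWithin_iff.2 ⟨?_, Eventually.of_forall hle⟩
  refine tendsto_of_tendsto_of_tendsto_of_le_of_le ?_ tendsto_const_nhds hge hle
  simpa using (tendsto_one_div_add_atTop_nhds_zero_nat (𝕜 := ℝ)).const_sub t

theorem aemeasurable_of_continuousWithinAt_Iic {E : Type*} [TopologicalSpace E]
    [TopologicalSpace.PseudoMetrizableSpace E] [MeasurableSpace E] [BorelSpace E] {x : ℝ → E}
    (hx : ∀ t ∈ Ioc a b, ContinuousWithinAt x (Iic t) t) (κ : Measure ℝ) :
    AEMeasurable x (κ.restrict (Ioc a b)) := by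
  refine aemeasurable_of_tendsto_metrizable_ae atTop
    (f := fun (m : ℕ) t => x (((⌈((m : ℝ) + 1) * t⌉ : ℝ) - 1) / ((m : ℝ) + 1))) (fun m => ?_) ?_
  · exact ((measurable_of_countable fun k : ℤ => x (((k : ℝ) - 1) / ((m : ℝ) + 1))).comp
      (Int.measurable_ceil.comp (measurable_const_mul _))).aemeasurable
  · filter_upwards [ae_restrict_mem measurableSet_Ioc] with t ht
    exact (hx t ht).tendsto.comp (tendsto_ceil_sub_one_div_nhdsWithin_Iic t)

theorem eqOn_of_ae_eq_of_continuousWithinAt_Iic {E : Type*} [TopologicalSpace E] [T2Space E]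
    {u v : ℝ → E} (hu : ∀ t ∈ Ioc a b, ContinuousWithinAt u (Iic t) t)
    (hv : ∀ t ∈ Ioc a b, ContinuousWithinAt v (Iic t) t)
    (huv : ∀ᵐ t, t ∈ Ioo a b → u t = v t) : EqOn u v (Ioc a b) := by
  intro t ht
  have hfreq : ∃ᶠ s in 𝓝[<] t, u s = v s := by
    intro hn
    obtain ⟨c, hct, hc⟩ := (mem_nhdsLT_iff_exists_Ioo_subset' ht.1).1 hn
    have hpos : volume (Ioo (max a c) t) ≠ 0 := by simpa using ⟨ht.1, hct⟩
    refine hpos (measure_mono_null (fun s hs => ?_) huv)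
    exact fun hs' => hc ⟨(le_max_right _ _).trans_lt hs.1, hs.2⟩
      (hs' ⟨(le_max_left _ _).trans_lt hs.1, hs.2.trans_le ht.2⟩)
  have hlim := ((hu t ht).mono Iio_subset_Iic_self).prodMk_nhds
    ((hv t ht).mono Iio_subset_Iic_self)
  exact isClosed_diagonal.mem_of_frequently_of_tendsto hfreq hlim

theorem RegulatedOn.integrableOn_of_continuousWithinAt_Iic {E : Type*} [NormedAddCommGroup E]
    [MeasurableSpace E] [BorelSpace E] [SecondCountableTopology E] {x : ℝ → E}
    (hx : RegulatedOn x a b) (hc : ∀ t ∈ Ioc a b, ContinuousWithinAt x (Iic t) t)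
    (κ : Measure ℝ) [IsFiniteMeasure (κ.restrict (Ioc a b))] : IntegrableOn x (Ioc a b) κ := by
  obtain ⟨C, hC⟩ := hx.exists_norm_le
  refine Integrable.of_bound (aemeasurable_of_continuousWithinAt_Iic hc κ).aestronglyMeasurable C ?_
  filter_upwards [ae_restrict_mem measurableSet_Ioc] with t ht using hC t (Ioc_subset_Icc_self ht)

end LeftContinuous

/-! ### The du Bois-Reymond lemma -/

section DuBoisReymond

variable {E : Type*} [NormedAddCommGroup E] [NormedSpace ℝ E] {a b : ℝ}

theorem intervalIntegral_eq_integral_of_forall_notMem_Ioo (hab : a ≤ b) {ψ : ℝ → E}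
    (hψ : ∀ t ∉ Ioo a b, ψ t = 0) : ∫ t in a..b, ψ t = ∫ t, ψ t := by
  rw [intervalIntegral.integral_of_le hab]
  exact setIntegral_eq_integral_of_forall_compl_eq_zero fun t ht =>
    hψ t fun ht' => ht (Ioo_subset_Ioc_self ht')

theorem exists_contDiff_integral_eq_one (hab : a < b) :
    ∃ χ : ℝ → ℝ, ContDiff ℝ ∞ χ ∧ (∀ t ∉ Ioo a b, χ t = 0) ∧ ∫ t in a..b, χ t = 1 := by
  let bump : ContDiffBump ((a + b) / 2) :=
    ⟨(b - a) / 4, (b - a) / 2, by linarith, by linarith⟩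
  have hsupp : Function.support (bump.normed volume) = Ioo a b := by
    rw [bump.support_normed_eq, Real.ball_eq_Ioo]
    congr 1 <;> simp only [bump] <;> ring
  have hzero : ∀ t ∉ Ioo a b, bump.normed volume t = 0 := fun t ht =>
    Function.notMem_support.1 (hsupp ▸ ht)
  refine ⟨bump.normed volume, bump.contDiff_normed, hzero, ?_⟩
  rw [intervalIntegral_eq_integral_of_forall_notMem_Ioo hab.le hzero, bump.integral_normed]

theorem exists_contDiff_deriv_eq {θ : ℝ → ℝ} (hθ : ContDiff ℝ ∞ θ)
    (hθ0 : ∀ t ∉ Ioo a b, θ t = 0) (hint : ∫ t in a..b, θ t = 0) :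
    ∃ Ψ : ℝ → ℝ, ContDiff ℝ ∞ Ψ ∧ (∀ t ∉ Ioo a b, Ψ t = 0) ∧ deriv Ψ = θ := by
  have hii : ∀ s t, IntervalIntegrable θ volume s t := hθ.continuous.intervalIntegrable
  have hderiv : ∀ t, HasDerivAt (fun t => ∫ s in a..t, θ s) (θ t) t := fun t =>
    intervalIntegral.integral_hasDerivAt_right (hii _ _)
      (hθ.continuous.stronglyMeasurableAtFilter _ _) hθ.continuous.continuousAt
  have hderiv_eq : deriv (fun t => ∫ s in a..t, θ s) = θ := funext fun t => (hderiv t).deriv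
  have hzero : ∀ s t, Disjoint (uIoc s t) (Ioo a b) → ∫ r in s..t, θ r = 0 := fun s t hst => by
    rw [intervalIntegral.integral_congr_ae (Eventually.of_forall fun r hr =>
      hθ0 r (disjoint_left.1 hst hr)), intervalIntegral.integral_zero]
  refine ⟨fun t => ∫ s in a..t, θ s, contDiff_infty_iff_deriv.2
    ⟨fun t => (hderiv t).differentiableAt, by rwa [hderiv_eq]⟩, fun t ht => ?_, hderiv_eq⟩
  rcases le_or_gt t a with hta | hat
  · refine hzero a t (disjoint_left.2 fun r hr hr' => hr'.1.not_ge ?_)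
    exact (uIoc_of_ge hta ▸ hr : r ∈ Ioc t a).2
  · have hbt : b ≤ t := not_lt.1 fun htb => ht ⟨hat, htb⟩
    change ∫ s in a..t, θ s = 0
    rw [← intervalIntegral.integral_add_adjacent_intervals (hii a b) (hii b t), hint, zero_add]
    refine hzero b t (disjoint_left.2 fun r hr hr' => hr'.2.not_gt ?_)
    exact (uIoc_of_le hbt ▸ hr : r ∈ Ioc b t).1

/-- Correcting a test function by a multiple of a fixed bump `χ` with integral `1` turns it into
the derivative of a test function, so the constant has to be `∫ χ u`. -/
theorem exists_ae_eq_const_of_forall_integral_deriv_smul_eq_zero [CompleteSpace E] (hab : a < b)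
    {u : ℝ → E} (hu : IntervalIntegrable u volume a b)
    (h : ∀ ψ : ℝ → ℝ, ContDiff ℝ ∞ ψ → (∀ t ∉ Ioo a b, ψ t = 0) →
      ∫ t in a..b, deriv ψ t • u t = 0) :
    ∃ c, ∀ᵐ t, t ∈ Ioo a b → u t = c := by
  obtain ⟨χ, hχ, hχ0, hχ1⟩ := exists_contDiff_integral_eq_one hab
  have hii : ∀ {ψ : ℝ → ℝ}, ContDiff ℝ ∞ ψ →
      IntervalIntegrable (fun t => ψ t • u t) volume a b :=
    fun hψ => hu.continuousOn_smul hψ.continuous.continuousOn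
  let c := ∫ t in a..b, χ t • u t
  have hloc : LocallyIntegrableOn (fun t => u t - c) (Ioo a b) :=
    (((intervalIntegrable_iff_integrableOn_Ioc_of_le hab.le).1
      (hu.sub intervalIntegrable_const)).mono_set Ioo_subset_Ioc_self).locallyIntegrableOn
  suffices hzero : ∀ ψ : ℝ → ℝ, ContDiff ℝ ∞ ψ → HasCompactSupport ψ → tsupport ψ ⊆ Ioo a b →
      ∫ t, ψ t • (u t - c) = 0 from
    ⟨c, (isOpen_Ioo.ae_eq_zero_of_integral_contDiff_smul_eq_zero hloc hzero).mono
      fun t ht htI => sub_eq_zero.1 (ht htI)⟩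
  intro ψ hψ _ hψs
  have hψ0 : ∀ t ∉ Ioo a b, ψ t = 0 := fun t ht =>
    image_eq_zero_of_notMem_tsupport fun ht' => ht (hψs ht')
  let m := ∫ t in a..b, ψ t
  have hcorr : ContDiff ℝ ∞ fun t => ψ t - m * χ t := hψ.sub (contDiff_const.mul hχ)
  obtain ⟨Ψ, hΨ, hΨ0, hΨd⟩ := exists_contDiff_deriv_eq hcorr
    (fun t ht => by rw [hψ0 t ht, hχ0 t ht, mul_zero, sub_zero]) (by
      rw [intervalIntegral.integral_sub (hψ.continuous.intervalIntegrable _ _)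
        ((hχ.continuous.intervalIntegrable _ _).const_mul m),
        intervalIntegral.integral_const_mul, hχ1, mul_one, sub_self])
  calc ∫ t, ψ t • (u t - c) = ∫ t in a..b, ψ t • (u t - c) :=
        (intervalIntegral_eq_integral_of_forall_notMem_Ioo hab.le fun t ht => by
          rw [hψ0 t ht, zero_smul]).symm
    _ = (∫ t in a..b, ψ t • u t) - m • c := by
        simp only [smul_sub]
        rw [intervalIntegral.integral_sub (hii hψ)
          (Continuous.intervalIntegrable (by fun_prop (disch := exact hψ.continuous)) _ _),
          intervalIntegral.integral_smul_const]
    _ = ∫ t in a..b, deriv Ψ t • u t := by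
        simp only [hΨd, sub_smul, mul_smul]
        have hmχ : IntervalIntegrable (fun t => m • χ t • u t) volume a b := (hii hχ).smul m
        rw [intervalIntegral.integral_sub (hii hψ) hmχ, intervalIntegral.integral_smul]
    _ = 0 := h Ψ hΨ hΨ0

theorem integral_primitive_mul_deriv_eq_neg {f : ℝ → ℝ} (hf : IntervalIntegrable f volume a b)
    {ψ : ℝ → ℝ} (hψ : ContDiff ℝ ∞ ψ) (hψ0 : ∀ t ∉ Ioo a b, ψ t = 0) :
    ∫ t in a..b, (∫ s in a..t, f s) * deriv ψ t = -∫ t in a..b, f t * ψ t := by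
  have hF := hf.absolutelyContinuousOnInterval_intervalIntegral (c := a) left_mem_uIcc
  have hψac : AbsolutelyContinuousOnInterval ψ a b :=
    (hψ.of_le (by simp)).contDiffOn.absolutelyContinuousOnInterval
  rw [hF.integral_mul_deriv_eq_deriv_mul hψac, hψ0 a (by simp), hψ0 b (by simp), mul_zero,
    mul_zero, sub_zero, zero_sub, neg_inj]
  refine intervalIntegral.integral_congr_ae ?_
  filter_upwards [hf.ae_hasDerivAt_integral] with t ht htI
  rw [(ht (uIoc_subset_uIcc htI) a left_mem_uIcc).deriv]

theorem exists_ae_eq_const_add_integral (hab : a < b) {u f : ℝ → ℝ}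
    (hu : IntervalIntegrable u volume a b) (hf : IntervalIntegrable f volume a b)
    (h : ∀ ψ : ℝ → ℝ, ContDiff ℝ ∞ ψ → (∀ t ∉ Ioo a b, ψ t = 0) →
      -∫ t in a..b, u t * deriv ψ t = ∫ t in a..b, f t * ψ t) :
    ∃ c, ∀ᵐ t, t ∈ Ioo a b → u t = c + ∫ s in a..t, f s := by
  have hF : IntervalIntegrable (fun t => ∫ s in a..t, f s) volume a b :=
    (hf.absolutelyContinuousOnInterval_intervalIntegral left_mem_uIcc).continuousOn
      |>.intervalIntegrable
  have hzero : ∀ ψ : ℝ → ℝ, ContDiff ℝ ∞ ψ → (∀ t ∉ Ioo a b, ψ t = 0) →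
      ∫ t in a..b, deriv ψ t • (u t - ∫ s in a..t, f s) = 0 := fun ψ hψ hψ0 => by
    have hψ' : ContinuousOn (deriv ψ) (uIcc a b) :=
      (contDiff_infty_iff_deriv.1 hψ).2.continuous.continuousOn
    simp only [smul_eq_mul, mul_comm (deriv ψ _), sub_mul]
    rw [intervalIntegral.integral_sub (hu.mul_continuousOn hψ') (hF.mul_continuousOn hψ'),
      integral_primitive_mul_deriv_eq_neg hf hψ hψ0, ← h ψ hψ hψ0, neg_neg, sub_self]
  obtain ⟨c, hc⟩ :=
    exists_ae_eq_const_of_forall_integral_deriv_smul_eq_zero hab (hu.sub hF) hzero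
  exact ⟨c, hc.mono fun t ht htI => sub_eq_iff_eq_add.1 (ht htI)⟩

end DuBoisReymond

/-! ### The integral equation -/

theorem eq_add_integral_of_ae_inner_eq {E : Type*} [NormedAddCommGroup E]
    [InnerProductSpace ℝ E] [CompleteSpace E] {a b : ℝ} (hab : a < b) {w u : ℝ → E} {w₀ : E}
    (hu : IntervalIntegrable u volume a b)
    (hw : ∀ t ∈ Ioc a b, ContinuousWithinAt w (Iic t) t) (hw₀ : Tendsto w (𝓝[>] a) (𝓝 w₀))
    (h : ∀ v : E, ∃ c : ℝ, ∀ᵐ t, t ∈ Ioo a b →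
      inner ℝ v (w t) = c + ∫ s in a..t, inner ℝ v (u s)) :
    ∀ t ∈ Ioc a b, w t = w₀ + ∫ s in a..t, u s := by
  have hΦ : ContinuousOn (fun t => ∫ s in a..t, u s) (Icc a b) := by
    have := intervalIntegral.continuousOn_primitive_interval' hu left_mem_uIcc
    rwa [uIcc_of_le hab.le] at this
  have hΦleft : ∀ t ∈ Ioc a b, ContinuousWithinAt (fun t => ∫ s in a..t, u s) (Iic t) t :=
    fun t ht => (hΦ t (Ioc_subset_Icc_self ht)).mono_of_mem_nhdsWithin <|
      mem_of_superset (Ioc_mem_nhdsLE ht.1) (Ioc_subset_Icc_self.trans (Icc_subset_Icc_right ht.2))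
  have hΦ₀ : Tendsto (fun t => ∫ s in a..t, u s) (𝓝[>] a) (𝓝 0) := by
    have := (hΦ a (left_mem_Icc.2 hab.le)).tendsto.mono_left
      (nhdsWithin_le_of_mem (Icc_mem_nhdsGT hab))
    rwa [intervalIntegral.integral_same] at this
  have hinner : ∀ v, ∀ t ∈ Ioc a b, inner ℝ v (∫ s in a..t, u s) = ∫ s in a..t, inner ℝ v (u s) :=
    fun v t ht => ((innerSL ℝ v).intervalIntegral_comp_comm (hu.mono_set
      (uIcc_subset_uIcc_left (Icc_subset_uIcc (Ioc_subset_Icc_self ht))))).symm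
  intro t ht
  refine ext_inner_left ℝ fun v => ?_
  obtain ⟨c, hc⟩ := h v
  have heqOn : EqOn (fun t => inner ℝ v (w t)) (fun t => c + inner ℝ v (∫ s in a..t, u s))
      (Ioc a b) := by
    refine eqOn_of_ae_eq_of_continuousWithinAt_Iic
      (fun t ht => tendsto_const_nhds.inner (hw t ht))
      (fun t ht => tendsto_const_nhds.add (tendsto_const_nhds.inner (hΦleft t ht))) ?_
    filter_upwards [hc] with t hct ht
    rw [hct ht, hinner v t (Ioo_subset_Ioc_self ht)]
  have hcw₀ : c = inner ℝ v w₀ := by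
    have hlim := (tendsto_const_nhds (x := c)).add
      ((tendsto_const_nhds (x := v)).inner (𝕜 := ℝ) hΦ₀)
    rw [inner_zero_right, add_zero] at hlim
    refine tendsto_nhds_unique hlim ((tendsto_const_nhds.inner hw₀).congr' ?_)
    exact mem_of_superset (Ioc_mem_nhdsGT hab) heqOn
  rw [inner_add_right, ← hcw₀]
  exact heqOn ht

section IntegralEquation

variable {n : ℕ} {T : ℝ}

theorem exists_ae_inner_sub_eq_const_add_integral (hT : 0 < T) {x H u : ℝ → Vec n}
    (hx : IntervalIntegrable x volume 0 T) (hH : IntervalIntegrable H volume 0 T)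
    (hu : IntervalIntegrable u volume 0 T)
    (heq : ∀ φ, IsTestFunction T φ → derivPairing T x φ = pairing T u φ + derivPairing T H φ)
    (v : Vec n) :
    ∃ c : ℝ, ∀ᵐ t, t ∈ Ioo 0 T → inner ℝ v (x t - H t) = c + ∫ s in 0..t, inner ℝ v (u s) := by
  have hii : ∀ {y : ℝ → Vec n}, IntervalIntegrable y volume 0 T →
      IntervalIntegrable (fun t => inner ℝ v (y t)) volume 0 T :=
    fun hy => ⟨(innerSL ℝ v).integrable_comp hy.1, (innerSL ℝ v).integrable_comp hy.2⟩
  refine exists_ae_eq_const_add_integral hT (hii (hx.sub hH)) (hii hu) fun ψ hψ hψ0 => ?_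
  have hψ' := contDiff_infty_iff_deriv.1 hψ
  have hderiv : deriv (fun t => ψ t • v) = fun t => deriv ψ t • v :=
    funext fun t => deriv_smul_const (hψ'.1 t) v
  have hmul : ∀ (y : ℝ → Vec n) (η : ℝ → ℝ) (t : ℝ),
      inner ℝ (y t) (η t • v) = inner ℝ v (y t) * η t := fun y η t => by
    rw [inner_smul_right, real_inner_comm, mul_comm]
  have hint : ∀ {y : ℝ → Vec n}, IntervalIntegrable y volume 0 T →
      IntervalIntegrable (fun t => inner ℝ v (y t) * deriv ψ t) volume 0 T :=
    fun hy => (hii hy).mul_continuousOn hψ'.2.continuous.continuousOn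
  have htest := heq (fun t => ψ t • v)
    ⟨hψ.smul contDiff_const, fun t ht => by simp only [hψ0 t ht, zero_smul]⟩
  simp only [derivPairing, pairing, hderiv, hmul] at htest
  simp only [inner_sub_right, sub_mul]
  rw [intervalIntegral.integral_sub (hint hx) (hint hH)]
  linarith

variable {Om : Set (Vec n)} {f : ℝ → Vec n → ℝ → Vec n} {g : Vec n → ℝ → Vec n} {h : ℝ → ℝ}
  {lam : ℝ} {x H : ℝ → Vec n}

theorem IsSolution.tendsto_sub_primitive (hT : 0 < T) (hx : IsSolution T Om f g h lam x)
    (hH : HasKSPrimitive (fun s => g (x s) s) h 0 T H) :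
    Tendsto (fun t => x t - H t) (𝓝[>] 0) (𝓝 (x 0)) := by
  have hlim := hx.2.2.2.2.2.sub (hH.tendsto_right (left_mem_Ico.2 hT))
  rw [hH.left_eq_zero hT.le, sub_zero] at hlim
  exact hlim.congr fun t => by abel

theorem IntegratorCondition.integrableOn_primitive {G : ℝ → Vec n}
    (hh : IntegratorCondition T h) (hH : HasKSPrimitive G h 0 T H) : IntegrableOn H (Ioc 0 T) :=
  (hH.regulatedOn (regulatedOn_of_boundedVariationOn hh.1)).integrableOn_of_continuousWithinAt_Iic
    (fun t ht => hH.continuousWithinAt_Iic ht (hh.2 t ht)) volume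

theorem IsSolution.exists_primitive (hT : 0 < T) (hh : IntegratorCondition T h)
    (hx : IsSolution T Om f g h lam x) :
    ∃ H : ℝ → Vec n, HasKSPrimitive (fun s => g (x s) s) h 0 T H ∧
      ∀ t ∈ Icc 0 T, x t = x 0 + (∫ s in 0..t, f lam (x s) s) + H t := by
  have htendsto := fun H => hx.tendsto_sub_primitive (H := H) hT
  obtain ⟨hbv, hlc, -, hf, ⟨H, hH, heq⟩, -⟩ := hx
  have hi : ∀ {y : ℝ → Vec n}, IntegrableOn y (Ioc 0 T) → IntervalIntegrable y volume 0 T :=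
    (intervalIntegrable_iff_integrableOn_Ioc_of_le hT.le).2
  have hfi := hi (hf.mono_set Ioc_subset_Icc_self)
  have hxi := hi ((regulatedOn_of_boundedVariationOn hbv).integrableOn_of_continuousWithinAt_Iic
    hlc volume)
  have hHi := hi (hh.integrableOn_primitive hH)
  have hxH : ∀ t ∈ Ioc 0 T, x t - H t = x 0 + ∫ s in 0..t, f lam (x s) s :=
    eq_add_integral_of_ae_inner_eq hT hfi
      (fun t ht => (hlc t ht).sub <|
        (HasKSPrimitive.continuousWithinAt_Iic hH ht (hh.2 t ht))) (htendsto H hH)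
      (exists_ae_inner_sub_eq_const_add_integral hT hxi hHi hfi heq)
  refine ⟨H, hH, fun t ht => ?_⟩
  rcases ht.1.eq_or_lt with rfl | h0t
  · simp [HasKSPrimitive.left_eq_zero hH hT.le]
  · exact sub_eq_iff_eq_add.1 (hxH t ⟨h0t, ht.2⟩)

end IntegralEquation

/-! ### Dependence of the differential on the parameter -/

section Differential

variable {E F : Type*} [NormedAddCommGroup E] [NormedSpace ℝ E] [NormedAddCommGroup F]
  [NormedSpace ℝ F]

theorem aestronglyMeasurable_of_hasFDerivAt [FiniteDimensional ℝ E] {α : Type*}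
    [MeasurableSpace α] {κ : Measure α} {Φ : E → α → F} {A : α → E →L[ℝ] F} {y : E}
    (hA : ∀ᵐ r ∂κ, HasFDerivAt (fun w => Φ w r) (A r) y)
    (hm : ∀ᶠ w in 𝓝 y, AEStronglyMeasurable (Φ w) κ) : AEStronglyMeasurable A κ := by
  have happly : ∀ v, AEStronglyMeasurable (fun r => A r v) κ := by
    intro v
    have hc : Tendsto (fun k : ℕ => ‖(k + 1 : ℝ)‖) atTop atTop :=
      tendsto_norm_atTop_atTop.comp
        (tendsto_atTop_add_const_right _ 1 tendsto_natCast_atTop_atTop)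
    have hy : Tendsto (fun k : ℕ => y + (k + 1 : ℝ)⁻¹ • v) atTop (𝓝 y) := by
      simpa using (tendsto_one_div_add_atTop_nhds_zero_nat (𝕜 := ℝ)).smul_const v |>.const_add y
    obtain ⟨N, hN⟩ := eventually_atTop.1 (hy.eventually hm)
    refine aestronglyMeasurable_of_tendsto_ae atTop (f := fun (k : ℕ) r =>
      ((k + N : ℕ) + 1 : ℝ) • (Φ (y + ((k + N : ℕ) + 1 : ℝ)⁻¹ • v) r - Φ y r))
      (fun k => ((hN (k + N) (by omega)).sub hm.self_of_nhds).const_smul _) ?_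
    filter_upwards [hA] with r hr
    exact (hr.lim v hc).comp (tendsto_add_atTop_nat N)
  let b := Module.finBasis ℝ E
  have hsum : A = fun r => ∑ i, (b.coord i).toContinuousLinearMap.smulRight (A r (b i)) := by
    refine funext fun r => ContinuousLinearMap.ext fun v => ?_
    conv_lhs => rw [← b.sum_repr v, map_sum]
    simp
  rw [hsum]
  exact Finset.aestronglyMeasurable_fun_sum _ fun i _ =>
    (ContinuousLinearMap.smulRightL ℝ E F _).continuous.comp_aestronglyMeasurable (happly _)

theorem ae_norm_le_mul_deriv_of_norm_integral_le [CompleteSpace E] {a b C : ℝ} {u : ℝ → E}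
    {γ : ℝ → ℝ} (hab : a ≤ b) (hu : IntervalIntegrable u volume a b)
    (hγ : MonotoneOn γ (Icc a b))
    (hle : ∀ s t, a ≤ s → s ≤ t → t ≤ b → ‖∫ r in s..t, u r‖ ≤ C * (γ t - γ s)) :
    ∀ᵐ r, r ∈ Ioo a b → ‖u r‖ ≤ C * deriv γ r := by
  filter_upwards [hu.ae_hasDerivAt_integral, hγ.ae_differentiableWithinAt_of_mem]
    with r hur hγr hr
  have hrI := Ioo_subset_Icc_self hr
  rw [uIcc_of_le hab] at hur
  have hγ' := ((hγr hrI).differentiableAt (Icc_mem_nhds hr.1 hr.2)).hasDerivAt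
  refine le_of_tendsto_of_tendsto (hur hrI r hrI).tendsto_slope_zero_right.norm
    (hγ'.tendsto_slope_zero_right.const_mul C) ?_
  filter_upwards [Ioo_mem_nhdsGT (sub_pos.2 hr.2)] with t ht
  rw [intervalIntegral.integral_same, sub_zero, norm_smul, norm_inv, Real.norm_of_nonneg ht.1.le,
    smul_eq_mul, mul_left_comm]
  exact mul_le_mul_of_nonneg_left
    (hle r (r + t) hr.1.le (by linarith [ht.1]) (by linarith [ht.2])) (inv_nonneg.2 ht.1.le)

end Differential

section UniformInSpace

variable {α X E : Type*} [MeasurableSpace α] [TopologicalSpace X]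
  [TopologicalSpace.PseudoMetrizableSpace X] [SecondCountableTopology X] [NormedAddCommGroup E]
  {κ : Measure α} {S : Set X} {θ : α → ℝ}

theorem ae_forall_mem_norm_le_of_continuousOn {G : X → α → E}
    (hG : ∀ᵐ r ∂κ, ContinuousOn (fun w => G w r) S)
    (hle : ∀ w ∈ S, ∀ᵐ r ∂κ, ‖G w r‖ ≤ θ r) : ∀ᵐ r ∂κ, ∀ w ∈ S, ‖G w r‖ ≤ θ r := by
  obtain ⟨D, hDS, hD, hSD⟩ :=
    (TopologicalSpace.IsSeparable.of_separableSpace S).exists_countable_dense_subset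
  filter_upwards [hG, (ae_ball_iff hD).2 fun w hw => hle w (hDS hw)] with r hr hrD w hw
  have := mem_closure_iff_nhdsWithin_neBot.1 (hSD hw)
  exact le_of_tendsto ((hr w hw).mono hDS).norm (eventually_mem_nhdsWithin.mono hrD)

theorem ae_tendstoUniformlyOn_of_norm_sub_le {G : ℕ → X → α → E}
    {G₀ : X → α → E} (hG : ∀ k, ∀ᵐ r ∂κ, ContinuousOn (fun w => G k w r) S)
    (hG₀ : ∀ᵐ r ∂κ, ContinuousOn (fun w => G₀ w r) S)
    (hle : ∀ ε > 0, ∀ᶠ k in atTop, ∀ w ∈ S, ∀ᵐ r ∂κ, ‖G k w r - G₀ w r‖ ≤ ε * θ r) :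
    ∀ᵐ r ∂κ, TendstoUniformlyOn (fun k w => G k w r) (fun w => G₀ w r) atTop S := by
  have hle' : ∀ m : ℕ, ∀ᵐ r ∂κ, ∀ᶠ k in atTop, ∀ w ∈ S,
      ‖G k w r - G₀ w r‖ ≤ 1 / (m + 1 : ℝ) * θ r := by
    intro m
    obtain ⟨N, hN⟩ := eventually_atTop.1 (hle (1 / (m + 1)) Nat.one_div_pos_of_nat)
    have hall : ∀ᵐ r ∂κ, ∀ k, N ≤ k → ∀ w ∈ S, ‖G k w r - G₀ w r‖ ≤ 1 / (m + 1 : ℝ) * θ r := by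
      refine ae_all_iff.2 fun k => ?_
      by_cases hk : N ≤ k
      · have hsub : ∀ᵐ r ∂κ, ContinuousOn (fun w => G k w r - G₀ w r) S := by
          filter_upwards [hG k, hG₀] with r h h₀ using h.sub h₀
        filter_upwards [ae_forall_mem_norm_le_of_continuousOn hsub (hN k hk)] with r hr _ using hr
      · exact Eventually.of_forall fun r h => absurd h hk
    filter_upwards [hall] with r hr using eventually_atTop.2 ⟨N, hr⟩
  filter_upwards [ae_all_iff.2 hle'] with r hr
  refine Metric.tendstoUniformlyOn_iff.2 fun ε hε => ?_
  have hlim : Tendsto (fun m : ℕ => 1 / (m + 1 : ℝ) * θ r) atTop (𝓝 0) := by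
    simpa using tendsto_one_div_add_atTop_nhds_zero_nat.mul_const (θ r)
  obtain ⟨m, hm⟩ := (hlim.eventually (gt_mem_nhds hε)).exists
  filter_upwards [hr m] with k hk w hw
  rw [dist_comm, dist_eq_norm]
  exact (hk w hw).trans_lt hm

end UniformInSpace

section FX

variable {n : ℕ} {T : ℝ} {Lam : Set ℝ} {Om : Set (Vec n)} {f : ℝ → Vec n → ℝ → Vec n}
  {g : Vec n → ℝ → Vec n} {h : ℝ → ℝ} {lam : ℝ}

theorem DiffUniformCondition.norm_integral_fx_sub_le (hdiff : DiffUniformCondition T Lam Om f g h) :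
    ∃ γ : ℝ → ℝ, MonotoneOn γ (Icc 0 T) ∧ ∀ ε > 0, ∃ δ > 0,
      ∀ lam₁ ∈ Lam, ∀ lam₂ ∈ Lam, |lam₁ - lam₂| < δ → ∀ w ∈ Om, ∀ s t, 0 ≤ s → s ≤ t → t ≤ T →
        ‖∫ r in s..t, (fx f lam₁ w r - fx f lam₂ w r)‖ ≤ ε * (γ t - γ s) := by
  obtain ⟨γ, hγ, hle⟩ := hdiff
  refine ⟨γ, hγ, fun ε hε => ?_⟩
  obtain ⟨δ, hδ, hδle⟩ := hle ε hε
  refine ⟨δ, hδ, fun lam₁ h₁ lam₂ h₂ hlam w hw s t hs hst ht => ?_⟩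
  obtain ⟨J, hJ, hJle⟩ := hδle s ⟨hs, hst.trans ht⟩ t ⟨hs.trans hst, ht⟩ hst w hw w hw lam₁ h₁
    lam₂ h₂ (by rwa [sub_self, norm_zero, add_zero])
  simp only [sub_self] at hJ
  rwa [hJ.unique (HasKSIntegral.const hst 0), smul_zero, add_zero] at hJle

theorem DiffConditionF.integrableOn_fx (hOm : IsOpen Om)
    (hf : ∀ lam ∈ Lam, ∀ x ∈ Om, AEMeasurable (f lam x) (volume.restrict (Icc 0 T)))
    (hdf : DiffConditionF T Lam Om f) (hlam : lam ∈ Lam) {w : Vec n} (hw : w ∈ Om) :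
    IntegrableOn (fx f lam w) (Icc 0 T) := by
  obtain ⟨hd, -, θ, hθ, hle⟩ := hdf
  refine Integrable.mono' hθ (aestronglyMeasurable_of_hasFDerivAt (Φ := f lam) (y := w) ?_ ?_) ?_
  · filter_upwards [ae_restrict_mem measurableSet_Icc] with r hr
    exact (hd lam hlam w hw r hr).hasFDerivAt
  · filter_upwards [hOm.mem_nhds hw] with y hy using (hf lam hlam y hy).aestronglyMeasurable
  · filter_upwards [ae_restrict_mem measurableSet_Icc] with r hr using hle lam hlam w hw r hr

theorem DiffUniformCondition.ae_tendstoUniformlyOn_fx (hT : 0 ≤ T) (hOm : IsOpen Om)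
    (hf : ∀ lam ∈ Lam, ∀ x ∈ Om, AEMeasurable (f lam x) (volume.restrict (Icc 0 T)))
    (hdf : DiffConditionF T Lam Om f) (hdiff : DiffUniformCondition T Lam Om f g h)
    (hlam : lam ∈ Lam) {l : ℕ → ℝ} (hl : ∀ k, l k ∈ Lam) (hllam : Tendsto l atTop (𝓝 lam)) :
    ∀ᵐ r ∂volume.restrict (Ioo 0 T),
      TendstoUniformlyOn (fun k w => fx f (l k) w r) (fun w => fx f lam w r) atTop Om := by
  obtain ⟨γ, hγ, hle⟩ := hdiff.norm_integral_fx_sub_le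
  have hcont : ∀ lam ∈ Lam, ∀ᵐ r ∂volume.restrict (Ioo 0 T),
      ContinuousOn (fun w => fx f lam w r) Om := by
    intro lam hlam
    filter_upwards [ae_restrict_mem measurableSet_Ioo] with r hr
    exact hdf.2.1 lam hlam r (Ioo_subset_Icc_self hr)
  have hint : ∀ lam ∈ Lam, ∀ w ∈ Om, IntervalIntegrable (fx f lam w) volume 0 T :=
    fun lam hlam w hw => (intervalIntegrable_iff_integrableOn_Ioc_of_le hT).2
      ((hdf.integrableOn_fx hOm hf hlam hw).mono_set Ioc_subset_Icc_self)
  refine ae_tendstoUniformlyOn_of_norm_sub_le (θ := deriv γ) (fun k => hcont _ (hl k))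
    (hcont lam hlam) fun ε hε => ?_
  obtain ⟨δ, hδ, hδle⟩ := hle ε hε
  filter_upwards [Metric.tendsto_nhds.1 hllam δ hδ] with k hk w hw
  exact (ae_restrict_iff' measurableSet_Ioo).2 (ae_norm_le_mul_deriv_of_norm_integral_le hT
    ((hint _ (hl k) w hw).sub (hint lam hlam w hw)) hγ
    (hδle (l k) (hl k) lam hlam hk w hw))

end FX

/-! ### Limits of primitives -/

section Limits

variable {F : Type*} [NormedAddCommGroup F] [NormedSpace ℝ F] {a b : ℝ}

theorem IsPolar.exists_hasKSPrimitive_of_tendsto [CompleteSpace F] {h : ℝ → ℝ} {μ : Measure ℝ}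
    {σ : ℝ → ℝ} (hp : IsPolar a b h μ σ) {G H : ℕ → ℝ → F} {G₀ : ℝ → F} {θ : ℝ → ℝ}
    (hG : ∀ k, IntegrableOn (G k) (Ico a b) μ) (hH : ∀ k, HasKSPrimitive (G k) h a b (H k))
    (hθ : IntegrableOn θ (Ico a b) μ) (hle : ∀ k, ∀ x ∈ Ico a b, ‖G k x‖ ≤ θ x)
    (hlim : ∀ᵐ x ∂μ.restrict (Ico a b), Tendsto (fun k => G k x) atTop (𝓝 (G₀ x))) :
    ∃ H₀, HasKSPrimitive G₀ h a b H₀ ∧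
      ∀ t ∈ Icc a b, Tendsto (fun k => H k t) atTop (𝓝 (H₀ t)) := by
  have hle' : ∀ k, ∀ᵐ x ∂μ.restrict (Ico a b), ‖G k x‖ ≤ θ x := fun k =>
    (ae_restrict_mem measurableSet_Ico).mono (hle k)
  have hG₀ : IntegrableOn G₀ (Ico a b) μ := by
    refine hθ.mono' (aestronglyMeasurable_of_tendsto_ae atTop (fun k => (hG k).1) hlim) ?_
    filter_upwards [hlim, ae_all_iff.2 hle'] with x hx hxle
    exact le_of_tendsto hx.norm (Eventually.of_forall hxle)
  refine ⟨_, hp.hasKSPrimitive hG₀, fun t ht => ?_⟩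
  have hrestrict : μ.restrict (Ico a t) ≤ μ.restrict (Ico a b) :=
    Measure.restrict_mono (Ico_subset_Ico_right ht.2) le_rfl
  have hHt : ∀ k, H k t = ∫ x in Ico a t, σ x • G k x ∂μ := fun k =>
    (hH k t ht).unique (hp.hasKSPrimitive (hG k) t ht)
  simp only [hHt]
  refine tendsto_integral_of_dominated_convergence θ
    (fun k => (hp.integrableOn_smul (hG k)).1.mono_measure hrestrict)
    (hθ.mono_set (Ico_subset_Ico_right ht.2)) (fun k => ?_) ?_
  · filter_upwards [ae_mono hrestrict (hle' k)] with x hx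
    rwa [hp.norm_smul]
  · filter_upwards [ae_mono hrestrict hlim] with x hx using hx.const_smul (σ x)

theorem hasKSPrimitive_intervalIntegral [CompleteSpace F] {u : ℝ → F}
    (hu : IntegrableOn u (Icc a b)) :
    HasKSPrimitive u (fun t => t) a b fun t => ∫ s in a..t, u s := by
  have hu' : IntegrableOn u (Ico a b) (volume.restrict (Icc a b)) :=
    (hu.mono_measure Measure.restrict_le_self).mono_set
      Ico_subset_Icc_self
  intro t ht
  convert (isPolar_id a b).hasKSPrimitive hu' t ht using 1
  simp only [one_smul]
  rw [intervalIntegral.integral_of_le ht.1, ← integral_Ico_eq_integral_Ioc,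
    Measure.restrict_restrict measurableSet_Ico,
    inter_eq_left.2 (Ico_subset_Icc_self.trans (Icc_subset_Icc_right ht.2))]

end Limits

/-! ### Compactness of functions with dominated increments -/

section Compactness

variable {E : Type*} [NormedAddCommGroup E]

theorem exists_subseq_tendstoUniformly_of_lipschitzWith [ProperSpace E] {X : Type*} [MetricSpace X]
    [CompactSpace X] {K : NNReal} {u : ℕ → X → E} (hu : ∀ k, LipschitzWith K (u k)) {M : ℝ}
    (hM : ∀ k x, ‖u k x‖ ≤ M) :
    ∃ φ : ℕ → ℕ, StrictMono φ ∧ ∃ w : X → E, TendstoUniformly (fun k => u (φ k)) w atTop := by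
  let U : ℕ → BoundedContinuousFunction X E := fun k =>
    BoundedContinuousFunction.mkOfCompact ⟨u k, (hu k).continuous⟩
  have hcompact : IsCompact (closure (range U)) := by
    refine BoundedContinuousFunction.arzela_ascoli (Metric.closedBall 0 M)
      (isCompact_closedBall _ _) _ ?_ ?_
    · rintro _ x ⟨k, rfl⟩
      exact mem_closedBall_zero_iff.2 (hM k x)
    · refine (LipschitzWith.uniformEquicontinuous _ K ?_).equicontinuous
      rintro ⟨_, k, rfl⟩
      exact hu k
  obtain ⟨w, -, φ, hφ, hlim⟩ :=
    hcompact.tendsto_subseq fun k => subset_closure (mem_range_self (f := U) k)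
  exact ⟨φ, hφ, w, BoundedContinuousFunction.tendsto_iff_tendstoUniformly.1 hlim⟩

theorem exists_lipschitzWith_comp_eq [NormedSpace ℝ E] [FiniteDimensional ℝ E] {α : Type*}
    [LinearOrder α] {S : Set α} {y : α → E} {Γ : α → ℝ}
    (hΓ : ∀ s ∈ S, ∀ t ∈ S, s ≤ t → ‖y t - y s‖ ≤ Γ t - Γ s) :
    ∃ u : ℝ → E, LipschitzWith (lipschitzExtensionConstant E) u ∧ ∀ t ∈ S, u (Γ t) = y t := by
  have hy : ∀ s ∈ S, ∀ t ∈ S, ‖y s - y t‖ ≤ |Γ s - Γ t| := by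
    intro s hs t ht
    rcases le_total s t with hst | hts
    · rw [norm_sub_rev, abs_sub_comm]
      exact (hΓ s hs t ht hst).trans (le_abs_self _)
    · exact (hΓ t ht s hs hts).trans (le_abs_self _)
  rcases S.eq_empty_or_nonempty with rfl | ⟨t₀, -⟩
  · exact ⟨0, (LipschitzWith.const _).weaken zero_le, fun t ht => ht.elim⟩
  have : Nonempty α := ⟨t₀⟩
  have hinv : ∀ r ∈ Γ '' S, Function.invFunOn Γ S r ∈ S ∧ Γ (Function.invFunOn Γ S r) = r :=
    fun r hr => ⟨Function.invFunOn_mem hr, Function.invFunOn_eq hr⟩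
  have hlip : LipschitzOnWith 1 (fun r => y (Function.invFunOn Γ S r)) (Γ '' S) := by
    refine LipschitzOnWith.of_dist_le_mul fun r hr r' hr' => ?_
    rw [dist_eq_norm, NNReal.coe_one, one_mul, Real.dist_eq]
    simpa only [(hinv r hr).2, (hinv r' hr').2] using hy _ (hinv r hr).1 _ (hinv r' hr').1
  obtain ⟨u, hu, huy⟩ := hlip.extend_finite_dimension
  refine ⟨u, by rwa [mul_one] at hu, fun t ht => ?_⟩
  have hΓt := mem_image_of_mem Γ ht
  have hnorm := hy _ (hinv _ hΓt).1 t ht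
  rw [(hinv _ hΓt).2, sub_self, abs_zero] at hnorm
  rw [← huy hΓt]
  exact sub_eq_zero.1 (norm_le_zero_iff.1 hnorm)

/-- A function whose increments are dominated by those of `Γ` is a Lipschitz function of `Γ`, which
reduces the claim to equi-Lipschitz sequences. -/
theorem exists_subseq_tendstoUniformlyOn_of_norm_sub_le [NormedSpace ℝ E] [FiniteDimensional ℝ E]
    {a b M : ℝ} {y : ℕ → ℝ → E} {Γ : ℝ → ℝ} (hM : ∀ k, ‖y k a‖ ≤ M)
    (hΓ : ∀ k s t, a ≤ s → s ≤ t → t ≤ b → ‖y k t - y k s‖ ≤ Γ t - Γ s) :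
    ∃ φ : ℕ → ℕ, StrictMono φ ∧ ∃ z : ℝ → E, RegulatedOn z a b ∧
      TendstoUniformlyOn (fun k => y (φ k)) z atTop (Icc a b) := by
  have := FiniteDimensional.proper_real E
  choose u hu huy using fun k => exists_lipschitzWith_comp_eq (S := Icc a b)
    fun s hs t ht hst => hΓ k s t hs.1 hst ht.2
  rcases lt_or_ge b a with hba | hab
  · refine ⟨id, strictMono_id, 0, regulatedOn_const 0, ?_⟩
    rw [Icc_eq_empty hba.not_ge]
    exact tendstoUniformlyOn_empty
  have hmono : ∀ s t, a ≤ s → s ≤ t → t ≤ b → Γ s ≤ Γ t := fun s t hs hst ht =>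
    sub_nonneg.1 ((norm_nonneg _).trans (hΓ 0 s t hs hst ht))
  have hΓab := hmono a b le_rfl hab le_rfl
  have hΓmem : ∀ t ∈ Icc a b, Γ t ∈ Icc (Γ a) (Γ b) := fun t ht =>
    ⟨hmono a t le_rfl ht.1 ht.2, hmono t b ht.1 ht.2 le_rfl⟩
  have hbound : ∀ k, ∀ r : Icc (Γ a) (Γ b),
      ‖u k r‖ ≤ M + lipschitzExtensionConstant E * (Γ b - Γ a) := by
    intro k r
    have ha : ‖u k (Γ a)‖ ≤ M := by
      rw [huy k a ⟨le_rfl, hab⟩]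
      exact hM k
    have hsub : ‖u k r - u k (Γ a)‖ ≤ lipschitzExtensionConstant E * (Γ b - Γ a) := by
      refine ((hu k).norm_sub_le _ _).trans ?_
      rw [Real.norm_of_nonneg (sub_nonneg.2 r.2.1)]
      gcongr
      exact r.2.2
    exact (norm_le_norm_add_norm_sub' _ _).trans (add_le_add ha hsub)
  obtain ⟨φ, hφ, w, hw⟩ := exists_subseq_tendstoUniformly_of_lipschitzWith
    (fun k => (hu k).comp (LipschitzWith.subtype_val _)) hbound
  have hlim : TendstoUniformlyOn (fun k => y (φ k))
      (fun t => w (projIcc (Γ a) (Γ b) hΓab (Γ t))) atTop (Icc a b) := by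
    refine ((hw.comp fun t => projIcc (Γ a) (Γ b) hΓab (Γ t)).tendstoUniformlyOn
      (s := Icc a b)).congr (Eventually.of_forall fun k t ht => ?_)
    simp only [Function.comp_apply, projIcc_of_mem hΓab (hΓmem t ht), huy _ t ht]
  refine ⟨φ, hφ, _, ?_, hlim⟩
  refine regulatedOn_of_boundedVariationOn (boundedVariationOn_of_norm_sub_le (V := Γ)
    fun s t hs hst ht => ?_)
  exact le_of_tendsto ((hlim.tendsto_at ⟨hs.trans hst, ht⟩).sub
    (hlim.tendsto_at ⟨hs, hst.trans ht⟩)).norm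
    (Eventually.of_forall fun k => hΓ (φ k) s t hs hst ht)

end Compactness

/-! ### Difference quotients of solutions -/

section Calculus

variable {E F : Type*} [NormedAddCommGroup E] [NormedSpace ℝ E] [NormedAddCommGroup F]
  [NormedSpace ℝ F]

theorem norm_smul_image_sub_le {Φ : E → F} {x y : E} {K M c : ℝ}
    (hd : ∀ w ∈ segment ℝ x y, DifferentiableAt ℝ Φ w)
    (hK : ∀ w ∈ segment ℝ x y, ‖fderiv ℝ Φ w‖ ≤ K) (hM : ‖c • (y - x)‖ ≤ M) :
    ‖c • (Φ y - Φ x)‖ ≤ K * M := by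
  have hK₀ : 0 ≤ K := (norm_nonneg _).trans (hK x (left_mem_segment ℝ x y))
  calc ‖c • (Φ y - Φ x)‖ = ‖c‖ * ‖Φ y - Φ x‖ := norm_smul _ _
    _ ≤ ‖c‖ * (K * ‖y - x‖) := by
        gcongr
        exact (convex_segment x y).norm_image_sub_le_of_norm_fderiv_le hd hK
          (left_mem_segment ℝ x y) (right_mem_segment ℝ x y)
    _ = K * ‖c • (y - x)‖ := by rw [norm_smul]; ring
    _ ≤ K * M := by gcongr

theorem tendsto_smul_of_sub_isLittleO {ι : Type*} {l : Filter ι} {L : E →L[ℝ] F} {u : ι → F}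
    {v : ι → E} {c : ι → ℝ} {z : E} (hu : (fun k => u k - L (v k)) =o[l] v)
    (hz : Tendsto (fun k => c k • v k) l (𝓝 z)) : Tendsto (fun k => c k • u k) l (𝓝 (L z)) := by
  have hzero : Tendsto (fun k => c k • (u k - L (v k))) l (𝓝 0) :=
    (((Asymptotics.isBigO_refl c l).smul_isLittleO hu).trans_isBigO
      (hz.isBigO_one ℝ)).tendsto_zero_of_tendsto tendsto_const_nhds
  have hadd := hzero.add ((L.continuous.tendsto z).comp hz)
  simpa only [Function.comp_apply, smul_sub, map_smul, sub_add_cancel, zero_add] using hadd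

theorem tendsto_smul_sub_of_hasFDerivAt {ι : Type*} {l : Filter ι} {Φ : E → F} {L : E →L[ℝ] F}
    {x : ι → E} {x₀ z : E} {c : ι → ℝ} (hΦ : HasFDerivAt Φ L x₀) (hx : Tendsto x l (𝓝 x₀))
    (hz : Tendsto (fun k => c k • (x k - x₀)) l (𝓝 z)) :
    Tendsto (fun k => c k • (Φ (x k) - Φ x₀)) l (𝓝 (L z)) :=
  tendsto_smul_of_sub_isLittleO (hΦ.isLittleO.comp_tendsto hx) hz

theorem tendsto_smul_sub_of_tendstoUniformlyOn_fderiv {ι : Type*} {l : Filter ι} {S : Set E}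
    {Φ : ι → E → F} {L : E → E →L[ℝ] F} {x : ι → E} {x₀ z : E} {c : ι → ℝ}
    (hd : ∀ k, ∀ w ∈ S, DifferentiableAt ℝ (Φ k) w)
    (hunif : TendstoUniformlyOn (fun k => fderiv ℝ (Φ k)) L l S) (hL : ContinuousWithinAt L S x₀)
    (hseg : ∀ k, segment ℝ x₀ (x k) ⊆ S) (hx : Tendsto x l (𝓝 x₀))
    (hz : Tendsto (fun k => c k • (x k - x₀)) l (𝓝 z)) :
    Tendsto (fun k => c k • (Φ k (x k) - Φ k x₀)) l (𝓝 (L x₀ z)) := by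
  refine tendsto_smul_of_sub_isLittleO (Asymptotics.isLittleO_iff.2 fun ε hε => ?_) hz
  obtain ⟨r, hr, hLr⟩ := Metric.continuousWithinAt_iff.1 hL (ε / 2) (half_pos hε)
  filter_upwards [Metric.tendstoUniformlyOn_iff.1 hunif (ε / 2) (half_pos hε),
    hx (Metric.ball_mem_nhds x₀ hr)] with k hk hxk
  refine (convex_segment x₀ (x k)).norm_image_sub_le_of_norm_fderiv_le'
    (fun w hw => hd k w (hseg k hw)) (fun w hw => ?_) (left_mem_segment ℝ x₀ (x k))
    (right_mem_segment ℝ x₀ (x k))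
  have hball := (convex_ball x₀ r).segment_subset (Metric.mem_ball_self hr) hxk hw
  have hdist := (dist_triangle_left (fderiv ℝ (Φ k) w) (L x₀) (L w)).trans
    (add_lt_add (hk w (hseg k hw)) (hLr (hseg k hw) hball)).le
  rwa [add_halves, dist_eq_norm] at hdist

end Calculus

section Quotients

theorem IsPolar.norm_add_le {F : Type*} [NormedAddCommGroup F] [NormedSpace ℝ F]
    {a b s t C : ℝ} {h : ℝ → ℝ} {μ : Measure ℝ} {σ θ : ℝ → ℝ} {p q : ℝ → F} {I J : F}
    (hp : IsPolar a b h μ σ) (hs : a ≤ s) (ht : t ≤ b) (hI : HasKSIntegral p (fun t => t) s t I)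
    (hJ : HasKSIntegral q h s t J) (hθ : IntegrableOn θ (Icc s t))
    (hpθ : ∀ τ ∈ Icc s t, ‖p τ‖ ≤ θ τ) (hqC : ∀ τ ∈ Icc s t, ‖q τ‖ ≤ C) :
    ‖I + J‖ ≤ (∫ r in s..t, θ r) + C * μ.real (Ico s t) := by
  have := hp.isFiniteMeasure
  have hst := hI.1
  have hIle : ‖I‖ ≤ ∫ r in s..t, θ r :=
    hI.norm_le (hasKSPrimitive_intervalIntegral hθ t ⟨hst, le_rfl⟩) fun u τ v hu huτ hτv hv => by
      have huv := sub_nonneg.2 (huτ.trans hτv)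
      rw [abs_of_nonneg huv]
      exact mul_le_mul_of_nonneg_left (hpθ τ ⟨hu.trans huτ, hτv.trans hv⟩) huv
  have hJle : ‖J‖ ≤ (μ.real (Ico s t) - μ.real (Ico s s)) • C :=
    hJ.norm_le (HasKSIntegral.const (h := fun t => μ.real (Ico s t)) hst C)
      fun u τ v hu huτ hτv hv => by
        rw [measureReal_Ico_sub hu (huτ.trans hτv)]
        exact mul_le_mul (hp.abs_sub_le (hs.trans hu) (huτ.trans hτv) (hv.trans ht))
          (hqC τ ⟨hu.trans huτ, hτv.trans hv⟩) (norm_nonneg _) measureReal_nonneg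
  rw [measureReal_Ico_sub le_rfl hst, smul_eq_mul, mul_comm] at hJle
  exact norm_add_le_of_le hIle hJle

theorem IsPolar.norm_sub_add_sub_le {F : Type*} [NormedAddCommGroup F] [NormedSpace ℝ F]
    {a b C : ℝ} {h : ℝ → ℝ} {μ : Measure ℝ} {σ θ : ℝ → ℝ} {p q I J : ℝ → F}
    (hp : IsPolar a b h μ σ) (hI : HasKSPrimitive p (fun t => t) a b I)
    (hJ : HasKSPrimitive q h a b J) (hθ : IntegrableOn θ (Icc a b))
    (hpθ : ∀ t ∈ Icc a b, ‖p t‖ ≤ θ t) (hqC : ∀ t ∈ Icc a b, ‖q t‖ ≤ C) {s t : ℝ} (hs : a ≤ s)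
    (hst : s ≤ t) (ht : t ≤ b) :
    ‖(I t - I s) + (J t - J s)‖ ≤ ((∫ r in a..t, θ r) + C * μ.real (Ico a t)) -
      ((∫ r in a..s, θ r) + C * μ.real (Ico a s)) := by
  have := hp.isFiniteMeasure
  have hsub : Icc s t ⊆ Icc a b := Icc_subset_Icc hs ht
  have hθi : ∀ u ∈ Icc a b, IntervalIntegrable θ volume a u := fun u hu =>
    (intervalIntegrable_iff_integrableOn_Icc_of_le hu.1).2 (hθ.mono_set (Icc_subset_Icc_right hu.2))
  rw [add_sub_add_comm, ← mul_sub, measureReal_Ico_sub hs hst,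
    intervalIntegral.integral_interval_sub_left (hθi t ⟨hs.trans hst, ht⟩)
      (hθi s ⟨hs, hst.trans ht⟩)]
  exact hp.norm_add_le hs ht (hI.hasKSIntegral hs hst ht) (hJ.hasKSIntegral hs hst ht)
    (hθ.mono_set hsub) (fun τ hτ => hpθ τ (hsub hτ)) fun τ hτ => hqC τ (hsub hτ)

variable {n : ℕ} {T ρ : ℝ} {Lam : Set ℝ} {Om : Set (Vec n)} {f : ℝ → Vec n → ℝ → Vec n}
  {g : Vec n → ℝ → Vec n} {h : ℝ → ℝ} {x₀ : ℝ → Vec n}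

theorem TrivialBranch.segment_subset (hx₀ : TrivialBranch T Lam Om f g h x₀ ρ) {x : ℝ → Vec n}
    (hx : MemBall T x₀ ρ x) : ∀ t ∈ Icc 0 T, segment ℝ (x₀ t) (x t) ⊆ Om := by
  rintro t ht _ ⟨a, b, ha, hb, hab, rfl⟩
  have hb₁ : b ≤ 1 := by linarith
  refine hx₀.2.2 (fun s => a • x₀ s + b • x s)
    ⟨(hx₀.1.const_smul a).add (hx.1.const_smul b), fun s hs => ?_⟩ t ht
  have hcomb : a • x₀ s + b • x s - x₀ s = b • (x s - x₀ s) := by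
    rw [eq_sub_of_add_eq hab]
    module
  rw [hcomb, norm_smul, Real.norm_of_nonneg hb]
  exact (mul_le_of_le_one_left (norm_nonneg _) hb₁).trans (hx.2 s hs)

theorem IsSolution.exists_quotient_primitives (hT : 0 < T) (hh : IntegratorCondition T h)
    {lam : ℝ} {x y : ℝ → Vec n} (hx : IsSolution T Om f g h lam x)
    (hy : IsSolution T Om f g h lam y) (c : ℝ) :
    ∃ I J, HasKSPrimitive (fun s => c • (f lam (y s) s - f lam (x s) s)) (fun t => t) 0 T I ∧
      HasKSPrimitive (fun s => c • (g (y s) s - g (x s) s)) h 0 T J ∧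
      ∀ t ∈ Icc 0 T, c • (y t - x t) = c • (y 0 - x 0) + I t + J t := by
  obtain ⟨H, hH, hxH⟩ := hx.exists_primitive hT hh
  obtain ⟨K, hK, hyK⟩ := hy.exists_primitive hT hh
  refine ⟨_, _, fun t ht => ((hasKSPrimitive_intervalIntegral hy.2.2.2.1 t ht).sub
    (hasKSPrimitive_intervalIntegral hx.2.2.2.1 t ht)).const_smul c,
    fun t ht => ((hK t ht).sub (hH t ht)).const_smul c, fun t ht => ?_⟩
  rw [hyK t ht, hxH t ht]
  module

end Quotients

/-! ### Sequences of nontrivial solutions -/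

section BifurcatingSequence

theorem exists_forall_norm_le_two_mul {α E : Type*} [NormedAddCommGroup E] {S : Set α} {u : α → E}
    {C : ℝ} (hC : ∀ t ∈ S, ‖u t‖ ≤ C) (hne : ∃ t ∈ S, u t ≠ 0) :
    ∃ τ ∈ S, u τ ≠ 0 ∧ ∀ t ∈ S, ‖u t‖ ≤ 2 * ‖u τ‖ := by
  obtain ⟨t₀, ht₀, hut₀⟩ := hne
  have hbdd : BddAbove ((fun t => ‖u t‖) '' S) := ⟨C, forall_mem_image.2 hC⟩
  have hle : ∀ t ∈ S, ‖u t‖ ≤ sSup ((fun t => ‖u t‖) '' S) := fun t ht =>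
    le_csSup hbdd (mem_image_of_mem _ ht)
  have hpos := (norm_pos_iff.2 hut₀).trans_le (hle t₀ ht₀)
  obtain ⟨_, ⟨τ, hτ, rfl⟩, hlt⟩ :=
    exists_lt_of_lt_csSup ((nonempty_of_mem ht₀).image _) (half_lt_self hpos)
  refine ⟨τ, hτ, norm_pos_iff.1 ((half_pos hpos).trans hlt), fun t ht => (hle t ht).trans ?_⟩
  linarith

variable {n : ℕ} {T ρ lam₀ : ℝ} {Lam : Set ℝ} {Om : Set (Vec n)} {f : ℝ → Vec n → ℝ → Vec n}
  {g : Vec n → ℝ → Vec n} {h : ℝ → ℝ} {x₀ : ℝ → Vec n}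

/-- Periodic solutions `(x k, l k)` in the ball `B(x₀, ρ)` which converge to `(x₀, lam₀)`, together
with factors `c k` normalizing `x k - x₀`. Since the supremum norm of a regulated function need not
be attained, the normalization is only up to a factor of two. -/
structure IsBifurcatingSequence (T : ℝ) (Lam : Set ℝ) (Om : Set (Vec n))
    (f : ℝ → Vec n → ℝ → Vec n) (g : Vec n → ℝ → Vec n) (h : ℝ → ℝ) (ρ : ℝ) (x₀ : ℝ → Vec n)
    (lam₀ : ℝ) (l : ℕ → ℝ) (x : ℕ → ℝ → Vec n) (c : ℕ → ℝ) : Prop where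
  param_mem : ∀ k, l k ∈ Lam
  tendsto_param : Tendsto l atTop (𝓝 lam₀)
  memBall : ∀ k, MemBall T x₀ ρ (x k)
  isPeriodicSolution : ∀ k, IsPeriodicSolution T Om f g h (l k) (x k)
  tendsto : ∀ t ∈ Icc 0 T, Tendsto (fun k => x k t) atTop (𝓝 (x₀ t))
  norm_smul_le : ∀ k, ∀ t ∈ Icc 0 T, ‖c k • (x k t - x₀ t)‖ ≤ 2
  exists_norm_smul_eq : ∀ k, ∃ t ∈ Icc 0 T, ‖c k • (x k t - x₀ t)‖ = 1

theorem IsBifurcationPoint.exists_isBifurcatingSequence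
    (hbif : IsBifurcationPoint T Lam Om f g h ρ x₀ lam₀) :
    ∃ l x c, IsBifurcatingSequence T Lam Om f g h ρ x₀ lam₀ l x c := by
  choose l hl x hxB hlε hxε hxS hne using fun k : ℕ =>
    hbif.2.2.2 (1 / ((k : ℝ) + 1)) Nat.one_div_pos_of_nat
  choose τ hτ hτne hτle using fun k => exists_forall_norm_le_two_mul (u := fun t => x k t - x₀ t)
    (hxB k).2 ((hne k).imp fun t ht => ⟨ht.1, sub_ne_zero.2 ht.2⟩)
  have hc : ∀ k (v : Vec n), ‖‖x k (τ k) - x₀ (τ k)‖⁻¹ • v‖ = ‖v‖ / ‖x k (τ k) - x₀ (τ k)‖ :=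
    fun k v => by rw [norm_smul, norm_inv, norm_norm, inv_mul_eq_div]
  exact ⟨l, x, fun k => ‖x k (τ k) - x₀ (τ k)‖⁻¹,
    { param_mem := hl
      tendsto_param := tendsto_iff_norm_sub_tendsto_zero.2 <|
        squeeze_zero (fun _ => norm_nonneg _) (fun k => (hlε k).le)
          tendsto_one_div_add_atTop_nhds_zero_nat
      memBall := hxB
      isPeriodicSolution := hxS
      tendsto := fun t ht => tendsto_iff_norm_sub_tendsto_zero.2 <|
        squeeze_zero (fun _ => norm_nonneg _) (fun k => (hxε k t ht).le)
          tendsto_one_div_add_atTop_nhds_zero_nat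
      norm_smul_le := fun k t ht => by
        rw [hc, div_le_iff₀ (norm_pos_iff.2 (hτne k))]
        exact hτle k t ht
      exists_norm_smul_eq := fun k => ⟨τ k, hτ k, by
        rw [hc, div_self (norm_ne_zero_iff.2 (hτne k))]⟩ }⟩

namespace IsBifurcatingSequence

variable {l c : ℕ → ℝ} {x : ℕ → ℝ → Vec n} {z : ℝ → Vec n}

theorem comp (hs : IsBifurcatingSequence T Lam Om f g h ρ x₀ lam₀ l x c) {φ : ℕ → ℕ}
    (hφ : StrictMono φ) :
    IsBifurcatingSequence T Lam Om f g h ρ x₀ lam₀ (fun k => l (φ k)) (fun k => x (φ k))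
      (fun k => c (φ k)) where
  param_mem k := hs.param_mem (φ k)
  tendsto_param := hs.tendsto_param.comp hφ.tendsto_atTop
  memBall k := hs.memBall (φ k)
  isPeriodicSolution k := hs.isPeriodicSolution (φ k)
  tendsto t ht := (hs.tendsto t ht).comp hφ.tendsto_atTop
  norm_smul_le k := hs.norm_smul_le (φ k)
  exists_norm_smul_eq k := hs.exists_norm_smul_eq (φ k)

theorem exists_ne_zero (hs : IsBifurcatingSequence T Lam Om f g h ρ x₀ lam₀ l x c)
    (hz : TendstoUniformlyOn (fun k t => c k • (x k t - x₀ t)) z atTop (Icc 0 T)) :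
    ∃ t ∈ Icc 0 T, z t ≠ 0 := by
  obtain ⟨k, hk⟩ := (Metric.tendstoUniformlyOn_iff.1 hz 1 one_pos).exists
  obtain ⟨t, ht, hone⟩ := hs.exists_norm_smul_eq k
  refine ⟨t, ht, fun hzero => ?_⟩
  have hlt := hk t ht
  rw [hzero, dist_zero_left, hone] at hlt
  exact hlt.false

theorem norm_smul_f_sub_le (hs : IsBifurcatingSequence T Lam Om f g h ρ x₀ lam₀ l x c)
    (hx₀ : TrivialBranch T Lam Om f g h x₀ ρ)
    (hdf : ∀ lam ∈ Lam, ∀ x ∈ Om, ∀ t ∈ Icc 0 T, DifferentiableAt ℝ (fun y => f lam y t) x)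
    {θ : ℝ → ℝ} (hθ : ∀ lam ∈ Lam, ∀ x ∈ Om, ∀ t ∈ Icc 0 T, ‖fx f lam x t‖ ≤ θ t) (k : ℕ) {t : ℝ}
    (ht : t ∈ Icc 0 T) : ‖c k • (f (l k) (x k t) t - f (l k) (x₀ t) t)‖ ≤ θ t * 2 :=
  have hseg := hx₀.segment_subset (hs.memBall k) t ht
  norm_smul_image_sub_le (Φ := fun w => f (l k) w t)
    (fun w hw => hdf _ (hs.param_mem k) w (hseg hw) t ht)
    (fun w hw => hθ _ (hs.param_mem k) w (hseg hw) t ht) (hs.norm_smul_le k t ht)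

theorem norm_smul_g_sub_le (hs : IsBifurcatingSequence T Lam Om f g h ρ x₀ lam₀ l x c)
    (hx₀ : TrivialBranch T Lam Om f g h x₀ ρ)
    (hdg : ∀ x ∈ Om, ∀ t ∈ Icc 0 T, DifferentiableAt ℝ (fun y => g y t) x) {C : ℝ}
    (hC : ∀ x ∈ Om, ∀ t ∈ Icc 0 T, ‖gx g x t‖ ≤ C) (k : ℕ) {t : ℝ} (ht : t ∈ Icc 0 T) :
    ‖c k • (g (x k t) t - g (x₀ t) t)‖ ≤ C * 2 :=
  have hseg := hx₀.segment_subset (hs.memBall k) t ht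
  norm_smul_image_sub_le (Φ := fun w => g w t) (fun w hw => hdg w (hseg hw) t ht)
    (fun w hw => hC w (hseg hw) t ht) (hs.norm_smul_le k t ht)

theorem exists_subseq_tendstoUniformlyOn
    (hs : IsBifurcatingSequence T Lam Om f g h ρ x₀ lam₀ l x c) (hT : 0 < T)
    (hh : IntegratorCondition T h) (hdf : DiffConditionF T Lam Om f)
    (hdg : ∀ x ∈ Om, ∀ t ∈ Icc 0 T, DifferentiableAt ℝ (fun y => g y t) x) {C : ℝ}
    (hC : ∀ x ∈ Om, ∀ t ∈ Icc 0 T, ‖gx g x t‖ ≤ C)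
    (hx₀ : TrivialBranch T Lam Om f g h x₀ ρ) :
    ∃ φ : ℕ → ℕ, StrictMono φ ∧ ∃ z : ℝ → Vec n, RegulatedOn z 0 T ∧
      TendstoUniformlyOn (fun k t => c (φ k) • (x (φ k) t - x₀ t)) z atTop (Icc 0 T) := by
  obtain ⟨μ, σ, hp⟩ := exists_isPolar hT.le hh.1 hh.2
  obtain ⟨θ, hθi, hθ⟩ := hdf.2.2
  refine exists_subseq_tendstoUniformlyOn_of_norm_sub_le
    (y := fun k t => c k • (x k t - x₀ t))
    (Γ := fun t => (∫ r in (0 : ℝ)..t, θ r * 2) + C * 2 * μ.real (Ico 0 t))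
    (fun k => hs.norm_smul_le k 0 ⟨le_rfl, hT.le⟩)
    fun k s t hs₀ hst ht => ?_
  obtain ⟨I, J, hI, hJ, heq⟩ := (hx₀.2.1 _ (hs.param_mem k)).1.exists_quotient_primitives hT hh
    (hs.isPeriodicSolution k).1 (c k)
  have hIJ := hp.norm_sub_add_sub_le hI hJ (hθi.mul_const 2)
    (fun t ht => hs.norm_smul_f_sub_le hx₀ hdf.1 hθ k ht)
    (fun t ht => hs.norm_smul_g_sub_le hx₀ hdg hC k ht) hs₀ hst ht
  rw [heq t ⟨hs₀.trans hst, ht⟩, heq s ⟨hs₀, hst.trans ht⟩, add_assoc, add_assoc,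
    add_sub_add_left_eq_sub, add_sub_add_comm]
  exact hIJ

theorem exists_hasKSPrimitive_fx (hs : IsBifurcatingSequence T Lam Om f g h ρ x₀ lam₀ l x c)
    (hT : 0 < T) (hOm : IsOpen Om)
    (hf : ∀ lam ∈ Lam, ∀ x ∈ Om, AEMeasurable (f lam x) (volume.restrict (Icc 0 T)))
    (hdf : DiffConditionF T Lam Om f) (hx₀ : TrivialBranch T Lam Om f g h x₀ ρ)
    (hdiff : DiffUniformCondition T Lam Om f g h) (hlam₀ : lam₀ ∈ Lam)
    (hz : ∀ t ∈ Icc 0 T, Tendsto (fun k => c k • (x k t - x₀ t)) atTop (𝓝 (z t)))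
    {I : ℕ → ℝ → Vec n} (hI : ∀ k, HasKSPrimitive
      (fun r => c k • (f (l k) (x k r) r - f (l k) (x₀ r) r)) (fun t => t) 0 T (I k)) :
    ∃ I₀, HasKSPrimitive (fun r => fx f lam₀ (x₀ r) r (z r)) (fun t => t) 0 T I₀ ∧
      ∀ t ∈ Icc 0 T, Tendsto (fun k => I k t) atTop (𝓝 (I₀ t)) := by
  obtain ⟨θ, hθi, hθ⟩ := hdf.2.2
  have hmono : ∀ {E : Type} [NormedAddCommGroup E] {u : ℝ → E}, IntegrableOn u (Icc 0 T) →
      IntegrableOn u (Ico 0 T) (volume.restrict (Icc 0 T)) := fun hu =>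
    (hu.mono_measure Measure.restrict_le_self).mono_set Ico_subset_Icc_self
  refine (isPolar_id 0 T).exists_hasKSPrimitive_of_tendsto
    (fun k => hmono (((hs.isPeriodicSolution k).1.2.2.2.1.sub
      (hx₀.2.1 _ (hs.param_mem k)).1.2.2.2.1).smul (c k))) hI (hmono (hθi.mul_const 2))
    (fun k t ht => hs.norm_smul_f_sub_le hx₀ hdf.1 hθ k (Ico_subset_Icc_self ht)) ?_
  have hunif := hdiff.ae_tendstoUniformlyOn_fx hT.le hOm hf hdf hlam₀ hs.param_mem hs.tendsto_param
  rw [Measure.restrict_restrict measurableSet_Ico, inter_eq_left.2 Ico_subset_Icc_self,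
    restrict_Ico_eq_restrict_Ioc, ← restrict_Ioo_eq_restrict_Ioc]
  filter_upwards [hunif, ae_restrict_mem measurableSet_Ioo] with r hr hr₀
  have hrT := Ioo_subset_Icc_self hr₀
  exact tendsto_smul_sub_of_tendstoUniformlyOn_fderiv (Φ := fun k w => f (l k) w r)
    (fun k w hw => hdf.1 _ (hs.param_mem k) w hw r hrT) hr
    (hdf.2.1 lam₀ hlam₀ r hrT _ ((hx₀.2.1 lam₀ hlam₀).1.2.2.1 r hrT))
    (fun k => hx₀.segment_subset (hs.memBall k) r hrT) (hs.tendsto r hrT) (hz r hrT)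

theorem exists_hasKSPrimitive_gx (hs : IsBifurcatingSequence T Lam Om f g h ρ x₀ lam₀ l x c)
    (hT : 0 < T) (hh : IntegratorCondition T h)
    (hdg : ∀ x ∈ Om, ∀ t ∈ Icc 0 T, DifferentiableAt ℝ (fun y => g y t) x) {C : ℝ}
    (hC : ∀ x ∈ Om, ∀ t ∈ Icc 0 T, ‖gx g x t‖ ≤ C)
    (hx₀ : TrivialBranch T Lam Om f g h x₀ ρ)
    (hz : ∀ t ∈ Icc 0 T, Tendsto (fun k => c k • (x k t - x₀ t)) atTop (𝓝 (z t)))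
    {J : ℕ → ℝ → Vec n}
    (hJ : ∀ k, HasKSPrimitive (fun r => c k • (g (x k r) r - g (x₀ r) r)) h 0 T (J k)) :
    ∃ J₀, HasKSPrimitive (fun r => gx g (x₀ r) r (z r)) h 0 T J₀ ∧
      ∀ t ∈ Icc 0 T, Tendsto (fun k => J k t) atTop (𝓝 (J₀ t)) := by
  obtain ⟨μ, σ, hp⟩ := exists_isPolar hT.le hh.1 hh.2
  have := hp.isFiniteMeasure
  have hle : ∀ k, ∀ t ∈ Icc 0 T, ‖c k • (g (x k t) t - g (x₀ t) t)‖ ≤ C * 2 := fun k t ht =>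
    hs.norm_smul_g_sub_le hx₀ hdg hC k ht
  refine hp.exists_hasKSPrimitive_of_tendsto
    (fun k => hp.integrableOn_of_hasKSPrimitive hT (hle k) (hJ k)) hJ (integrable_const (C * 2))
    (fun k t ht => hle k t (Ico_subset_Icc_self ht)) ?_
  filter_upwards [ae_restrict_mem measurableSet_Ico] with t ht
  have htT := Ico_subset_Icc_self ht
  exact tendsto_smul_sub_of_hasFDerivAt (Φ := fun w => g w t)
    (hdg _ ((hx₀.2.1 _ (hs.param_mem 0)).1.2.2.1 t htT) t htT).hasFDerivAt (hs.tendsto t htT)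
    (hz t htT)

theorem isLinearSolution (hs : IsBifurcatingSequence T Lam Om f g h ρ x₀ lam₀ l x c)
    (hT : 0 < T) (hOm : IsOpen Om) (hh : IntegratorCondition T h)
    (hf : ∀ lam ∈ Lam, ∀ x ∈ Om, AEMeasurable (f lam x) (volume.restrict (Icc 0 T)))
    (hdf : DiffConditionF T Lam Om f)
    (hdg : ∀ x ∈ Om, ∀ t ∈ Icc 0 T, DifferentiableAt ℝ (fun y => g y t) x) {C : ℝ}
    (hC : ∀ x ∈ Om, ∀ t ∈ Icc 0 T, ‖gx g x t‖ ≤ C)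
    (hx₀ : TrivialBranch T Lam Om f g h x₀ ρ) (hdiff : DiffUniformCondition T Lam Om f g h)
    (hlam₀ : lam₀ ∈ Lam) (hzr : RegulatedOn z 0 T)
    (hz : ∀ t ∈ Icc 0 T, Tendsto (fun k => c k • (x k t - x₀ t)) atTop (𝓝 (z t))) :
    IsLinearSolution T (fun τ => fx f lam₀ (x₀ τ) τ) (fun τ => gx g (x₀ τ) τ) h (fun _ => 0) z := by
  choose I J hI hJ heq using fun k =>
    (hx₀.2.1 _ (hs.param_mem k)).1.exists_quotient_primitives hT hh
    (hs.isPeriodicSolution k).1 (c k)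
  obtain ⟨I₀, hI₀, hIlim⟩ := hs.exists_hasKSPrimitive_fx hT hOm hf hdf hx₀ hdiff hlam₀ hz hI
  obtain ⟨J₀, hJ₀, hJlim⟩ := hs.exists_hasKSPrimitive_gx hT hh hdg hC hx₀ hz hJ
  have h0 : (0 : ℝ) ∈ Icc 0 T := ⟨le_rfl, hT.le⟩
  have hT' : T ∈ Icc 0 T := ⟨hT.le, le_rfl⟩
  have hperiodic : z 0 = z T := by
    refine tendsto_nhds_unique (hz 0 h0) ((hz T hT').congr fun k => ?_)
    rw [(hs.isPeriodicSolution k).2, (hx₀.2.1 _ hlam₀).2]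
  refine ⟨hzr, fun t ht => ⟨I₀ t, J₀ t, hI₀ t ht, hJ₀ t ht, ?_⟩⟩
  have heqlim : z t = z 0 + I₀ t + J₀ t := tendsto_nhds_unique (hz t ht) <|
    (((hz 0 h0).add (hIlim t ht)).add (hJlim t ht)).congr fun k => (heq k t ht).symm
  simp only [heqlim, ← hperiodic]
  abel

end IsBifurcatingSequence

theorem IsBifurcationPoint.exists_isLinearSolution
    (hbif : IsBifurcationPoint T Lam Om f g h ρ x₀ lam₀) (hT : 0 < T) (hOm : IsOpen Om)
    (hh : IntegratorCondition T h)
    (hf : ∀ lam ∈ Lam, ∀ x ∈ Om, AEMeasurable (f lam x) (volume.restrict (Icc 0 T)))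
    (hdf : DiffConditionF T Lam Om f)
    (hdg : ∀ x ∈ Om, ∀ t ∈ Icc 0 T, DifferentiableAt ℝ (fun y => g y t) x) {C : ℝ}
    (hC : ∀ x ∈ Om, ∀ t ∈ Icc 0 T, ‖gx g x t‖ ≤ C)
    (hx₀ : TrivialBranch T Lam Om f g h x₀ ρ) (hdiff : DiffUniformCondition T Lam Om f g h) :
    ∃ z, IsLinearSolution T (fun τ => fx f lam₀ (x₀ τ) τ) (fun τ => gx g (x₀ τ) τ) h
      (fun _ => 0) z ∧ ∃ t ∈ Icc 0 T, z t ≠ 0 := by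
  obtain ⟨l, x, c, hs⟩ := hbif.exists_isBifurcatingSequence
  obtain ⟨φ, hφ, z, hzr, hz⟩ := hs.exists_subseq_tendstoUniformlyOn hT hh hdf hdg hC hx₀
  exact ⟨z, (hs.comp hφ).isLinearSolution hT hOm hh hf hdf hdg hC hx₀ hdiff hbif.2.1 hzr
    fun t ht => hz.tendsto_at ht, (hs.comp hφ).exists_ne_zero hz⟩

end BifurcatingSequence

/-! ### Uniqueness for linear equations -/

theorem forall_mem_Icc_of_left_of_right {a b : ℝ} {P : ℝ → Prop}
    (hleft : ∀ τ ∈ Icc a b, (∀ r ∈ Ico a τ, P r) → P τ)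
    (hright : ∀ τ ∈ Ico a b, (∀ r ∈ Icc a τ, P r) → ∃ c > τ, ∀ r ∈ Ioc τ c, P r) :
    ∀ t ∈ Icc a b, P t := by
  by_contra! hne
  let S := {t ∈ Icc a b | ¬ P t}
  have hS : S.Nonempty := hne
  have hbdd : BddBelow S := ⟨a, fun t ht => ht.1.1⟩
  have hτ : sInf S ∈ Icc a b := by
    obtain ⟨t, ht⟩ := hS
    exact ⟨le_csInf ⟨t, ht⟩ fun t ht => ht.1.1, (csInf_le hbdd ht).trans ht.1.2⟩
  have hbelow : ∀ r ∈ Ico a (sInf S), P r := fun r hr => by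
    by_contra hPr
    exact hr.2.not_ge (csInf_le hbdd ⟨⟨hr.1, hr.2.le.trans hτ.2⟩, hPr⟩)
  have hPτ := hleft _ hτ hbelow
  have hτmem : ∀ t ∈ S, sInf S < t := fun t ht =>
    (csInf_le hbdd ht).lt_of_ne fun heq => ht.2 (heq ▸ hPτ)
  obtain ⟨t₀, ht₀⟩ := hS
  obtain ⟨c, hc, hPc⟩ := hright _ ⟨hτ.1, (hτmem t₀ ht₀).trans_le ht₀.1.2⟩ fun r hr =>
    hr.2.eq_or_lt.elim (fun heq => heq ▸ hPτ) fun hlt => hbelow r ⟨hr.1, hlt⟩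
  obtain ⟨t, ht, htc⟩ := exists_lt_of_csInf_lt ⟨t₀, ht₀⟩ hc
  exact ht.2 (hPc t ⟨hτmem t ht, htc.le⟩)

theorem tendsto_measureReal_Ioo_right (μ : Measure ℝ) [IsFiniteMeasure μ] (t : ℝ) :
    Tendsto (fun s => μ.real (Ioo t s)) (𝓝[>] t) (𝓝 0) := by
  have hlim := tendsto_measure_biInter_gt (μ := μ) (s := fun r => Ioo t r) (a := t)
    (fun r _ => measurableSet_Ioo.nullMeasurableSet) (fun i j _ hij => Ioo_subset_Ioo_right hij)
    ⟨t + 1, lt_add_one t, measure_ne_top _ _⟩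
  have hempty : ⋂ r > t, Ioo t r = ∅ := by
    refine eq_empty_of_forall_notMem fun x hx => ?_
    simp only [mem_iInter] at hx
    exact (hx x (hx (t + 1) (lt_add_one t)).1).2.false
  rw [hempty, measure_empty] at hlim
  exact (ENNReal.tendsto_toReal ENNReal.zero_ne_top).comp hlim

theorem tendsto_intervalIntegral_nhdsGT {F : Type*} [NormedAddCommGroup F] [NormedSpace ℝ F]
    {a b : ℝ} {u : ℝ → F} (hu : IntegrableOn u (Icc a b)) {τ : ℝ} (hτ : τ ∈ Ico a b) :
    Tendsto (fun t => ∫ r in τ..t, u r) (𝓝[>] τ) (𝓝 0) := by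
  have hcont := intervalIntegral.continuousOn_primitive_interval (a := τ) (b := b) (f := u)
    (μ := volume) (by
      rw [uIcc_of_le hτ.2.le]
      exact hu.mono_set (Icc_subset_Icc_left hτ.1))
  rw [uIcc_of_le hτ.2.le] at hcont
  simpa only [intervalIntegral.integral_same] using
    (hcont τ (left_mem_Icc.2 hτ.2.le)).tendsto.mono_left
      (nhdsWithin_le_of_mem (Icc_mem_nhdsGT hτ.2))

section Uniqueness

variable {E : Type*} [NormedAddCommGroup E] [NormedSpace ℝ E] {a b C : ℝ} {h θ : ℝ → ℝ}
  {A B : ℝ → E →L[ℝ] E} {z I J : ℝ → E}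

theorem eq_zero_of_forall_Ico_eq_zero (hh : ∀ t ∈ Ioc a b, ContinuousWithinAt h (Iic t) t)
    (hI : HasKSPrimitive (fun τ => A τ (z τ)) (fun t => t) a b I)
    (hJ : HasKSPrimitive (fun τ => B τ (z τ)) h a b J) (hz : ∀ t ∈ Icc a b, z t = I t + J t)
    {τ : ℝ} (hτ : τ ∈ Icc a b) (hzero : ∀ r ∈ Ico a τ, z r = 0) : z τ = 0 := by
  rcases hτ.1.eq_or_lt with rfl | haτ
  · rw [hz _ hτ, hI.left_eq_zero hτ.2, hJ.left_eq_zero hτ.2, add_zero]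
  have hcont : ContinuousWithinAt (fun t => I t + J t) (Iio τ) τ :=
    ((hI.continuousWithinAt_Iic ⟨haτ, hτ.2⟩ continuousWithinAt_id).add
      (hJ.continuousWithinAt_Iic ⟨haτ, hτ.2⟩ (hh τ ⟨haτ, hτ.2⟩))).mono Iio_subset_Iic_self
  rw [hz τ hτ]
  refine tendsto_nhds_unique hcont.tendsto (tendsto_const_nhds.congr' ?_)
  filter_upwards [Ioo_mem_nhdsLT haτ] with r hr
  rw [← hz r ⟨hr.1.le, hr.2.le.trans hτ.2⟩, hzero r ⟨hr.1.le, hr.2⟩]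

theorem HasKSPrimitive.tendsto_nhdsGT_of_eq_zero {G H : ℝ → E} (hH : HasKSPrimitive G h a b H)
    {τ : ℝ} (hτ : τ ∈ Ico a b) (hG : G τ = 0) : Tendsto H (𝓝[>] τ) (𝓝 (H τ)) := by
  have hlim := hH.tendsto_right hτ
  simp only [hG, smul_zero, sub_zero] at hlim
  exact tendsto_sub_nhds_zero_iff.1 hlim

theorem tendsto_nhdsGT_zero_of_eq_zero
    (hI : HasKSPrimitive (fun τ => A τ (z τ)) (fun t => t) a b I)
    (hJ : HasKSPrimitive (fun τ => B τ (z τ)) h a b J) (hz : ∀ t ∈ Icc a b, z t = I t + J t)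
    {τ : ℝ} (hτ : τ ∈ Ico a b) (hzτ : z τ = 0) : Tendsto z (𝓝[>] τ) (𝓝 0) := by
  rw [← hzτ, hz τ (Ico_subset_Icc_self hτ)]
  refine ((hI.tendsto_nhdsGT_of_eq_zero hτ (by rw [hzτ, map_zero])).add
    (hJ.tendsto_nhdsGT_of_eq_zero hτ (by rw [hzτ, map_zero]))).congr' ?_
  filter_upwards [Ioo_mem_nhdsGT hτ.2] with s hs
  exact (hz s ⟨hτ.1.trans hs.1.le, hs.2.le⟩).symm

variable {μ : Measure ℝ} {σ : ℝ → ℝ} {s t M : ℝ}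

theorem IsPolar.norm_sub_le_mul (hp : IsPolar a b h μ σ) (hθ : IntegrableOn θ (Icc a b))
    (hA : ∀ t ∈ Icc a b, ‖A t‖ ≤ θ t) (hB : ∀ t ∈ Icc a b, ‖B t‖ ≤ C)
    (hI : HasKSPrimitive (fun τ => A τ (z τ)) (fun t => t) a b I)
    (hJ : HasKSPrimitive (fun τ => B τ (z τ)) h a b J) (hz : ∀ t ∈ Icc a b, z t = I t + J t)
    (hs : a ≤ s) (hst : s ≤ t) (ht : t ≤ b) (hM : ∀ r ∈ Icc s t, ‖z r‖ ≤ M) :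
    ‖z t - z s‖ ≤ ((∫ r in s..t, θ r) + C * μ.real (Ico s t)) * M := by
  have hsub : Icc s t ⊆ Icc a b := Icc_subset_Icc hs ht
  have hincr := hp.norm_add_le hs ht (hI.hasKSIntegral hs hst ht) (hJ.hasKSIntegral hs hst ht)
    ((hθ.mono_set hsub).mul_const M)
    (fun r hr => (A r).le_of_opNorm_le_of_le (hA r (hsub hr)) (hM r hr))
    (fun r hr => (B r).le_of_opNorm_le_of_le (hB r (hsub hr)) (hM r hr))
  rw [intervalIntegral.integral_mul_const, mul_right_comm, ← add_mul] at hincr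
  rwa [hz t (hsub ⟨hst, le_rfl⟩), hz s (hsub ⟨le_rfl, hst⟩), add_sub_add_comm]

/-- Since `z τ = 0`, a jump of `h` at `τ` does not contribute to the increment of `z`. -/
theorem IsPolar.norm_le_mul_of_eq_zero (hp : IsPolar a b h μ σ) (hθ : IntegrableOn θ (Icc a b))
    (hA : ∀ t ∈ Icc a b, ‖A t‖ ≤ θ t) (hB : ∀ t ∈ Icc a b, ‖B t‖ ≤ C)
    (hI : HasKSPrimitive (fun τ => A τ (z τ)) (fun t => t) a b I)
    (hJ : HasKSPrimitive (fun τ => B τ (z τ)) h a b J) (hz : ∀ t ∈ Icc a b, z t = I t + J t)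
    {τ : ℝ} (hτ : a ≤ τ) (hτt : τ < t) (ht : t ≤ b) (hzτ : z τ = 0)
    (hM : ∀ r ∈ Ioc τ t, ‖z r‖ ≤ M) :
    ‖z t‖ ≤ ((∫ r in τ..t, θ r) + C * μ.real (Ioo τ t)) * M := by
  have := hp.isFiniteMeasure
  have hM₀ : 0 ≤ M := (norm_nonneg _).trans (hM t ⟨hτt, le_rfl⟩)
  have hC₀ : 0 ≤ C := (norm_nonneg _).trans (hB τ ⟨hτ, hτt.le.trans ht⟩)
  have hθ₀ : 0 ≤ᵐ[volume.restrict (Ioc τ t)] θ :=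
    (ae_restrict_mem measurableSet_Ioc).mono fun r hr =>
      (norm_nonneg _).trans (hA r ⟨hτ.trans hr.1.le, hr.2.trans ht⟩)
  have hlim : Tendsto (fun s => ‖z t - z s‖) (𝓝[>] τ) (𝓝 ‖z t‖) := by
    simpa only [sub_zero] using (tendsto_const_nhds.sub
      (tendsto_nhdsGT_zero_of_eq_zero hI hJ hz ⟨hτ, hτt.trans_le ht⟩ hzτ)).norm
  refine le_of_tendsto hlim ?_
  filter_upwards [Ioo_mem_nhdsGT hτt] with s hs
  refine (hp.norm_sub_le_mul hθ hA hB hI hJ hz (hτ.trans hs.1.le) hs.2.le ht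
    fun r hr => hM r ⟨hs.1.trans_le hr.1, hr.2⟩).trans ?_
  gcongr
  · exact intervalIntegral.integral_mono_interval hs.1.le hs.2.le le_rfl hθ₀
      ((intervalIntegrable_iff_integrableOn_Icc_of_le hτt.le).2
        (hθ.mono_set (Icc_subset_Icc hτ ht)))
  · exact measure_ne_top _ _
  · exact hs.1

theorem eq_zero_of_eq_add_primitives (hbv : BoundedVariationOn h (Icc a b))
    (hh : ∀ t ∈ Ioc a b, ContinuousWithinAt h (Iic t) t)
    (hθ : IntegrableOn θ (Icc a b)) (hA : ∀ t ∈ Icc a b, ‖A t‖ ≤ θ t)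
    (hB : ∀ t ∈ Icc a b, ‖B t‖ ≤ C) (hI : HasKSPrimitive (fun τ => A τ (z τ)) (fun t => t) a b I)
    (hJ : HasKSPrimitive (fun τ => B τ (z τ)) h a b J) (hz : ∀ t ∈ Icc a b, z t = I t + J t)
    (hzr : RegulatedOn z a b) : ∀ t ∈ Icc a b, z t = 0 := by
  refine forall_mem_Icc_of_left_of_right
    (fun τ hτ => eq_zero_of_forall_Ico_eq_zero hh hI hJ hz hτ) fun τ hτ hzero => ?_
  obtain ⟨μ, σ, hp⟩ := exists_isPolar (hτ.1.trans hτ.2.le) hbv hh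
  have := hp.isFiniteMeasure
  obtain ⟨M, hM⟩ := hzr.exists_norm_le
  have hκ : Tendsto (fun t => (∫ r in τ..t, θ r) + C * μ.real (Ioo τ t)) (𝓝[>] τ) (𝓝 0) := by
    simpa using (tendsto_intervalIntegral_nhdsGT hθ hτ).add
      ((tendsto_measureReal_Ioo_right μ τ).const_mul C)
  obtain ⟨c, hc, hκc⟩ := mem_nhdsGT_iff_exists_Ioc_subset.1
    ((hκ.eventually_lt_const one_half_pos).and (Ioo_mem_nhdsGT hτ.2))
  refine ⟨c, hc, ?_⟩
  by_contra! hne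
  obtain ⟨s, hs, hzs, hsup⟩ := exists_forall_norm_le_two_mul
    (fun t ht => hM t ⟨hτ.1.trans ht.1.le, (hκc ht).2.2.le⟩) hne
  have hle := hp.norm_le_mul_of_eq_zero hθ hA hB hI hJ hz hτ.1 hs.1 (hκc hs).2.2.le
    (hzero τ ⟨hτ.1, le_rfl⟩) fun r hr => hsup r ⟨hr.1, hr.2.trans hs.2⟩
  have hpos := norm_pos_iff.2 hzs
  have hlt := mul_lt_mul_of_pos_right (hκc hs).1 (mul_pos two_pos hpos)
  linarith

end Uniqueness

/-! ### Linear periodic problems -/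

theorem ker_le_ker_of_surjective_of_ker_le_ker {K V W : Type*} [Field K] [AddCommGroup V]
    [Module K V] [AddCommGroup W] [Module K W] [FiniteDimensional K W] {S D : V →ₗ[K] W}
    (hSD : LinearMap.ker S ≤ LinearMap.ker D) (hD : Function.Surjective D) :
    LinearMap.ker D ≤ LinearMap.ker S := by
  obtain ⟨R, hR⟩ := D.exists_rightInverse_of_surjective (LinearMap.range_eq_top.2 hD)
  have hDR : ∀ w, D (R w) = w := LinearMap.congr_fun hR
  have hinj : Function.Injective (S ∘ₗ R) :=
    (injective_iff_map_eq_zero _).2 fun w hw => (hDR w).symm.trans (hSD hw)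
  intro v hv
  obtain ⟨w, hw⟩ := LinearMap.surjective_of_injective hinj (S v)
  have hvR : v - R w ∈ LinearMap.ker D := hSD (by
    rw [LinearMap.mem_ker, map_sub, ← hw, LinearMap.comp_apply, sub_self])
  have hw₀ : w = 0 := by
    simpa only [LinearMap.mem_ker, map_sub, LinearMap.mem_ker.1 hv, hDR, zero_sub, neg_eq_zero]
      using hvR
  rw [LinearMap.mem_ker, ← hw, hw₀, map_zero]

section LinearSolutions

variable {n : ℕ} {T : ℝ} {A B : ℝ → Vec n →L[ℝ] Vec n} {h : ℝ → ℝ} {q q' z w : ℝ → Vec n}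

theorem IsLinearSolution.add (hz : IsLinearSolution T A B h q z)
    (hw : IsLinearSolution T A B h q' w) :
    IsLinearSolution T A B h (fun t => q t + q' t) (fun t => z t + w t) := by
  refine ⟨hz.1.add hw.1, fun t ht => ?_⟩
  obtain ⟨I, J, hI, hJ, hq⟩ := hz.2 t ht
  obtain ⟨I', J', hI', hJ', hq'⟩ := hw.2 t ht
  refine ⟨I + I', J + J', ?_, ?_, ?_⟩
  · simpa only [map_add] using hI.add hI'
  · simpa only [map_add] using hJ.add hJ'
  · simp only [← hq, ← hq']
    abel

theorem IsLinearSolution.const_smul (hz : IsLinearSolution T A B h q z) (r : ℝ) :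
    IsLinearSolution T A B h (fun t => r • q t) (fun t => r • z t) := by
  refine ⟨hz.1.const_smul r, fun t ht => ?_⟩
  obtain ⟨I, J, hI, hJ, hq⟩ := hz.2 t ht
  refine ⟨r • I, r • J, ?_, ?_, ?_⟩
  · simpa only [map_smul] using hI.const_smul r
  · simpa only [map_smul] using hJ.const_smul r
  · simp only [← hq, smul_sub]

theorem IsLinearSolution.apply_zero (hz : IsLinearSolution T A B h q z) (hT : 0 ≤ T) :
    q 0 = z 0 - z T := by
  obtain ⟨I, J, hI, hJ, hq⟩ := hz.2 0 (left_mem_Icc.2 hT)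
  rw [← hq, hI.eq_zero, hJ.eq_zero, sub_zero, sub_zero]

theorem isLinearSolution_zero : IsLinearSolution T A B h (fun _ => 0) fun _ => 0 := by
  refine ⟨regulatedOn_const 0, fun t ht => ⟨0, 0, ?_, ?_, by simp only [sub_zero]⟩⟩
  · simpa only [map_zero, smul_zero] using HasKSIntegral.const ht.1 (0 : Vec n)
  · simpa only [map_zero, smul_zero] using HasKSIntegral.const ht.1 (0 : Vec n)

/-- The space of regulated solutions of `z(t) = z(0) + ∫_0^t A(τ) z(τ) dτ + ∫_0^t B(τ) z(τ) dh(τ)`,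
the linear equation without a boundary condition. -/
def linearSolutions (T : ℝ) (A B : ℝ → Vec n →L[ℝ] Vec n) (h : ℝ → ℝ) :
    Submodule ℝ (ℝ → Vec n) where
  carrier := {z | IsLinearSolution T A B h (fun _ => z 0 - z T) z}
  add_mem' hz hw := by
    simpa only [← add_sub_add_comm] using! hz.add hw
  zero_mem' := by
    simpa only [mem_ofPred_eq, Pi.zero_apply, sub_zero] using! isLinearSolution_zero
  smul_mem' r z hz := by
    simpa only [smul_sub] using! IsLinearSolution.const_smul hz r

theorem IsLinearSolution.mem_linearSolutions {c : Vec n} (hT : 0 ≤ T)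
    (hz : IsLinearSolution T A B h (fun _ => c) z) : z ∈ linearSolutions T A B h := by
  have hc := hz.apply_zero hT
  subst hc
  exact hz

theorem linearSolutions.eq_zero_of_apply_zero_eq_zero (hh : IntegratorCondition T h) {θ : ℝ → ℝ}
    {C : ℝ} (hθ : IntegrableOn θ (Icc 0 T)) (hA : ∀ t ∈ Icc 0 T, ‖A t‖ ≤ θ t)
    (hB : ∀ t ∈ Icc 0 T, ‖B t‖ ≤ C) (hz : z ∈ linearSolutions T A B h) (hz₀ : z 0 = 0) :
    ∀ t ∈ Icc 0 T, z t = 0 := by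
  choose! I J hI hJ hIJ using hz.2
  refine eq_zero_of_eq_add_primitives hh.1 hh.2 hθ hA hB hI hJ (fun t ht => ?_) hz.1
  have heq := hIJ t ht
  rw [hz₀, zero_sub, sub_sub, sub_right_comm, sub_eq_neg_self, sub_eq_zero] at heq
  exact heq

theorem IsLinearSolution.exists_const_forall_not (hz : IsLinearSolution T A B h (fun _ => 0) z)
    (hne : ∃ t ∈ Icc 0 T, z t ≠ 0) (hh : IntegratorCondition T h) {θ : ℝ → ℝ} {C : ℝ}
    (hθ : IntegrableOn θ (Icc 0 T)) (hA : ∀ t ∈ Icc 0 T, ‖A t‖ ≤ θ t)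
    (hB : ∀ t ∈ Icc 0 T, ‖B t‖ ≤ C) :
    ∃ c : Vec n, ∀ w, ¬ IsLinearSolution T A B h (fun _ => c) w := by
  obtain ⟨t, ht, hzt⟩ := hne
  have hT : 0 ≤ T := ht.1.trans ht.2
  by_contra! hsolv
  let S : linearSolutions T A B h →ₗ[ℝ] Vec n := LinearMap.proj 0 ∘ₗ Submodule.subtype _
  let D : linearSolutions T A B h →ₗ[ℝ] Vec n := S - LinearMap.proj T ∘ₗ Submodule.subtype _
  have hunique : ∀ w : linearSolutions T A B h, S w = 0 → ∀ t ∈ Icc 0 T, (w : ℝ → Vec n) t = 0 :=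
    fun w hw => linearSolutions.eq_zero_of_apply_zero_eq_zero hh hθ hA hB w.2 hw
  have hSD : LinearMap.ker S ≤ LinearMap.ker D := fun w hw =>
    (congrArg₂ _ hw (hunique w hw T (right_mem_Icc.2 hT))).trans (sub_zero 0)
  have hD : Function.Surjective D := fun c => by
    obtain ⟨w, hw⟩ := hsolv c
    exact ⟨⟨w, hw.mem_linearSolutions hT⟩, (hw.apply_zero hT).symm⟩
  exact hzt (hunique ⟨z, hz.mem_linearSolutions hT⟩
    (ker_le_ker_of_surjective_of_ker_le_ker hSD hD (hz.apply_zero hT).symm) t ht)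

end LinearSolutions

end MeasureDE

theorem mainTheorem3_general {n : ℕ} {T : ℝ} (hT : 0 < T) {Lam : Set ℝ}
    {Om : Set (MeasureDE.Vec n)} (hOm : IsOpen Om)
    {f : ℝ → MeasureDE.Vec n → ℝ → MeasureDE.Vec n} {g : MeasureDE.Vec n → ℝ → MeasureDE.Vec n}
    {h : ℝ → ℝ} (hh : MeasureDE.IntegratorCondition T h)
    (hf : ∀ lam ∈ Lam, ∀ x ∈ Om, AEMeasurable (f lam x) (volume.restrict (Icc 0 T)))
    (hdf : MeasureDE.DiffConditionF T Lam Om f)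
    (hdg : ∀ x ∈ Om, ∀ t ∈ Icc 0 T, DifferentiableAt ℝ (fun y => g y t) x)
    (hgx : ∃ C : ℝ, ∀ x ∈ Om, ∀ t ∈ Icc 0 T, ‖MeasureDE.gx g x t‖ ≤ C)
    {x₀ : ℝ → MeasureDE.Vec n} {ρ : ℝ} (hx₀ : MeasureDE.TrivialBranch T Lam Om f g h x₀ ρ)
    (hdiff : MeasureDE.DiffUniformCondition T Lam Om f g h) {lam₀ : ℝ}
    (hbif : MeasureDE.IsBifurcationPoint T Lam Om f g h ρ x₀ lam₀) :
    (∃ c : MeasureDE.Vec n, ∀ z, ¬ MeasureDE.IsLinearSolution T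
      (fun τ => MeasureDE.fx f lam₀ (x₀ τ) τ) (fun τ => MeasureDE.gx g (x₀ τ) τ) h (fun _ => c) z) ∧
    ∃ z, MeasureDE.IsLinearSolution T (fun τ => MeasureDE.fx f lam₀ (x₀ τ) τ)
      (fun τ => MeasureDE.gx g (x₀ τ) τ) h (fun _ => 0) z ∧ ∃ t ∈ Icc 0 T, z t ≠ 0 := by
  obtain ⟨C, hC⟩ := hgx
  obtain ⟨θ, hθint, hθ⟩ := hdf.2.2
  have hx₀Om : ∀ t ∈ Icc 0 T, x₀ t ∈ Om := (hx₀.2.1 lam₀ hbif.2.1).1.2.2.1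
  obtain ⟨z, hz, hne⟩ := hbif.exists_isLinearSolution hT hOm hh hf hdf hdg hC hx₀ hdiff
  exact ⟨hz.exists_const_forall_not hne hh hθint
    (fun t ht => hθ lam₀ hbif.2.1 _ (hx₀Om t ht) t ht) (fun t ht => hC _ (hx₀Om t ht) t ht),
    z, hz, hne⟩

theorem mainTheorem3 {n : ℕ} (T : ℝ) (hT : 0 < T)
    (Lam : Set ℝ) (hLam : IsOpen Lam)
    (Om : Set (MeasureDE.Vec n)) (hOm : IsOpen Om)
    (f : ℝ → MeasureDE.Vec n → ℝ → MeasureDE.Vec n)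
    (g : MeasureDE.Vec n → ℝ → MeasureDE.Vec n)
    (h : ℝ → ℝ)
    (hh : MeasureDE.IntegratorCondition T h)
    (hf : MeasureDE.CaratheodoryCondition T Lam Om f)
    (hg : MeasureDE.StieltjesCondition T Om g h)
    (hdf : MeasureDE.DiffConditionF T Lam Om f)
    (hdg : MeasureDE.DiffConditionG T Om g h)
    (x₀ : ℝ → MeasureDE.Vec n) (ρ : ℝ) (hρ : 0 < ρ)
    (hx₀ : MeasureDE.TrivialBranch T Lam Om f g h x₀ ρ)
    (hpar : MeasureDE.ParameterCondition T Lam Om f)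
    (hdiff : MeasureDE.DiffUniformCondition T Lam Om f g h)
    (lam₀ : ℝ)
    (hbif : MeasureDE.IsBifurcationPoint T Lam Om f g h ρ x₀ lam₀) :
    (∃ q : ℝ → MeasureDE.Vec n, MeasureDE.RegulatedOn q 0 T ∧
      ¬ ∃ z : ℝ → MeasureDE.Vec n,
        MeasureDE.IsLinearSolution T (fun τ => MeasureDE.fx f lam₀ (x₀ τ) τ)
          (fun τ => MeasureDE.gx g (x₀ τ) τ) h q z) ∧
    (∃ z : ℝ → MeasureDE.Vec n,
      MeasureDE.IsLinearSolution T (fun τ => MeasureDE.fx f lam₀ (x₀ τ) τ)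
        (fun τ => MeasureDE.gx g (x₀ τ) τ) h (fun _ => 0) z ∧
      ∃ t ∈ Set.Icc 0 T, z t ≠ 0) := by
  obtain ⟨⟨c, hc⟩, hz⟩ :=
    mainTheorem3_general hT hOm hh hf.2.1 hdf hdg.1 hdg.2.1 hx₀ hdiff hbif
  exact ⟨⟨fun _ => c, MeasureDE.regulatedOn_const c, not_exists.2 hc⟩, hz⟩
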